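/- **Setting.** Graphs are finite undirected multigraphs (parallel edges allowed, no loops). For a graph $G=(V,E)$, $d_G(v)$ is the number of edges incident with $v$. For a vertex order $\sigma$ of $G$, the left-degree $\overleftarrow{d}(v)$ (right-degree $\overrightarrow{d}(v)$) is the number of edges joining $v$ to vertices preceding (following) $v$ in $\sigma$. An $s$-$t$ order of a graph is a vertex order with $s$ first and $t$ last in which every vertex $v\ne s,t$ of degree at least $2$ has $\overleftarrow{d}(v)\ge 1$ and $\overrightarrow{d}(v)\ge 1$. The biconnected components of a connected graph $G$ are its maximal subgraphs that have at least two vertices, are connected, and stay connected after the deletion of any one vertex. The tree $T$ has the biconnected components and the cut vertices of $G$ as nodes, a component being adjacent to the cut vertices that it contains. An end-component is a component containing exactly one cut vertex. **Algorithm combineST.** Input: a connected graph $G=(V,E)$ with maximum degree at most $3$ and $|V|\ge 2$. 1. If $G$ has a cut vertex, choose an arbitrary end-component $B_1$, let $t_1$ be its unique cut vertex, and choose $s_1\in B_1\setminus\{t_1\}$ with $d_G(s_1)$ minimum. If $G$ has no cut vertex, let $B_1$ be the only component, and choose $s_1\in B_1$ with $d_G(s_1)$ minimum and then $t_1\in B_1\setminus\{s_1\}$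 with $d_G(t_1)$ minimum. 2. Perform a depth-first traversal of $T$ starting from $B_1$, and let $B_1,\dots,B_r$ be the components in the order in which they are discovered. 3. Let $\sigma^1$ be an $s_1$-$t_1$ order of $B_1$. 4. For $i=2,\dots,r$: let $s_i\in B_i$ be a cut vertex that also lies in some $B_j$ with $j<i$. If $B_i$ is an end-component, choose $t_i\in B_i\setminus\{s_i\}$ with $d_G(t_i)$ minimum; otherwise let $t_i\in B_i\setminus\{s_i\}$ be a cut vertex that also lies in some $B_j$ with $j>i$. Take an $s_i$-$t_i$ order of $B_i$, and append it without its first vertex to $\sigma^{i-1}$ to obtain $\sigma^i$. 5. Return $\sigma^r$. **Theorem.** Let $G=(V,E)$ be a connected graph with maximum degree at most $3$ and $|V|\ge 2$. (a) Whatever choices are made, every order returned by combineST is a vertex order of $G$ that maximizes $\sum_{v\in V}\overleftarrow{d}(v)\,\overrightarrow{d}(v)$ over all vertex orders of $G$. (b) combineST can be carried out in polynomial time: there are a single program for a random access machine (unit cost per step; addition and truncated subtraction are the only arithmetic) and a polynomial $p$ such that, for every such $G$ with vertices $0,\dots,n-1$, given by $n$, the number $m$ of edges and a list of the ends of the edges,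 the program halts after at most $p(n+m)$ steps and outputs a vertex order that is a possible output of combineST on $G$, and hence maximizes $\sum_{v\in V}\overleftarrow{d}(v)\,\overrightarrow{d}(v)$. -/

import Mathlib

open scoped Graph

universe u v

/-! ### Degrees, vertex orders and the objective

A multigraph is a `Graph α β` (vertices in `α`, edges in `β`, parallel edges allowed). -/

namespace OrderedGraph

/-- The degree `d(v)`: the number of edges incident with `v`. -/
noncomputable def deg {α : Type u} {β : Type v} (G : Graph α β) (v : α) : ℕ :=
  {e | G.Inc e v}.ncard

/-- `d(v, S)`: the number of edges joining `v` to a vertex of `S`. -/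
noncomputable def degTo {α : Type u} {β : Type v} (G : Graph α β) (v : α) (S : Set α) : ℕ :=
  {e | ∃ w ∈ S, G.IsLink e v w}.ncard

/-- The left-degree of `v` in the order `σ`: edges to vertices that precede `v`. -/
noncomputable def leftDeg {α : Type u} {β : Type v} (G : Graph α β) (σ : List α) (v : α) : ℕ :=
  degTo G v {w | List.Sublist [w, v] σ}

/-- The right-degree of `v` in the order `σ`: edges to vertices that come after `v`. -/
noncomputable def rightDeg {α : Type u} {β : Type v} (G : Graph α β) (σ : List α) (v : α) : ℕ :=
  degTo G v {w | List.Sublist [v, w] σ}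

/-- `σ` lists every vertex of `G` exactly once. -/
def IsVertexOrder {α : Type u} {β : Type v} (G : Graph α β) (σ : List α) : Prop :=
  σ.Nodup ∧ ∀ v, v ∈ σ ↔ v ∈ V(G)

/-- The objective: the sum over all vertices of left-degree times right-degree. -/
noncomputable def objective {α : Type u} {β : Type v} (G : Graph α β) (σ : List α) : ℕ :=
  ∑ᶠ v ∈ V(G), leftDeg G σ v * rightDeg G σ v

/-- `σ` is a vertex order of `G` that maximizes the objective among all vertex orders. -/
def IsOptimalOrder {α : Type u} {β : Type v} (G : Graph α β) (σ : List α) : Prop :=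
  IsVertexOrder G σ ∧ ∀ τ, IsVertexOrder G τ → objective G τ ≤ objective G σ

/-- `σ` is an `s`-`t` order of `G`. -/
def IsSTOrder {α : Type u} {β : Type v} (G : Graph α β) (s t : α) (σ : List α) : Prop :=
  IsVertexOrder G σ ∧ σ.head? = some s ∧ σ.getLast? = some t ∧
    ∀ v ∈ V(G), v ≠ s → v ≠ t → 2 ≤ deg G v → 1 ≤ leftDeg G σ v ∧ 1 ≤ rightDeg G σ v

/-- Admissible input graphs: finite, loop-free, connected, maximum degree at most three, and at
least two vertices. -/
structure IsInputGraph {α : Type u} {β : Type v} (G : Graph α β) : Prop where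
  finite_vertices : V(G).Finite
  finite_edges : E(G).Finite
  loopless : G.Loopless
  connected : G.toSimpleGraph.Connected
  deg_le_three : ∀ v ∈ V(G), deg G v ≤ 3
  two_le_card : 2 ≤ V(G).ncard

/-! ### Biconnected components and their tree -/

/-- Connected, at least two vertices, and connected after the deletion of any one vertex.
A single edge, or a bundle of parallel edges, is biconnected. -/
def IsBiconnected {α : Type u} {β : Type v} (H : Graph α β) : Prop :=
  V(H).Nontrivial ∧ H.toSimpleGraph.Connected ∧
    ∀ x ∈ V(H), (H.deleteVerts {x}).toSimpleGraph.Connected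

/-- The biconnected components of `G`: its maximal biconnected subgraphs. -/
def IsBlock {α : Type u} {β : Type v} (G B : Graph α β) : Prop :=
  Maximal (fun H : Graph α β => H ≤ G ∧ IsBiconnected H) B

/-- Cut vertices of a connected graph: vertices whose deletion disconnects it. -/
def IsCutVertex {α : Type u} {β : Type v} (G : Graph α β) (c : α) : Prop :=
  c ∈ V(G) ∧ ¬ (G.deleteVerts {c}).toSimpleGraph.Preconnected

/-- End-components: biconnected components containing exactly one cut vertex. -/
def IsEndBlock {α : Type u} {β : Type v} (G B : Graph α β) : Prop :=
  IsBlock G B ∧ ∃! c, IsCutVertex G c ∧ c ∈ V(B)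

/-- The nodes of the tree of biconnected components: the components and the cut vertices. -/
abbrev BlockNode {α : Type u} {β : Type v} (G : Graph α β) : Type (max u v) :=
  {B : Graph α β // IsBlock G B} ⊕ {c : α // IsCutVertex G c}

/-- The tree of biconnected components: a component and a cut vertex are adjacent when the
component contains the cut vertex. -/
def blockTree {α : Type u} {β : Type v} (G : Graph α β) : SimpleGraph (BlockNode G) :=
  SimpleGraph.fromRel fun x y =>
    ∃ B c, x = Sum.inl B ∧ y = Sum.inr c ∧ c.1 ∈ V(B.1)

/-- The states reachable by a depth-first traversal of `T` from `r`; the arguments are the list of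
nodes visited so far, in the order of their discovery, and the stack with its top first. -/
inductive DFSState {N : Type u} (T : SimpleGraph N) (r : N) : List N → List N → Prop
  | start : DFSState T r [r] [r]
  | discover {visited stack : List N} {x y : N} :
      DFSState T r visited (x :: stack) → T.Adj x y → y ∉ visited →
        DFSState T r (visited ++ [y]) (y :: x :: stack)
  | backtrack {visited stack : List N} {x : N} :
      DFSState T r visited (x :: stack) → (∀ y, T.Adj x y → y ∈ visited) →
        DFSState T r visited stack

/-- `L` lists the nodes in the order in which some depth-first traversal of `T` from `r`
discovers them. -/
def IsDFSOrder {N : Type u} (T : SimpleGraph N) (r : N) (L : List N) : Prop :=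
  DFSState T r L []

/-- The biconnected components in a list of nodes, in the same order. -/
def blocksOf {α : Type u} {β : Type v} {G : Graph α β} (L : List (BlockNode G)) :
    List (Graph α β) :=
  L.filterMap (Sum.elim (fun B => some B.1) (fun _ => none))

/-! ### The algorithm `combineST`, as the relation between its input and its possible outputs -/

/-- `x` has the least degree in `G` among the vertices in `S`. -/
def IsMinDegIn {α : Type u} {β : Type v} (G : Graph α β) (S : Set α) (x : α) : Prop :=
  x ∈ S ∧ ∀ y ∈ S, deg G x ≤ deg G y

/-- The choice of the first component `B` and of its terminals `s`, `t`. If `G` has a cut vertex,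
`B` is an end-component, `t` is its cut vertex, and `s` is another vertex of `B` of least degree.
Otherwise `B` is the only component; `s` is a vertex of least degree and `t` is another vertex of
least degree. -/
def FirstChoice {α : Type u} {β : Type v} (G B : Graph α β) (s t : α) : Prop :=
  (IsEndBlock G B ∧ IsCutVertex G t ∧ t ∈ V(B) ∧ IsMinDegIn G (V(B) \ {t}) s) ∨
  ((∀ c, ¬ IsCutVertex G c) ∧ IsBlock G B ∧
    IsMinDegIn G V(B) s ∧ IsMinDegIn G (V(B) \ {s}) t)

/-- The choice of the terminals `s`, `t` of a component `B` other than the first, where `before`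
and `after` are the lists of components preceding and following `B` in the traversal order. -/
def LaterChoice {α : Type u} {β : Type v} (G : Graph α β) (before : List (Graph α β))
    (B : Graph α β) (after : List (Graph α β)) (s t : α) : Prop :=
  (IsCutVertex G s ∧ s ∈ V(B) ∧ ∃ B' ∈ before, s ∈ V(B')) ∧
  (IsEndBlock G B → IsMinDegIn G (V(B) \ {s}) t) ∧
  (¬ IsEndBlock G B → IsCutVertex G t ∧ t ∈ V(B) \ {s} ∧ ∃ B' ∈ after, t ∈ V(B'))

/-- The main loop: `CombineLoop G before σ remaining τ` says that, when the components in `before`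
have been processed and `σ` is the current order, processing the components in `remaining`
may end with the order `τ`. -/
inductive CombineLoop {α : Type u} {β : Type v} (G : Graph α β) :
    List (Graph α β) → List α → List (Graph α β) → List α → Prop
  | done {before : List (Graph α β)} {σ : List α} : CombineLoop G before σ [] σ
  | next {before after : List (Graph α β)} {B : Graph α β} {s t : α} {σ ρ τ : List α} :
      LaterChoice G before B after s t → IsSTOrder B s t ρ →
        CombineLoop G (before ++ [B]) (σ ++ ρ.tail) after τ →
          CombineLoop G before σ (B :: after) τ

/-- `σ` is a possible output of `combineST` on `G`: it is the result of some sequence of admissible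
choices of the first component, of the depth-first traversal, of the terminals and of the
`s`-`t` orders of the components. -/
def IsCombineSTOutput {α : Type u} {β : Type v} (G : Graph α β) (σ : List α) : Prop :=
  ∃ (B : {B : Graph α β // IsBlock G B}) (L : List (BlockNode G)) (rest : List (Graph α β))
    (s t : α) (ρ : List α),
    IsDFSOrder (blockTree G) (Sum.inl B) L ∧ blocksOf L = B.1 :: rest ∧
      FirstChoice G B.1 s t ∧ IsSTOrder B.1 s t ρ ∧ CombineLoop G [B.1] ρ rest σ

end OrderedGraph

/-! ### A machine model with a step count

Programs over a random access memory of natural numbers, divided into scalar variables and arrays.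
The only arithmetic is addition and truncated subtraction, so that unit cost per executed assignment
and test is polynomially equivalent to Turing machine time. -/

namespace RAM

/-- The memory: scalar variables, and cells `array a i`. -/
structure Store where
  scalar : ℕ → ℕ
  array : ℕ → ℕ → ℕ

inductive Expr where
  | const (k : ℕ)
  | var (x : ℕ)
  | get (a : ℕ) (i : Expr)
  | add (e f : Expr)
  | sub (e f : Expr)

def Expr.val (m : Store) : Expr → ℕ
  | .const k => k
  | .var x => m.scalar x
  | .get a i => m.array a (i.val m)
  | .add e f => e.val m + f.val m
  | .sub e f => e.val m - f.val m

inductive Test where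
  | lt (e f : Expr)
  | eq (e f : Expr)
  | not (b : Test)
  | and (b c : Test)

def Test.holds (m : Store) : Test → Prop
  | .lt e f => e.val m < f.val m
  | .eq e f => e.val m = f.val m
  | .not b => ¬ b.holds m
  | .and b c => b.holds m ∧ c.holds m

inductive Program where
  | skip
  | assign (x : ℕ) (e : Expr)
  | put (a : ℕ) (i e : Expr)
  | seq (P Q : Program)
  | branch (b : Test) (P Q : Program)
  | loop (b : Test) (P : Program)

/-- `Run P m k m'`: started in the memory `m`, the program `P` halts after exactly `k` steps, with
memory `m'`. Each assignment and each evaluation of a test is one step. -/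
inductive Run : Program → Store → ℕ → Store → Prop
  | skip (m : Store) : Run .skip m 1 m
  | assign (x : ℕ) (e : Expr) (m : Store) :
      Run (.assign x e) m 1 ⟨Function.update m.scalar x (e.val m), m.array⟩
  | put (a : ℕ) (i e : Expr) (m : Store) :
      Run (.put a i e) m 1
        ⟨m.scalar, Function.update m.array a (Function.update (m.array a) (i.val m) (e.val m))⟩
  | seq {P Q : Program} {m m' m'' : Store} {k l : ℕ} :
      Run P m k m' → Run Q m' l m'' → Run (.seq P Q) m (k + l) m''
  | branch_true {b : Test} {P Q : Program} {m m' : Store} {k : ℕ} :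
      b.holds m → Run P m k m' → Run (.branch b P Q) m (k + 1) m'
  | branch_false {b : Test} {P Q : Program} {m m' : Store} {k : ℕ} :
      ¬ b.holds m → Run Q m k m' → Run (.branch b P Q) m (k + 1) m'
  | loop_true {b : Test} {P : Program} {m m' m'' : Store} {k l : ℕ} :
      b.holds m → Run P m k m' → Run (.loop b P) m' l m'' → Run (.loop b P) m (k + l + 1) m''
  | loop_false {b : Test} {P : Program} {m : Store} :
      ¬ b.holds m → Run (.loop b P) m 1 m

/-- The initial memory for a graph with vertices `0, …, n-1` and edges `0, …, m-1`, where edge `k`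
joins `src k` and `tgt k`: scalars `0` and `1` hold `n` and `m`, arrays `0` and `1` list the ends of
the edges, and every other cell is zero. -/
def graphInput (n m : ℕ) (src tgt : ℕ → ℕ) : Store where
  scalar x := if x = 0 then n else if x = 1 then m else 0
  array a k := if k < m then (if a = 0 then src k else if a = 1 then tgt k else 0) else 0

/-- The list of the first `n` cells of array `2`. -/
def listOutput (n : ℕ) (m : Store) : List ℕ :=
  (List.range n).map (m.array 2)

end RAM

/-! ### Connection inside a set of vertices -/

/-! As degrees are at most 3, the product of left- and right-degree of `v` is `deg G v - 1` if `v`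
has neighbours on both sides (`Good`), and 0 otherwise (`leftDeg_mul_rightDeg`). Maximizing the
objective thus means minimizing the sum of `deg G v - 1` over the one-sided vertices.

Lower bound: in any order, the first and the last vertex of a biconnected component see the rest of
the component on one side only. If such a vertex is not a cut vertex, all its edges lie in the
component, so it is one-sided. Hence every end-component contains a one-sided vertex that is not a
cut vertex. Such a vertex lies in no other component, so distinct end-components give distinct
vertices. A graph without cut vertices has two one-sided vertices.

Upper bound: in an `s`-`t` order of a component only the terminals can be one-sided. When a
component is attached, `s` already has a left neighbour and now gets a right one. The vertex `t`
gets a left neighbour, and either it is a cut vertex that obtains a right neighbour later, or it has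
least degree among the non-cut vertices of an end-component. `CombineInv` records this. In the end
each one-sided vertex is the only non-cut one of its end-component and has least degree there.
Sending it to a one-sided non-cut vertex that a competing order has in the same end-component is
injective and does not lower degrees, so `objective_le` applies.

For the program, every choice is expressed by reachability. The component of an edge `sw` is the set
`blk` of the vertices that no other vertex separates from that edge. An `s`-`t` order of it grows
one vertex at a time: by `exists_extension` some unplaced vertex adjacent to the placed part can be
removed with all other unplaced vertices still joined to `t`. The new vertex has a left neighbour at
once, and an unplaced neighbour as well unless it is `t`. No stack is kept: the next component is
opened at the last placed vertex that has an unplaced neighbour, and the invariant `Complete` shows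
that this follows a depth-first traversal of the tree of components. Each choice is then the least
witness of a fixed formula with bounded quantifiers, counting and transitive closure. `Tm.correct`
compiles such terms, with a polynomial time bound. -/

namespace OrderedGraph

/-- `u` and `v` are joined by a walk inside `S`. -/
def Joins {α : Type u} (A : SimpleGraph α) (S : Set α) (u v : α) : Prop :=
  ∃ p : A.Walk u v, ∀ z ∈ p.support, z ∈ S

section Joins

variable {α : Type u} {A A' : SimpleGraph α} {S S' : Set α} {u v w x : α}

theorem Joins.refl (h : u ∈ S) : Joins A S u u := ⟨.nil, by simpa using h⟩

theorem Joins.left_mem (h : Joins A S u v) : u ∈ S := h.choose_spec _ (by simp)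

theorem Joins.right_mem (h : Joins A S u v) : v ∈ S := h.choose_spec _ (by simp)

theorem Joins.symm (h : Joins A S u v) : Joins A S v u := by
  obtain ⟨p, hp⟩ := h
  exact ⟨p.reverse, by simpa using hp⟩

theorem Joins.trans (h : Joins A S u v) (h' : Joins A S v w) : Joins A S u w := by
  obtain ⟨p, hp⟩ := h
  obtain ⟨q, hq⟩ := h'
  refine ⟨p.append q, fun z hz => ?_⟩
  rw [SimpleGraph.Walk.mem_support_append_iff] at hz
  exact hz.elim (hp z) (hq z)

theorem Joins.mono (h : Joins A S u v) (hS : S ⊆ S') : Joins A S' u v := by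
  obtain ⟨p, hp⟩ := h
  exact ⟨p, fun z hz => hS (hp z hz)⟩

theorem Joins.mono_graph (h : Joins A S u v) (hA : A ≤ A') : Joins A' S u v := by
  obtain ⟨p, hp⟩ := h
  exact ⟨p.mapLe hA, by simpa using hp⟩

theorem Joins.of_adj (h : A.Adj u v) (hu : u ∈ S) (hv : v ∈ S) : Joins A S u v :=
  ⟨h.toWalk, by simp [hu, hv]⟩

theorem Joins.exists_path (h : Joins A S u v) :
    ∃ p : A.Walk u v, p.IsPath ∧ ∀ z ∈ p.support, z ∈ S := by
  classical
  obtain ⟨p, hp⟩ := h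
  exact ⟨p.bypass, p.bypass_isPath, fun z hz => hp z (p.support_bypass_subset_support hz)⟩

/-- A path does not return to its first vertex, so what follows the first edge avoids `u`. -/
theorem Joins.exists_adj (h : Joins A S u v) (huv : u ≠ v) :
    ∃ w, A.Adj u w ∧ Joins A (S \ {u}) w v := by
  obtain ⟨p, hp, hS⟩ := h.exists_path
  cases p with
  | nil => exact absurd rfl huv
  | cons h q =>
    rw [SimpleGraph.Walk.cons_isPath_iff] at hp
    refine ⟨_, h, q, fun z hz => ⟨hS z (by simp [hz]), ?_⟩⟩
    rintro rfl
    exact hp.2 hz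

/-- A walk stays inside any set that contains all vertices joined to its end. -/
theorem Joins.restrict (h : Joins A S u v) (hS : ∀ z, Joins A S z v → z ∈ S') :
    Joins A S' u v := by
  classical
  obtain ⟨p, hp⟩ := h
  refine ⟨p, fun z hz => hS z ⟨p.dropUntil z hz, fun y hy => hp y ?_⟩⟩
  exact p.support_dropUntil_subset_support hz hy

/-- A walk from `T` to its complement has an edge that leaves `T`. -/
theorem Joins.exists_crossing (h : Joins A S u v) (T : Set α) (hu : u ∈ T) (hv : v ∉ T) :
    ∃ a b, A.Adj a b ∧ a ∈ T ∧ b ∉ T ∧ a ∈ S ∧ b ∈ S := by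
  obtain ⟨p, hp⟩ := h
  induction p with
  | nil => exact absurd hu hv
  | @cons a b c hab q ih =>
    by_cases hb : b ∈ T
    · exact ih hb hv fun z hz => hp z (by simp [hz])
    · exact ⟨a, b, hab, hu, hb, hp _ (by simp), hp _ (by simp)⟩

/-- This links walks to the transitive closure that the terms of the program can express. Membership
of `u` is separate because the empty walk makes no step. -/
theorem joins_iff_reflTransGen :
    Joins A S u v ↔ u ∈ S ∧ Relation.ReflTransGen (fun a b => A.Adj a b ∧ a ∈ S ∧ b ∈ S) u v := by
  constructor
  · intro h
    refine ⟨h.left_mem, ?_⟩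
    obtain ⟨p, hp⟩ := h
    induction p with
    | nil => exact .refl
    | cons hab q ih =>
      exact .head ⟨hab, hp _ (by simp), hp _ (by simp)⟩ (ih fun z hz => hp z (by simp [hz]))
  · rintro ⟨hu, h⟩
    induction h with
    | refl => exact .refl hu
    | tail _ hbc ih => exact ih.trans (.of_adj hbc.1 hbc.2.1 hbc.2.2)

/-! ### The vertex set of the biconnected component of an edge -/

/-- The vertices that no other vertex separates from the edge `sw`. -/
def blk (A : SimpleGraph α) (s w : α) : Set α :=
  {v | ∀ x, x ≠ v → Joins A {x}ᶜ v s ∨ Joins A {x}ᶜ v w}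

theorem left_mem_blk {s w : α} : s ∈ blk A s w :=
  fun x hx => .inl (.refl (by simpa using hx.symm))

theorem right_mem_blk {s w : α} : w ∈ blk A s w :=
  fun x hx => .inr (.refl (by simpa using hx.symm))

/-- Both vertices reach an end of the edge `sw` without `x`. If they reach different ends, then `x`
is neither of these, so the edge itself completes the walk. -/
theorem blk_joins_compl {s w : α} (h : A.Adj s w) (hu : u ∈ blk A s w) (hv : v ∈ blk A s w)
    (hxu : x ≠ u) (hxv : x ≠ v) : Joins A {x}ᶜ u v := by
  rcases hu x hxu with h1 | h1 <;> rcases hv x hxv with h2 | h2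
  · exact h1.trans h2.symm
  · exact h1.trans ((Joins.of_adj h h1.right_mem h2.right_mem).trans h2.symm)
  · exact h1.trans ((Joins.of_adj h.symm h1.right_mem h2.right_mem).trans h2.symm)
  · exact h1.trans h2.symm

theorem blk_joins_univ {s w : α} (h : A.Adj s w) (hu : u ∈ blk A s w) :
    Joins A Set.univ u s := by
  by_cases hs : s = u
  · subst hs; exact .refl trivial
  · rcases hu s hs with h1 | h1
    · exact absurd rfl h1.right_mem
    · exact (h1.mono (Set.subset_univ _)).trans (.of_adj h.symm trivial trivial)

/-- A path between two vertices of a biconnected component stays in it. -/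
theorem support_subset_blk {s w : α} (hu : u ∈ blk A s w) (hv : v ∈ blk A s w)
    {p : A.Walk u v} (hp : p.IsPath) : ∀ z ∈ p.support, z ∈ blk A s w := by
  classical
  intro z hz x hx
  -- A path visits `x` at most once, so one of its two halves at `z` avoids `x` and joins `z` to `u`
  -- or to `v`.
  by_cases h1 : x ∈ (p.takeUntil z hz).support
  · have h2 : x ∉ (p.dropUntil z hz).support := by
      intro h2
      have := hp.support_nodup
      rw [← p.take_spec hz, SimpleGraph.Walk.support_append, List.nodup_append] at this
      rw [← SimpleGraph.Walk.cons_tail_support, List.mem_cons] at h2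
      exact this.2.2 x h1 x (h2.resolve_left hx) rfl
    have h3 : Joins A {x}ᶜ z v := ⟨p.dropUntil z hz, fun y hy => by rintro rfl; exact h2 hy⟩
    exact (hv x fun e => h3.right_mem e.symm).imp h3.trans h3.trans
  · have h3 : Joins A {x}ᶜ z u :=
      Joins.symm ⟨p.takeUntil z hz, fun y hy => by rintro rfl; exact h1 hy⟩
    exact (hu x fun e => h3.right_mem e.symm).imp h3.trans h3.trans

theorem Joins.inter_blk {s w : α} (h : Joins A S u v) (hu : u ∈ blk A s w)
    (hv : v ∈ blk A s w) : Joins A (S ∩ blk A s w) u v := by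
  obtain ⟨p, hp, hS⟩ := h.exists_path
  exact ⟨p, fun z hz => ⟨hS z hz, support_subset_blk hu hv hp z hz⟩⟩

/-- This is the source of the maximality of `blk`. The deleted vertex `x` is at most one of `s` and
`w`, and the other one serves as the target. -/
theorem subset_blk {s w : α} (hsw : s ≠ w) (hs : s ∈ S) (hw : w ∈ S)
    (h : ∀ x, ∀ u ∈ S, ∀ v ∈ S, x ≠ u → x ≠ v → Joins A {x}ᶜ u v) : S ⊆ blk A s w := by
  intro v hv x hx
  by_cases hxs : x = s
  · exact .inr (h x v hv w hw hx (hxs ▸ hsw))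
  · exact .inl (h x v hv s hs hx hxs)

/-! ### Extending a partial `s`-`t` order -/

/-- In a biconnected set `S`, if the part `R` not yet ordered is connected and contains `t`, some
vertex of `R` has a neighbour outside `R`, and its removal leaves all others joined to `t`. -/
theorem exists_extension {s t : α} {R : Set α} (hS : S.Finite)
    (hbi : ∀ x, ∀ u ∈ S, ∀ v ∈ S, x ≠ u → x ≠ v → Joins A (S \ {x}) u v)
    (hconn : ∀ u ∈ S, ∀ v ∈ S, Joins A S u v)
    (hR : R ⊆ S) (hs : s ∈ S) (hsR : s ∉ R) (ht : t ∈ R) (hRt : ∀ y ∈ R, Joins A R y t) :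
    ∃ v ∈ R, (∃ a ∈ S \ R, A.Adj a v) ∧ ∀ y ∈ R, y ≠ v → Joins A (R \ {v}) y t := by
  have hst : s ≠ t := by rintro rfl; exact hsR ht
  by_cases hR1 : ∀ y ∈ R, y = t
  · obtain ⟨a, b, hab, ha, hb, -, hbS⟩ :=
      (hconn t (hR ht) s hs).exists_crossing R ht hsR
    have := hR1 a ha
    subst this
    exact ⟨a, ht, ⟨b, ⟨hbS, hb⟩, hab.symm⟩, fun y hy hya => absurd (hR1 y hy) hya⟩
  push Not at hR1
  obtain ⟨y, hy, hyt⟩ := hR1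
  -- The vertices that the removal of `v` cuts off from `t`. The proof descends on the size of this
  -- set over the candidates `v` with a neighbour outside `R`.
  let D : α → Set α := fun v => {y | y ∈ R ∧ y ≠ v ∧ ¬ Joins A (R \ {v}) y t}
  have key : ∀ k, ∀ v ∈ R, v ≠ t → (∃ a ∈ S \ R, A.Adj a v) → (D v).ncard ≤ k →
      ∃ v ∈ R, (∃ a ∈ S \ R, A.Adj a v) ∧ ∀ y ∈ R, y ≠ v → Joins A (R \ {v}) y t := by
    intro k
    induction k with
    | zero =>
      intro v hv hvt ha hk
      refine ⟨v, hv, ha, fun y hy hyv => by_contra fun hn => ?_⟩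
      have hfin : (D v).Finite := hS.subset fun z hz => hR hz.1
      have := (Set.ncard_eq_zero hfin).1 (Nat.le_zero.1 hk)
      exact (Set.eq_empty_iff_forall_notMem.1 this y) ⟨hy, hyv, hn⟩
    | succ k ih =>
      intro v hv hvt ha hk
      by_cases hD : ∀ y ∈ R, y ≠ v → Joins A (R \ {v}) y t
      · exact ⟨v, hv, ha, hD⟩
      push Not at hD
      obtain ⟨y, hy, hyv, hyn⟩ := hD
      have hsv : s ≠ v := by rintro rfl; exact hsR hv
      obtain ⟨a, b, hab, haD, hbD, haS, hbS⟩ :=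
        (hbi v y (hR hy) s hs hyv.symm hsv.symm).exists_crossing (D v) ⟨hy, hyv, hyn⟩
          (fun h => hsR h.1)
      -- Otherwise `b` would still reach `t` without `v`, and so would `a`. Hence `a` has a
      -- neighbour outside `R` and is the next candidate.
      have hbR : b ∉ R := by
        intro hbR
        have h1 : Joins A (R \ {v}) b t := by
          by_contra h1
          exact hbD ⟨hbR, hbS.2, h1⟩
        exact haD.2.2 ((Joins.of_adj (S := R \ {v}) hab ⟨haD.1, haD.2.1⟩ h1.left_mem).trans h1)
      have htv : Joins A (R \ {v}) t t := .refl (S := R \ {v}) ⟨ht, hvt.symm⟩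
      have hat : a ≠ t := by rintro rfl; exact haD.2.2 htv
      -- A walk to `t` that avoids `v` cannot meet `a`, which `v` cuts off from `t`.
      have hoff : ∀ z, Joins A (R \ {v}) z t → Joins A (R \ {a}) z t := fun z hz =>
        hz.restrict fun q hq => ⟨hq.left_mem.1, by rintro rfl; exact haD.2.2 hq⟩
      have hva : Joins A (R \ {a}) v t := by
        obtain ⟨w, hw, hwt⟩ := (hRt v hv).exists_adj hvt
        have := hoff w hwt
        exact (Joins.of_adj (S := R \ {a}) hw ⟨hv, by rintro rfl; exact haD.2.1 rfl⟩
          this.left_mem).trans this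
      refine ih a haD.1 hat ⟨b, ⟨hbS.1, hbR⟩, hab.symm⟩ ?_
      have hss : D a ⊂ D v := by
        refine ⟨fun z hz => ⟨hz.1, ?_, fun h => hz.2.2 (hoff z h)⟩, fun h => (h haD).2.1 rfl⟩
        rintro rfl
        exact hz.2.2 hva
      have := Set.ncard_lt_ncard hss (hS.subset fun z hz => hR hz.1)
      omega
  obtain ⟨v, b, hvb, hv, hb, hvS, hbS⟩ :=
    (hbi t y (hR hy) s hs hyt.symm hst.symm).exists_crossing R hy hsR
  exact key _ v hv hvS.2 ⟨b, ⟨hbS.1, hb⟩, hvb.symm⟩ le_rfl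

/-! ### End-components -/

/-- `c` separates two vertices of `V`. -/
def Separates (A : SimpleGraph α) (V : Set α) (c : α) : Prop :=
  ∃ a ∈ V, ∃ b ∈ V, a ≠ c ∧ b ≠ c ∧ ¬ Joins A {c}ᶜ a b

/-- Descent on the part `C c a` that contains `a` after deletion of a cut vertex `c`. If the
component of the first edge from `c` towards `a` contains another cut vertex `d`, then `d` separates
some `a'` from `c`, and `C d a'` is a proper subset of `C c a` since it lacks `d`. -/
theorem exists_end_blk {V : Set α} (hV : V.Finite)
    (hconn : ∀ u ∈ V, ∀ v ∈ V, Joins A Set.univ u v) (hcut : ∃ c ∈ V, Separates A V c)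
    (hA : ∀ a b, A.Adj a b → a ∈ V) :
    ∃ c ∈ V, Separates A V c ∧ ∃ w, A.Adj c w ∧ ∀ d ∈ blk A c w, Separates A V d → d = c := by
  let C : α → α → Set α := fun c a => {y | y ∈ V ∧ Joins A {c}ᶜ y a}
  have key : ∀ k, ∀ c ∈ V, Separates A V c → ∀ a ∈ V, a ≠ c → (C c a).ncard ≤ k →
      ∃ c ∈ V, Separates A V c ∧ ∃ w, A.Adj c w ∧ ∀ d ∈ blk A c w, Separates A V d → d = c := by
    intro k
    induction k with
    | zero =>
      intro c hc _ a ha hac hk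
      have := (Set.ncard_eq_zero (hV.subset fun z hz => hz.1)).1 (Nat.le_zero.1 hk)
      exact absurd (⟨ha, .refl (by simpa using hac)⟩ : a ∈ C c a)
        (Set.eq_empty_iff_forall_notMem.1 this a)
    | succ k ih =>
      intro c hc hcs a ha hac hk
      obtain ⟨w, hcw, hwa⟩ := (hconn c hc a ha).exists_adj hac.symm
      replace hwa : Joins A {c}ᶜ w a := hwa.mono fun z hz => hz.2
      by_cases hd : ∀ d ∈ blk A c w, Separates A V d → d = c
      · exact ⟨c, hc, hcs, w, hcw, hd⟩
      push Not at hd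
      obtain ⟨d, hd, hds, hdc⟩ := hd
      have hda : Joins A {c}ᶜ d a := by
        rcases hd c hdc.symm with h | h
        · exact absurd rfl h.right_mem
        · exact h.trans hwa
      have hdV : d ∈ V := by
        obtain ⟨b, hdb, -⟩ := (blk_joins_univ hcw hd).exists_adj hdc
        exact hA d b hdb
      obtain ⟨a', ha', ha'd, hn⟩ : ∃ a' ∈ V, a' ≠ d ∧ ¬ Joins A {d}ᶜ a' c := by
        by_contra! hall
        obtain ⟨p, hp, q, hq, hpd, hqd, hpq⟩ := hds
        exact hpq ((hall p hp hpd).trans (hall q hq hqd).symm)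
      refine ih d hdV hds a' ha' ha'd ?_
      have hss : C d a' ⊂ C c a := by
        -- If `y` is not on the side of `a`, a walk from `c` to `y` that leaves `c` for good cannot
        -- meet `d`, which is on that side. It would join `c` to `y` without `d`, although `d`
        -- separates them.
        refine ⟨fun y hy => ⟨hy.1, by_contra fun hya => ?_⟩, fun h => ?_⟩
        · have hyc : ¬ Joins A {d}ᶜ c y := fun h => hn (hy.2.symm.trans h.symm)
          by_cases hcy : c = y
          · subst hcy; exact hyc (.refl (by simpa using hdc.symm))
          obtain ⟨w', hcw', hw'⟩ := (hconn c hc y hy.1).exists_adj hcy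
          have h1 : Joins A {d}ᶜ w' y := hw'.restrict fun z hz => by
            rintro rfl
            exact hya ((hz.mono fun z hz => hz.2).symm.trans hda)
          exact hyc ((Joins.of_adj hcw' (by simpa using hdc.symm) h1.left_mem).trans h1)
        · exact absurd rfl (h ⟨hdV, hda⟩).2.left_mem
      have := Set.ncard_lt_ncard hss (hV.subset fun z hz => hz.1)
      omega
  obtain ⟨c, hc, hcs⟩ := hcut
  obtain ⟨a, ha, b, hb, hac, -⟩ := id hcs
  exact key _ c hc hcs a ha hac le_rfl

end Joins

end OrderedGraph

/-! ### Biconnected components as induced subgraphs -/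

namespace OrderedGraph

/-- Adjacency of distinct vertices, as a simple graph on the ambient type. -/
def skel {α : Type u} {β : Type v} (G : Graph α β) : SimpleGraph α where
  Adj a b := a ≠ b ∧ G.Adj a b
  symm := ⟨fun _ _ h => ⟨h.1.symm, h.2.symm⟩⟩

section Blocks

variable {α : Type u} {β : Type v} {G H B B' : Graph α β} {u v w x c s t : α} {S X : Set α}

theorem skel_mono (h : H ≤ G) : skel H ≤ skel G := fun _ _ hab => ⟨hab.1, hab.2.mono h⟩

theorem skel_adj_left (h : (skel G).Adj u v) : u ∈ V(G) := h.2.left_mem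

theorem skel_adj_right (h : (skel G).Adj u v) : v ∈ V(G) := h.2.right_mem

theorem Joins.mem_vertexSet (h : Joins (skel G) S u v) (hv : v ∈ V(G)) : u ∈ V(G) := by
  by_cases huv : u = v
  · exact huv ▸ hv
  · obtain ⟨w, hw, -⟩ := h.exists_adj huv
    exact skel_adj_left hw

theorem skel_induce_adj :
    (skel (G.induce X)).Adj u v ↔ (skel G).Adj u v ∧ u ∈ X ∧ v ∈ X := by
  constructor
  · rintro ⟨h, e, he⟩
    exact ⟨⟨h, e, he.1⟩, he.2⟩
  · rintro ⟨⟨h, e, he⟩, hX⟩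
    exact ⟨h, e, he, hX⟩

theorem joins_skel_induce (hu : u ∈ X) :
    Joins (skel (G.induce X)) S u v ↔ Joins (skel G) (S ∩ X) u v := by
  rw [joins_iff_reflTransGen, joins_iff_reflTransGen]
  have : (fun a b => (skel (G.induce X)).Adj a b ∧ a ∈ S ∧ b ∈ S) =
      fun a b => (skel G).Adj a b ∧ a ∈ S ∩ X ∧ b ∈ S ∩ X := by
    funext a b
    rw [skel_induce_adj]
    simp only [Set.mem_inter_iff, eq_iff_iff]
    tauto
  rw [this]
  simp [hu]

/-- Connectedness is moved to the fixed ambient type, where walks of different subgraphs can be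
compared and concatenated. -/
theorem preconnected_iff :
    G.toSimpleGraph.Preconnected ↔ ∀ u ∈ V(G), ∀ v ∈ V(G), Joins (skel G) Set.univ u v := by
  constructor
  · intro h u hu v hv
    obtain ⟨p⟩ := h ⟨u, hu⟩ ⟨v, hv⟩
    let f : G.toSimpleGraph →g skel G :=
      ⟨Subtype.val, fun {a b} hab => ⟨fun e => hab.1 (Subtype.ext e), hab.2⟩⟩
    exact ⟨p.map f, fun _ _ => trivial⟩
  · rintro h ⟨u, hu⟩ ⟨v, hv⟩
    obtain ⟨p, -⟩ := h u hu v hv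
    induction p with
    | nil => exact .refl _
    | @cons a b d hab q ih =>
      have hb := skel_adj_right hab
      have h1 : G.toSimpleGraph.Adj ⟨a, hu⟩ ⟨b, hb⟩ :=
        ⟨fun e => hab.1 (congrArg Subtype.val e), hab.2⟩
      exact h1.reachable.trans (ih hb hv)

theorem preconnected_deleteVerts_iff :
    (G.deleteVerts {x}).toSimpleGraph.Preconnected ↔
      ∀ u ∈ V(G), ∀ v ∈ V(G), u ≠ x → v ≠ x → Joins (skel G) {x}ᶜ u v := by
  rw [preconnected_iff, Graph.vertexSet_deleteVerts]
  have key : ∀ u ∈ V(G) \ {x}, ∀ v ∈ V(G) \ {x},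
      Joins (skel (G.deleteVerts {x})) Set.univ u v ↔ Joins (skel G) {x}ᶜ u v := by
    intro u hu v hv
    rw [Graph.deleteVerts, joins_skel_induce hu, Set.univ_inter]
    exact ⟨fun h => h.mono fun z hz => hz.2,
      fun h => h.restrict fun z hz => ⟨hz.mem_vertexSet hv.1, hz.left_mem⟩⟩
  exact ⟨fun h u hu v hv hux hvx => (key u ⟨hu, hux⟩ v ⟨hv, hvx⟩).1 (h u ⟨hu, hux⟩ v ⟨hv, hvx⟩),
    fun h u hu v hv => (key u hu v hv).2 (h u hu.1 v hv.1 hu.2 hv.2)⟩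

theorem isCutVertex_iff : IsCutVertex G c ↔ c ∈ V(G) ∧ Separates (skel G) V(G) c := by
  rw [IsCutVertex, preconnected_deleteVerts_iff]
  unfold Separates
  push Not
  rfl

theorem IsBiconnected.joins_univ (h : IsBiconnected H) (hu : u ∈ V(H)) (hv : v ∈ V(H)) :
    Joins (skel H) Set.univ u v := preconnected_iff.1 h.2.1.preconnected u hu v hv

/-- Here `x` may be any element of the ambient type: one that is not a vertex of `H` lies on no walk
between vertices of `H`. -/
theorem IsBiconnected.joins_compl (h : IsBiconnected H) (hu : u ∈ V(H)) (hv : v ∈ V(H))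
    (hxu : x ≠ u) (hxv : x ≠ v) : Joins (skel H) {x}ᶜ u v := by
  by_cases hx : x ∈ V(H)
  · exact preconnected_deleteVerts_iff.1 (h.2.2 x hx).preconnected u hu v hv hxu.symm hxv.symm
  · refine (h.joins_univ hu hv).restrict fun z hz => ?_
    rintro rfl
    exact hx (hz.mem_vertexSet hv)

theorem isBiconnected_of_joins (hV : V(H).Nontrivial)
    (h : ∀ u ∈ V(H), ∀ v ∈ V(H), Joins (skel H) Set.univ u v)
    (hx : ∀ x, ∀ u ∈ V(H), ∀ v ∈ V(H), x ≠ u → x ≠ v → Joins (skel H) {x}ᶜ u v) :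
    IsBiconnected H := by
  refine ⟨hV, ?_, fun x _ => ?_⟩
  · have : Nonempty V(H) := hV.nonempty.to_subtype
    exact ⟨preconnected_iff.2 h⟩
  · obtain ⟨y, hy, hyx⟩ := hV.exists_ne x
    have : Nonempty V(H.deleteVerts {x}) := ⟨⟨y, by simp [hy, hyx]⟩⟩
    exact ⟨preconnected_deleteVerts_iff.2 fun u hu v hv hux hvx =>
      hx x u hu v hv hux.symm hvx.symm⟩

theorem blk_subset (h : (skel G).Adj s w) : blk (skel G) s w ⊆ V(G) := fun _ hu =>
  (blk_joins_univ h hu).mem_vertexSet (skel_adj_left h)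

theorem isBiconnected_induce_blk (h : (skel G).Adj s w) :
    IsBiconnected (G.induce (blk (skel G) s w)) := by
  refine isBiconnected_of_joins ⟨s, left_mem_blk, w, right_mem_blk, h.1⟩ ?_ ?_
  · intro u hu v hv
    refine (joins_skel_induce (X := blk (skel G) s w) hu).2 ?_
    exact ((blk_joins_univ h hu).trans (blk_joins_univ h hv).symm).inter_blk hu hv
  · intro x u hu v hv hxu hxv
    refine (joins_skel_induce (X := blk (skel G) s w) hu).2 ?_
    exact (blk_joins_compl h hu hv hxu hxv).inter_blk hu hv

theorem le_induce_blk (h : (skel G).Adj s w) (hH : H ≤ G) (hbi : IsBiconnected H)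
    (hs : s ∈ V(H)) (hw : w ∈ V(H)) : H ≤ G.induce (blk (skel G) s w) := by
  have hsub : V(H) ⊆ blk (skel G) s w := subset_blk h.1 hs hw fun x u hu v hv hxu hxv =>
    (hbi.joins_compl hu hv hxu hxv).mono_graph (skel_mono hH)
  exact ⟨hsub, fun e a b he => ⟨he.mono hH, hsub he.left_mem, hsub he.right_mem⟩⟩

theorem isBlock_induce_blk (h : (skel G).Adj s w) :
    IsBlock G (G.induce (blk (skel G) s w)) :=
  ⟨⟨Graph.induce_le (blk_subset h), isBiconnected_induce_blk h⟩, fun _ hH hle =>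
    le_induce_blk h hH.1 hH.2 (hle.vertexSet_mono left_mem_blk)
      (hle.vertexSet_mono right_mem_blk)⟩

theorem IsBlock.le (hB : IsBlock G B) : B ≤ G := hB.1.1

theorem IsBlock.isBiconnected (hB : IsBlock G B) : IsBiconnected B := hB.1.2

theorem IsBlock.nontrivial (hB : IsBlock G B) : V(B).Nontrivial := hB.1.2.1

theorem IsBlock.mem_vertexSet (hB : IsBlock G B) (hv : v ∈ V(B)) : v ∈ V(G) :=
  hB.le.vertexSet_mono hv

/-- The subgraph induced by `blk` is biconnected and contains every biconnected subgraph through `s`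
and `w`, so a component is determined by any one of its edges. -/
theorem IsBlock.eq_induce_blk (hB : IsBlock G B) (h : (skel G).Adj s w) (hs : s ∈ V(B))
    (hw : w ∈ V(B)) : B = G.induce (blk (skel G) s w) :=
  le_antisymm (le_induce_blk h hB.le hB.isBiconnected hs hw)
    (hB.2 (isBlock_induce_blk h).1 (le_induce_blk h hB.le hB.isBiconnected hs hw))

theorem IsBlock.exists_skel_adj (hB : IsBlock G B) (hv : v ∈ V(B)) :
    ∃ w, (skel B).Adj v w := by
  obtain ⟨u, hu, huv⟩ := hB.nontrivial.exists_ne v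
  obtain ⟨w, hw, -⟩ := (hB.isBiconnected.joins_univ hv hu).exists_adj huv.symm
  exact ⟨w, hw⟩

theorem IsBlock.exists_eq_induce_blk (hB : IsBlock G B) (hv : v ∈ V(B)) :
    ∃ w, (skel G).Adj v w ∧ w ∈ V(B) ∧ B = G.induce (blk (skel G) v w) := by
  obtain ⟨w, hw⟩ := hB.exists_skel_adj hv
  exact ⟨w, skel_mono hB.le hw, skel_adj_right hw,
    hB.eq_induce_blk (skel_mono hB.le hw) hv (skel_adj_right hw)⟩

theorem exists_isBlock (h : (skel G).Adj u v) : ∃ B, IsBlock G B ∧ u ∈ V(B) ∧ v ∈ V(B) :=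
  ⟨_, isBlock_induce_blk h, left_mem_blk, right_mem_blk⟩

theorem IsBlock.isLink (hB : IsBlock G B) {e : β} (h : G.IsLink e u v) (hu : u ∈ V(B))
    (hv : v ∈ V(B)) : B.IsLink e u v := by
  obtain ⟨s, hs⟩ := hB.nontrivial.nonempty
  obtain ⟨w, -, -, rfl⟩ := hB.exists_eq_induce_blk hs
  exact ⟨h, hu, hv⟩

theorem IsBlock.support_subset (hB : IsBlock G B) (hu : u ∈ V(B)) (hv : v ∈ V(B))
    {p : (skel G).Walk u v} (hp : p.IsPath) : ∀ z ∈ p.support, z ∈ V(B) := by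
  obtain ⟨w, -, -, rfl⟩ := hB.exists_eq_induce_blk hu
  exact support_subset_blk hu hv hp

theorem IsBlock.joins (hB : IsBlock G B) (hu : u ∈ V(B)) (hv : v ∈ V(B)) :
    Joins (skel G) V(B) u v :=
  ((hB.isBiconnected.joins_univ hu hv).restrict fun _ hz => hz.mem_vertexSet hv).mono_graph
    (skel_mono hB.le)

theorem IsBlock.joins_diff (hB : IsBlock G B) (hu : u ∈ V(B)) (hv : v ∈ V(B))
    (hxu : x ≠ u) (hxv : x ≠ v) : Joins (skel G) (V(B) \ {x}) u v :=
  ((hB.isBiconnected.joins_compl hu hv hxu hxv).restrict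
    fun z (hz : Joins _ _ z v) => (⟨hz.mem_vertexSet hv, hz.left_mem⟩ : z ∈ V(B) \ {x})).mono_graph
      (skel_mono hB.le)

theorem IsBlock.eq_of_adj (hB : IsBlock G B) (hB' : IsBlock G B') (h : (skel G).Adj u v)
    (hu : u ∈ V(B)) (hv : v ∈ V(B)) (hu' : u ∈ V(B')) (hv' : v ∈ V(B')) : B = B' :=
  (hB.eq_induce_blk h hu hv).trans (hB'.eq_induce_blk h hu' hv').symm

/-! ### Connected unions of components -/

/-- The graph of the edges in the components of a list. -/
def unionSkel (G : Graph α β) (bs : List (Graph α β)) : SimpleGraph α where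
  Adj a b := (skel G).Adj a b ∧ ∃ B ∈ bs, a ∈ V(B) ∧ b ∈ V(B)
  symm := ⟨fun _ _ h => ⟨h.1.symm, h.2.imp fun _ hB => ⟨hB.1, hB.2.2, hB.2.1⟩⟩⟩

/-- The vertices of the components of a list. -/
def unionVerts (bs : List (Graph α β)) : Set α := {v | ∃ B ∈ bs, v ∈ V(B)}

/-- The union of the components of a list is connected. -/
def Chained (G : Graph α β) (bs : List (Graph α β)) : Prop :=
  (∀ B ∈ bs, IsBlock G B) ∧
    ∀ u ∈ unionVerts bs, ∀ v ∈ unionVerts bs, Joins (unionSkel G bs) Set.univ u v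

theorem IsBlock.joins_unionSkel {bs : List (Graph α β)} (hB : IsBlock G B) (hbs : B ∈ bs)
    (hu : u ∈ V(B)) (hv : v ∈ V(B)) : Joins (unionSkel G bs) Set.univ u v := by
  refine (hB.isBiconnected.joins_univ hu hv).mono_graph fun a b hab => ?_
  exact ⟨skel_mono hB.le hab, B, hbs, skel_adj_left hab, skel_adj_right hab⟩

theorem Chained.singleton (hB : IsBlock G B) : Chained G [B] := by
  refine ⟨by simpa using hB, ?_⟩
  rintro u ⟨B', hB', hu⟩ v ⟨B'', hB'', hv⟩
  rw [List.mem_singleton] at hB' hB''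
  subst hB' hB''
  exact hB.joins_unionSkel (by simp) hu hv

theorem Chained.append {bs : List (Graph α β)} (h : Chained G bs) (hB : IsBlock G B)
    (hs : s ∈ V(B)) (hs' : s ∈ unionVerts bs) : Chained G (bs ++ [B]) := by
  have hle : unionSkel G bs ≤ unionSkel G (bs ++ [B]) := fun a b hab =>
    ⟨hab.1, hab.2.imp fun _ h => ⟨List.mem_append_left _ h.1, h.2⟩⟩
  have key : ∀ u ∈ unionVerts (bs ++ [B]), Joins (unionSkel G (bs ++ [B])) Set.univ u s := by
    rintro u ⟨B', hB', hu⟩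
    rw [List.mem_append, List.mem_singleton] at hB'
    rcases hB' with hB' | rfl
    · exact (h.2 u ⟨B', hB', hu⟩ s hs').mono_graph hle
    · exact hB.joins_unionSkel (by simp) hu hs
  refine ⟨fun B' hB' => ?_, fun u hu v hv => (key u hu).trans (key v hv).symm⟩
  rw [List.mem_append, List.mem_singleton] at hB'
  rcases hB' with hB' | rfl
  exacts [h.1 _ hB', hB]

/-- A component meets a connected union of other components in at most one vertex. -/
theorem Chained.eq_of_mem {bs : List (Graph α β)} (h : Chained G bs) (hB : IsBlock G B)
    (hbs : B ∉ bs) (hu : u ∈ V(B)) (hv : v ∈ V(B)) (hu' : u ∈ unionVerts bs)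
    (hv' : v ∈ unionVerts bs) : u = v := by
  by_contra huv
  obtain ⟨p, hp, -⟩ := (h.2 u hu' v hv').exists_path
  cases p with
  | nil => exact huv rfl
  | @cons _ w _ hw q =>
    have hle : unionSkel G bs ≤ skel G := fun a b hab => hab.1
    have hwB : w ∈ V(B) :=
      hB.support_subset hu hv (p := (q.cons hw).mapLe hle) (hp.mapLe hle) w (by simp)
    obtain ⟨B', hB', huB', hwB'⟩ := hw.2
    exact hbs ((hB.eq_of_adj (h.1 _ hB') hw.1 hu hwB huB' hwB') ▸ hB')

/-! ### Components and cut vertices -/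

theorem IsBlock.isCutVertex (hB : IsBlock G B) (hB' : IsBlock G B') (hne : B ≠ B')
    (hv : v ∈ V(B)) (hv' : v ∈ V(B')) : IsCutVertex G v := by
  refine isCutVertex_iff.2 ⟨hB.mem_vertexSet hv, ?_⟩
  obtain ⟨w, hw, hwB, hBw⟩ := hB.exists_eq_induce_blk hv
  obtain ⟨w', hw', hwB', -⟩ := hB'.exists_eq_induce_blk hv'
  -- If the neighbours `w'` and `w` were joined without `v`, then `w'` would lie in the component of
  -- `vw`: the deletion of `v` leaves it joined to `w`, and any other deletion leaves it adjacent to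
  -- `v`.
  refine ⟨w', skel_adj_right hw', w, skel_adj_right hw, hw'.1.symm, hw.1.symm, fun hj => hne ?_⟩
  refine hB.eq_of_adj hB' hw' hv ?_ hv' hwB'
  rw [hBw]
  intro x hx
  by_cases hxv : x = v
  · exact .inr (hxv ▸ hj)
  · exact .inl (.of_adj hw'.symm (by simpa using hx.symm) (by simpa using fun h => hxv h.symm))

theorem eq_of_not_isCutVertex (hv : ¬ IsCutVertex G v) (hB : IsBlock G B) (hB' : IsBlock G B')
    (h : v ∈ V(B)) (h' : v ∈ V(B')) : B = B' :=
  by_contra fun hne => hv (hB.isCutVertex hB' hne h h')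

theorem mem_of_adj_of_not_isCutVertex (hv : ¬ IsCutVertex G v) (hB : IsBlock G B)
    (h : v ∈ V(B)) (hw : (skel G).Adj v w) : w ∈ V(B) := by
  obtain ⟨B', hB', hv', hw'⟩ := exists_isBlock hw
  exact eq_of_not_isCutVertex hv hB hB' h hv' ▸ hw'

/-- Take the first edges from `c` towards two vertices that `c` separates. They lie in different
components, since a common component would join their far ends without `c`. At least one of the two
differs from `B`. -/
theorem IsCutVertex.exists_other_block (hG : G.toSimpleGraph.Preconnected)
    (hc : IsCutVertex G c) (B : Graph α β) : ∃ B', IsBlock G B' ∧ c ∈ V(B') ∧ B' ≠ B := by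
  rw [isCutVertex_iff] at hc
  obtain ⟨hcV, a, ha, b, hb, hac, hbc, hab⟩ := hc
  rw [preconnected_iff] at hG
  obtain ⟨a', hca', ha'⟩ := (hG c hcV a ha).exists_adj hac.symm
  obtain ⟨b', hcb', hb'⟩ := (hG c hcV b hb).exists_adj hbc.symm
  obtain ⟨A, hA, hcA, haA⟩ := exists_isBlock hca'
  obtain ⟨D, hD, hcD, hbD⟩ := exists_isBlock hcb'
  by_cases hAB : A = B
  · refine ⟨D, hD, hcD, ?_⟩
    rintro rfl
    subst hAB
    have := hA.joins_diff haA hbD hca'.1 hcb'.1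
    exact hab (((ha'.mono fun z hz => hz.2).symm.trans (this.mono fun z hz => hz.2)).trans
      (hb'.mono fun z hz => hz.2))
  · exact ⟨A, hA, hcA, hAB⟩

theorem exists_skel_adj (hG : G.toSimpleGraph.Preconnected) (hn : V(G).Nontrivial)
    (hv : v ∈ V(G)) : ∃ w, (skel G).Adj v w := by
  obtain ⟨u, hu, huv⟩ := hn.exists_ne v
  obtain ⟨w, hw, -⟩ := (preconnected_iff.1 hG v hv u hu).exists_adj huv.symm
  exact ⟨w, hw⟩

theorem exists_isBlock_of_mem (hG : G.toSimpleGraph.Preconnected) (hn : V(G).Nontrivial)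
    (hv : v ∈ V(G)) : ∃ B, IsBlock G B ∧ v ∈ V(B) := by
  obtain ⟨w, hw⟩ := exists_skel_adj hG hn hv
  obtain ⟨B, hB, hvB, -⟩ := exists_isBlock hw
  exact ⟨B, hB, hvB⟩

/-- A connected graph without cut vertices is its own only biconnected component. -/
theorem IsBlock.eq_of_forall_not_isCutVertex (hG : G.toSimpleGraph.Preconnected)
    (hc : ∀ c ∈ V(B), ¬ IsCutVertex G c) (hB : IsBlock G B) : B = G := by
  have hV : V(G) ⊆ V(B) := by
    intro v hv
    by_contra hvB
    obtain ⟨u, hu⟩ := hB.nontrivial.nonempty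
    obtain ⟨a, b, hab, ha, hb, -⟩ := (preconnected_iff.1 hG u (hB.mem_vertexSet hu) v
      hv).exists_crossing V(B) hu hvB
    exact hb (mem_of_adj_of_not_isCutVertex (hc a ha) hB ha hab)
  exact le_antisymm hB.le ⟨hV, fun e a b he => hB.isLink he (hV he.left_mem) (hV he.right_mem)⟩

theorem exists_isEndBlock (hfin : V(G).Finite) (hG : G.toSimpleGraph.Preconnected)
    (hc : ∃ c, IsCutVertex G c) : ∃ B, IsEndBlock G B := by
  obtain ⟨c, hc⟩ := hc
  rw [isCutVertex_iff] at hc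
  obtain ⟨c, hcV, hc, w, hw, hd⟩ := exists_end_blk hfin (preconnected_iff.1 hG) ⟨c, hc⟩
    fun a b hab => skel_adj_left hab
  refine ⟨_, isBlock_induce_blk hw, c, ⟨isCutVertex_iff.2 ⟨hcV, hc⟩, left_mem_blk⟩, ?_⟩
  rintro d ⟨hd1, hd2⟩
  exact hd d hd2 (isCutVertex_iff.1 hd1).2

/-! ### Depth-first traversals -/

theorem blockTree_adj_inl_inr {B : {B : Graph α β // IsBlock G B}}
    {c : {c : α // IsCutVertex G c}} :
    (blockTree G).Adj (Sum.inl B) (Sum.inr c) ↔ c.1 ∈ V(B.1) := by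
  simp [blockTree, SimpleGraph.fromRel_adj]

theorem mem_blocksOf {L : List (BlockNode G)} :
    B ∈ blocksOf L ↔ ∃ h : IsBlock G B, Sum.inl ⟨B, h⟩ ∈ L := by
  simp [blocksOf]

theorem nodup_blocksOf {L : List (BlockNode G)} (h : L.Nodup) : (blocksOf L).Nodup := by
  refine h.filterMap ?_
  rintro (a | a) (b | b) c hc hd <;> simp at hc hd
  rw [Sum.inl.injEq]
  exact Subtype.ext (hc.trans hd.symm)

section DFS

variable {N : Type u} {T : SimpleGraph N} {r : N} {L st : List N}

theorem DFSState.nodup (h : DFSState T r L st) : L.Nodup := by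
  induction h with
  | start => simp
  | discover _ _ hy ih => exact List.nodup_append.2 ⟨ih, by simp, by
      rintro a ha b hb rfl; simp at hb; subst hb; exact hy ha⟩
  | backtrack _ _ ih => exact ih

theorem DFSState.reverse_sublist (h : DFSState T r L st) : st.reverse.Sublist L := by
  induction h with
  | start => simp
  | discover _ _ _ ih =>
    rw [List.reverse_cons]
    exact ih.append (List.Sublist.refl _)
  | backtrack _ _ ih =>
    rw [List.reverse_cons] at ih
    exact (List.sublist_append_left _ _).trans ih

theorem DFSState.root_mem (h : DFSState T r L st) : r ∈ L := by
  induction h with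
  | start => simp
  | discover _ _ _ ih => simp [ih]
  | backtrack _ _ ih => exact ih

/-- A node leaves the stack only by backtracking, which requires all its neighbours to have been
discovered. -/
theorem DFSState.mem_of_adj (h : DFSState T r L st) {x y : N} (hx : x ∈ L) (hst : x ∉ st)
    (hxy : T.Adj x y) : y ∈ L := by
  induction h with
  | start => simp at hx hst; exact absurd hx hst
  | @discover L st a b _ _ _ ih =>
    rw [List.mem_append, List.mem_singleton] at hx ⊢
    rcases hx with hx | rfl
    · exact .inl (ih hx fun h => hst (List.mem_cons_of_mem _ h))
    · simp at hst
  | @backtrack L st a _ ha ih =>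
    by_cases hxa : x = a
    · exact ha y (hxa ▸ hxy)
    · exact ih hx (by simp [hxa, hst])

/-- A traversal can always continue from the latest node with an undiscovered neighbour. -/
theorem DFSState.extend (h : DFSState T r L st) {x y : N} {l₁ l₂ : List N}
    (hL : L = l₁ ++ x :: l₂) (hxy : T.Adj x y) (hy : y ∉ L)
    (hl : ∀ z ∈ l₂, ∀ y', T.Adj z y' → y' ∈ L) : ∃ st', DFSState T r (L ++ [y]) st' := by
  have hx : x ∈ st := by
    by_contra hx
    exact hy (h.mem_of_adj (by simp [hL]) hx hxy)
  induction st with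
  | nil => simp at hx
  | cons a st ih =>
    by_cases hxa : x = a
    · exact ⟨_, .discover h (hxa ▸ hxy) hy⟩
    · have hxst : x ∈ st := (List.mem_cons.1 hx).resolve_left hxa
      -- The top `a` is above `x` on the stack, hence it was discovered after `x`. By hypothesis it
      -- has no undiscovered neighbour left and can be popped.
      refine ih (.backtrack h (hl a ?_)) hxst
      have h1 := h.reverse_sublist
      obtain ⟨s₁, s₂, rfl⟩ := List.append_of_mem hxst
      have h2 : [x, a].Sublist (l₁ ++ x :: l₂) := by
        rw [← hL]
        refine List.Sublist.trans ?_ h1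
        simp only [List.reverse_cons, List.reverse_append, List.append_assoc]
        exact List.Sublist.trans (.cons_cons x (List.sublist_append_right s₁.reverse _))
          (List.sublist_append_right _ _)
      have hn := h.nodup
      rw [hL] at hn
      rw [List.sublist_append_iff] at h2
      obtain ⟨m₁, m₂, hm, hm₁, hm₂⟩ := h2
      have hxl : x ∉ l₁ := fun hx1 => (List.nodup_append.1 hn).2.2 x hx1 x (by simp) rfl
      cases m₁ with
      | nil =>
        rw [List.nil_append] at hm
        rw [← hm, List.cons_sublist_cons] at hm₂
        simpa using hm₂
      | cons b m₁ =>
        rw [List.cons_append, List.cons.injEq] at hm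
        exact absurd (hm₁.subset (by simp [hm.1])) hxl

theorem DFSState.isDFSOrder (h : DFSState T r L st) (hL : ∀ x ∈ L, ∀ y, T.Adj x y → y ∈ L) :
    IsDFSOrder T r L := by
  induction st with
  | nil => exact h
  | cons a st ih =>
    exact ih (.backtrack h (hL a (h.reverse_sublist.subset (by simp))))

end DFS

/-! ### Traversals of the tree reach every component -/

theorem IsBlock.mem_of_closed (hG : G.toSimpleGraph.Preconnected) {P : BlockNode G → Prop}
    (hP : ∀ x y, (blockTree G).Adj x y → P x → P y) (hB : IsBlock G B) (hPB : P (.inl ⟨B, hB⟩))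
    (hB' : IsBlock G B') : P (.inl ⟨B', hB'⟩) := by
  have key : ∀ D D' (hD : IsBlock G D) (hD' : IsBlock G D') (a : α), a ∈ V(D) → a ∈ V(D') →
      P (.inl ⟨D, hD⟩) → P (.inl ⟨D', hD'⟩) := by
    intro D D' hD hD' a ha ha' h
    by_cases hne : D = D'
    · subst hne; exact h
    · let c : {c : α // IsCutVertex G c} := ⟨a, hD.isCutVertex hD' hne ha ha'⟩
      have h1 : (blockTree G).Adj (.inl ⟨D, hD⟩) (.inr c) := blockTree_adj_inl_inr.2 ha
      have h2 : (blockTree G).Adj (.inl ⟨D', hD'⟩) (.inr c) := blockTree_adj_inl_inr.2 ha'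
      exact hP _ _ h2.symm (hP _ _ h1 h)
  obtain ⟨a, ha⟩ := hB.nontrivial.nonempty
  obtain ⟨b, hb⟩ := hB'.nontrivial.nonempty
  by_contra hn
  -- Consider the vertices covered by components with `P`. An edge leaving this set lies in a
  -- component that shares a vertex with one of them, so `P` passes to it through that vertex.
  obtain ⟨c, d, hcd, ⟨D, hD, hc, hPD⟩, hd, -⟩ := (preconnected_iff.1 hG a (hB.mem_vertexSet ha) b
    (hB'.mem_vertexSet hb)).exists_crossing
      {v | ∃ D, ∃ hD : IsBlock G D, v ∈ V(D) ∧ P (.inl ⟨D, hD⟩)} ⟨B, hB, ha, hPB⟩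
      (fun ⟨D, hD, h1, h2⟩ => hn (key _ _ hD hB' b h1 hb h2))
  obtain ⟨E, hE, hc', hd'⟩ := exists_isBlock hcd
  exact hd ⟨E, hE, hd', key _ _ hD hE c hc hc' hPD⟩

theorem IsDFSOrder.mem_blocksOf (hG : G.toSimpleGraph.Preconnected)
    {B₁ : {B : Graph α β // IsBlock G B}} {L : List (BlockNode G)}
    (hL : IsDFSOrder (blockTree G) (.inl B₁) L) (hB : IsBlock G B) : B ∈ blocksOf L :=
  OrderedGraph.mem_blocksOf.2 ⟨hB, IsBlock.mem_of_closed hG (P := (· ∈ L))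
    (fun _ _ hxy hx => DFSState.mem_of_adj hL hx (by simp) hxy) B₁.2
    (DFSState.root_mem hL) hB⟩

end Blocks

end OrderedGraph

/-! ### Precedence in a list -/

namespace OrderedGraph

section Precedence

variable {α : Type u} {a b c : α} {l l₁ l₂ : List α}

theorem pair_sublist_cons : [a, b].Sublist (c :: l) ↔ a = c ∧ b ∈ l ∨ [a, b].Sublist l := by
  rw [List.sublist_cons_iff]
  constructor
  · rintro (h | ⟨r, hr, h⟩)
    · exact .inr h
    · rw [List.cons.injEq] at hr
      obtain ⟨rfl, rfl⟩ := hr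
      exact .inl ⟨rfl, by simpa using h⟩
  · rintro (⟨rfl, h⟩ | h)
    · exact .inr ⟨[b], rfl, by simpa using h⟩
    · exact .inl h

theorem pair_sublist_append : [a, b].Sublist (l₁ ++ l₂) ↔
    [a, b].Sublist l₁ ∨ (a ∈ l₁ ∧ b ∈ l₂) ∨ [a, b].Sublist l₂ := by
  induction l₁ with
  | nil => simp
  | cons c l ih =>
    rw [List.cons_append, pair_sublist_cons, ih, pair_sublist_cons, List.mem_append, List.mem_cons]
    tauto

theorem pair_sublist_or (ha : a ∈ l) (hb : b ∈ l) (h : a ≠ b) :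
    [a, b].Sublist l ∨ [b, a].Sublist l := by
  obtain ⟨l₁, l₂, rfl⟩ := List.append_of_mem ha
  simp only [pair_sublist_append, pair_sublist_cons, List.mem_cons, List.mem_append] at hb ⊢
  tauto

theorem ne_of_pair_sublist (hl : l.Nodup) (h : [a, b].Sublist l) : a ≠ b := by
  have := hl.sublist h
  simpa using this

theorem not_pair_sublist (hl : l.Nodup) (h : [a, b].Sublist l) : ¬ [b, a].Sublist l := by
  induction l with
  | nil => simp at h
  | cons c l ih =>
    rw [List.nodup_cons] at hl
    rw [pair_sublist_cons] at h ⊢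
    have h1 : [a, b].Sublist l → a ∈ l ∧ b ∈ l := fun h =>
      ⟨h.subset (by simp), h.subset (by simp)⟩
    have h2 : [b, a].Sublist l → a ∈ l ∧ b ∈ l := fun h =>
      ⟨h.subset (by simp), h.subset (by simp)⟩
    rintro (⟨rfl, h'⟩ | h')
    · rcases h with ⟨rfl, h⟩ | h
      · exact hl.1 h
      · exact hl.1 (h1 h).2
    · rcases h with ⟨rfl, h⟩ | h
      · exact hl.1 (h2 h').1
      · exact ih hl.2 h h'

end Precedence

/-! ### The objective -/

section Objective

variable {α : Type u} {β : Type v} {G B : Graph α β} {σ τ ρ : List α} {s t v w : α}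

/-- `v` has a neighbour that precedes it in `σ`. -/
def HasLeft (G : Graph α β) (σ : List α) (v : α) : Prop :=
  ∃ w, (skel G).Adj v w ∧ [w, v].Sublist σ

/-- `v` has a neighbour that comes after it in `σ`. -/
def HasRight (G : Graph α β) (σ : List α) (v : α) : Prop :=
  ∃ w, (skel G).Adj v w ∧ [v, w].Sublist σ

/-- `v` has neighbours on both sides in `σ`. -/
def Good (G : Graph α β) (σ : List α) (v : α) : Prop := HasLeft G σ v ∧ HasRight G σ v

theorem one_le_degTo_iff (hG : IsInputGraph G) {S : Set α} :
    1 ≤ degTo G v S ↔ ∃ w, (skel G).Adj v w ∧ w ∈ S := by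
  have := hG.loopless
  have hfin : {e | ∃ w ∈ S, G.IsLink e v w}.Finite :=
    hG.finite_edges.subset fun e ⟨w, _, he⟩ => he.edge_mem
  rw [degTo, Nat.one_le_iff_ne_zero, Ne, Set.ncard_eq_zero hfin, ← Ne,
    ← Set.nonempty_iff_ne_empty]
  constructor
  · rintro ⟨e, w, hw, he⟩
    exact ⟨w, ⟨he.ne, e, he⟩, hw⟩
  · rintro ⟨w, ⟨-, e, he⟩, hw⟩
    exact ⟨e, w, hw, he⟩

theorem leftDeg_pos_iff (hG : IsInputGraph G) : 1 ≤ leftDeg G σ v ↔ HasLeft G σ v :=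
  one_le_degTo_iff hG

theorem rightDeg_pos_iff (hG : IsInputGraph G) : 1 ≤ rightDeg G σ v ↔ HasRight G σ v :=
  one_le_degTo_iff hG

theorem leftDeg_add_rightDeg (hG : IsInputGraph G) (hσ : IsVertexOrder G σ) (hv : v ∈ V(G)) :
    leftDeg G σ v + rightDeg G σ v = deg G v := by
  have := hG.loopless
  have hfin : ∀ S : Set α, {e | ∃ w ∈ S, G.IsLink e v w}.Finite := fun S =>
    hG.finite_edges.subset fun e ⟨w, _, he⟩ => he.edge_mem
  rw [leftDeg, rightDeg, degTo, degTo, deg, ← Set.ncard_union_eq ?_ (hfin _) (hfin _)]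
  · congr 1
    ext e
    constructor
    · rintro (⟨w, -, he⟩ | ⟨w, -, he⟩) <;> exact ⟨w, he⟩
    · rintro ⟨w, he⟩
      rcases pair_sublist_or ((hσ.2 w).2 he.right_mem) ((hσ.2 v).2 hv) he.ne.symm with h | h
      exacts [.inl ⟨w, h, he⟩, .inr ⟨w, h, he⟩]
  · rw [Set.disjoint_left]
    rintro e ⟨w, hw, he⟩ ⟨w', hw', he'⟩
    rw [he.right_unique he'] at hw
    exact not_pair_sublist hσ.1 hw hw'

open Classical in
-- The degree bound enters here: of two positive integers with sum at most 3 one is equal to 1, so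
-- their product is their sum minus 1.
theorem leftDeg_mul_rightDeg (hG : IsInputGraph G) (hσ : IsVertexOrder G σ) (hv : v ∈ V(G)) :
    leftDeg G σ v * rightDeg G σ v = if Good G σ v then deg G v - 1 else 0 := by
  have h := leftDeg_add_rightDeg hG hσ hv
  have h3 := hG.deg_le_three v hv
  rw [Good, ← leftDeg_pos_iff hG, ← rightDeg_pos_iff hG, ← h]
  generalize leftDeg G σ v = a at *
  generalize rightDeg G σ v = b at *
  have ha : a ≤ 3 := by omega
  have hb : b ≤ 3 := by omega
  interval_cases a <;> interval_cases b <;> simp at * <;> omega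

open Classical in
theorem objective_eq (hG : IsInputGraph G) (hσ : IsVertexOrder G σ) :
    objective G σ = ∑ v ∈ hG.finite_vertices.toFinset.filter (Good G σ ·), (deg G v - 1) := by
  rw [objective, finsum_mem_eq_finite_toFinset_sum _ hG.finite_vertices, Finset.sum_filter]
  exact Finset.sum_congr rfl fun v hv => leftDeg_mul_rightDeg hG hσ (by simpa using hv)

/-- An injection of the one-sided vertices of `σ` into those of `τ` that does not decrease degrees
shows that `σ` is at least as good as `τ`. -/
theorem objective_le (hG : IsInputGraph G) (hσ : IsVertexOrder G σ) (hτ : IsVertexOrder G τ)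
    (f : α → α) (hf : ∀ v ∈ V(G), ¬ Good G σ v → f v ∈ V(G) ∧ ¬ Good G τ (f v) ∧
      deg G v ≤ deg G (f v))
    (hinj : ∀ v ∈ V(G), ¬ Good G σ v → ∀ w ∈ V(G), ¬ Good G σ w → f v = f w → v = w) :
    objective G τ ≤ objective G σ := by
  classical
  rw [objective_eq hG hσ, objective_eq hG hτ]
  have h1 := Finset.sum_filter_add_sum_filter_not hG.finite_vertices.toFinset (Good G σ ·)
    fun v => deg G v - 1
  have h2 := Finset.sum_filter_add_sum_filter_not hG.finite_vertices.toFinset (Good G τ ·)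
    fun v => deg G v - 1
  have h3 : ∑ v ∈ hG.finite_vertices.toFinset.filter (¬ Good G σ ·), (deg G v - 1) ≤
      ∑ v ∈ hG.finite_vertices.toFinset.filter (¬ Good G τ ·), (deg G v - 1) := by
    calc _ ≤ ∑ v ∈ hG.finite_vertices.toFinset.filter (¬ Good G σ ·), (deg G (f v) - 1) := by
          refine Finset.sum_le_sum fun v hv => ?_
          simp only [Finset.mem_filter, Set.Finite.mem_toFinset] at hv
          have := (hf v hv.1 hv.2).2.2
          omega
      _ = ∑ v ∈ (hG.finite_vertices.toFinset.filter (¬ Good G σ ·)).image f, (deg G v - 1) := by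
          rw [Finset.sum_image]
          intro v hv w hw h
          simp only [Finset.coe_filter, Set.Finite.mem_toFinset, Set.mem_ofPred_eq] at hv hw
          exact hinj v hv.1 hv.2 w hw.1 hw.2 h
      _ ≤ _ := by
          refine Finset.sum_le_sum_of_subset fun v hv => ?_
          simp only [Finset.mem_image, Finset.mem_filter, Set.Finite.mem_toFinset] at hv ⊢
          obtain ⟨w, hw, rfl⟩ := hv
          have := hf w hw.1 hw.2
          exact ⟨this.1, this.2.1⟩
  omega

/-! ### `s`-`t` orders of components -/

/-- An `s`-`t` order constrains only vertices of degree at least 2. A component with a third vertex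
`v` gives `v` two distinct neighbours: one neighbour `a`, and another on a walk from `v` that avoids
`a`. -/
theorem IsBlock.two_le_deg (hG : IsInputGraph G) (hB : IsBlock G B) (hs : s ∈ V(B))
    (ht : t ∈ V(B)) (hst : s ≠ t) (hv : v ∈ V(B)) (hvs : v ≠ s) (hvt : v ≠ t) :
    2 ≤ deg B v := by
  obtain ⟨a, ha⟩ := hB.exists_skel_adj hv
  obtain ⟨b, hb, hba, hbv⟩ : ∃ b ∈ V(B), b ≠ a ∧ b ≠ v := by
    by_cases h : s = a
    · exact ⟨t, ht, fun h' => hst (h.trans h'.symm), hvt.symm⟩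
    · exact ⟨s, hs, h, hvs.symm⟩
  obtain ⟨a', ha', haj⟩ := (hB.isBiconnected.joins_compl hv hb ha.1.symm hba.symm).exists_adj
    hbv.symm
  obtain ⟨-, e, he⟩ := ha
  obtain ⟨-, e', he'⟩ := ha'
  refine (Set.one_lt_ncard (hG.finite_edges.subset fun e h => ?_)).2
    ⟨e, he.inc_left, e', he'.inc_left, ?_⟩
  · exact hB.le.edgeSet_mono h.edge_mem
  · rintro rfl
    exact haj.left_mem.1 (he'.right_unique he)

theorem hasLeft_of_leftDeg (hG : G.Loopless) (hB : B ≤ G)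
    (h : 1 ≤ leftDeg B ρ v) : HasLeft G ρ v := by
  obtain ⟨e, w, hw, he⟩ := Set.nonempty_of_ncard_ne_zero (Nat.one_le_iff_ne_zero.1 h)
  exact ⟨w, ⟨(he.mono hB).ne, e, he.mono hB⟩, hw⟩

theorem hasRight_of_rightDeg (hG : G.Loopless) (hB : B ≤ G)
    (h : 1 ≤ rightDeg B ρ v) : HasRight G ρ v := by
  obtain ⟨e, w, hw, he⟩ := Set.nonempty_of_ncard_ne_zero (Nat.one_le_iff_ne_zero.1 h)
  exact ⟨w, ⟨(he.mono hB).ne, e, he.mono hB⟩, hw⟩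

theorem IsSTOrder.eq_cons (h : IsSTOrder B s t ρ) : ρ = s :: ρ.tail :=
  (List.cons_head?_tail h.2.1).symm

theorem IsSTOrder.eq_append (h : IsSTOrder B s t ρ) : ρ = ρ.dropLast ++ [t] :=
  (List.dropLast_append_getLast? t h.2.2.1).symm

theorem IsSTOrder.left_mem (h : IsSTOrder B s t ρ) : s ∈ V(B) :=
  (h.1.2 s).1 (h.eq_cons ▸ by simp)

theorem IsSTOrder.right_mem (h : IsSTOrder B s t ρ) : t ∈ V(B) :=
  (h.1.2 t).1 (h.eq_append ▸ by simp)

theorem IsSTOrder.left_sublist (h : IsSTOrder B s t ρ) (hv : v ∈ V(B)) (hvs : v ≠ s) :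
    [s, v].Sublist ρ := by
  have hv' := (h.1.2 v).2 hv
  rw [h.eq_cons] at hv' ⊢
  exact pair_sublist_cons.2 (.inl ⟨rfl, (List.mem_cons.1 hv').resolve_left hvs⟩)

theorem IsSTOrder.sublist_right (h : IsSTOrder B s t ρ) (hv : v ∈ V(B)) (hvt : v ≠ t) :
    [v, t].Sublist ρ := by
  have hv' := (h.1.2 v).2 hv
  rw [h.eq_append] at hv' ⊢
  rw [List.mem_append, List.mem_singleton] at hv'
  exact pair_sublist_append.2 (.inr (.inl ⟨hv'.resolve_right hvt, by simp⟩))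

theorem IsSTOrder.ne (hB : IsBlock G B) (h : IsSTOrder B s t ρ) : s ≠ t := by
  rintro rfl
  obtain ⟨v, hv, hvs⟩ := hB.nontrivial.exists_ne s
  exact not_pair_sublist h.1.1 (h.left_sublist hv hvs) (h.sublist_right hv hvs)

theorem IsSTOrder.hasRight_left (hB : IsBlock G B) (h : IsSTOrder B s t ρ) : HasRight G ρ s := by
  obtain ⟨w, hw⟩ := hB.exists_skel_adj h.left_mem
  exact ⟨w, skel_mono hB.le hw, h.left_sublist (skel_adj_right hw) hw.1.symm⟩

theorem IsSTOrder.hasLeft_right (hB : IsBlock G B) (h : IsSTOrder B s t ρ) : HasLeft G ρ t := by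
  obtain ⟨w, hw⟩ := hB.exists_skel_adj h.right_mem
  exact ⟨w, skel_mono hB.le hw, h.sublist_right (skel_adj_right hw) hw.1.symm⟩

theorem IsSTOrder.good (hG : IsInputGraph G) (hB : IsBlock G B) (h : IsSTOrder B s t ρ)
    (hv : v ∈ V(B)) (hvs : v ≠ s) (hvt : v ≠ t) : Good G ρ v := by
  have := h.2.2.2 v hv hvs hvt
    (hB.two_le_deg hG h.left_mem h.right_mem (h.ne hB) hv hvs hvt)
  exact ⟨hasLeft_of_leftDeg hG.loopless hB.le this.1,
    hasRight_of_rightDeg hG.loopless hB.le this.2⟩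

theorem HasLeft.mono (h : HasLeft G σ v) (hs : ∀ a b, [a, b].Sublist σ → [a, b].Sublist τ) :
    HasLeft G τ v := h.imp fun _ hw => ⟨hw.1, hs _ _ hw.2⟩

theorem HasRight.mono (h : HasRight G σ v) (hs : ∀ a b, [a, b].Sublist σ → [a, b].Sublist τ) :
    HasRight G τ v := h.imp fun _ hw => ⟨hw.1, hs _ _ hw.2⟩

theorem Good.mono (h : Good G σ v) (hs : ∀ a b, [a, b].Sublist σ → [a, b].Sublist τ) :
    Good G τ v := ⟨h.1.mono hs, h.2.mono hs⟩

/-- Dropping the first vertex of `ρ` loses no precedence, because `s` already occurs in `σ`, before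
everything that is appended. -/
theorem sublist_append_tail (h : IsSTOrder B s t ρ) (hs : s ∈ σ) (a b : α)
    (hab : [a, b].Sublist ρ) : [a, b].Sublist (σ ++ ρ.tail) := by
  rw [h.eq_cons, pair_sublist_cons] at hab
  rw [pair_sublist_append]
  rcases hab with ⟨rfl, h'⟩ | h'
  exacts [.inr (.inl ⟨hs, h'⟩), .inr (.inr h')]

/-! ### The invariant of the main loop -/

/-- `v` is the only one-sided vertex, apart from the cut vertex, of an end-component, and has least
degree there. -/
def EndStatus (G : Graph α β) (σ : List α) (v : α) : Prop :=
  ¬ IsCutVertex G v ∧ ∃ B, IsEndBlock G B ∧ v ∈ V(B) ∧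
    ∀ y ∈ V(B), ¬ IsCutVertex G y → deg G v ≤ deg G y ∧ (y ≠ v → Good G σ y)

/-- `v` is a cut vertex from which the next components are still to be attached. -/
def PendingStatus (G : Graph α β) (bs : List (Graph α β)) (σ : List α) (v : α) : Prop :=
  HasLeft G σ v ∧ ∀ B ∈ bs, ∀ B' ∈ bs, v ∈ V(B) → v ∈ V(B') → B = B'

structure CombineInv (G : Graph α β) (bs : List (Graph α β)) (σ : List α) : Prop where
  nodup : σ.Nodup
  mem : ∀ v, v ∈ σ ↔ v ∈ unionVerts bs
  chained : Chained G bs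
  status : ∀ v ∈ σ, Good G σ v ∨ (IsCutVertex G v ∧ PendingStatus G bs σ v) ∨ EndStatus G σ v

theorem EndStatus.mono (h : EndStatus G σ v) (hs : ∀ a b, [a, b].Sublist σ → [a, b].Sublist τ) :
    EndStatus G τ v :=
  ⟨h.1, h.2.imp fun _ hB => ⟨hB.1, hB.2.1, fun y hy hyc =>
    ⟨(hB.2.2 y hy hyc).1, fun hyv => ((hB.2.2 y hy hyc).2 hyv).mono hs⟩⟩⟩

theorem CombineInv.start (hG : IsInputGraph G) (hB : IsEndBlock G B) (ht : IsCutVertex G t)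
    (hs : IsMinDegIn G (V(B) \ {t}) s) (hρ : IsSTOrder B s t ρ) : CombineInv G [B] ρ where
  nodup := hρ.1.1
  mem v := by simp [unionVerts, hρ.1.2]
  chained := .singleton hB.1
  status v hv := by
    have hvB := (hρ.1.2 v).1 hv
    obtain ⟨c, hc, hcu⟩ := hB.2
    have htc := hcu t ⟨ht, hρ.right_mem⟩
    have hcut : ∀ y ∈ V(B), IsCutVertex G y → y = t := fun y hy hyc =>
      (hcu y ⟨hyc, hy⟩).trans htc.symm
    by_cases hvt : v = t
    · subst hvt
      refine .inr (.inl ⟨ht, hρ.hasLeft_right hB.1, ?_⟩)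
      simp
    by_cases hvs : v = s
    · subst hvs
      refine .inr (.inr ⟨fun h => hvt (hcut v hvB h), B, hB, hvB, fun y hy hyc => ?_⟩)
      have hyt : y ≠ t := fun h => hyc (h ▸ ht)
      exact ⟨hs.2 y ⟨hy, hyt⟩, fun hyv => hρ.good hG hB.1 hy hyv hyt⟩
    · exact .inl (hρ.good hG hB.1 hvB hvs hvt)

/-- The new component meets the earlier ones only in `s`, so the other old vertices keep their
status. A pending `s` becomes two-sided. The new terminal `t` has a left neighbour; it gets the end
status in an end-component. Otherwise it is pending, as a new vertex lies in no earlier component.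
-/
theorem CombineInv.step (hG : IsInputGraph G) {before after : List (Graph α β)}
    (h : CombineInv G before σ) (hB : IsBlock G B) (hnew : B ∉ before)
    (hc : LaterChoice G before B after s t) (hρ : IsSTOrder B s t ρ) :
    CombineInv G (before ++ [B]) (σ ++ ρ.tail) := by
  obtain ⟨⟨hsc, hsB, hs⟩, hend, hnend⟩ := hc
  have hsσ : s ∈ σ := (h.mem s).2 hs
  have hst := hρ.ne hB
  have hmem : ∀ v, v ∈ ρ.tail ↔ v ∈ V(B) ∧ v ≠ s := by
    intro v
    have h1 := hρ.1.1
    rw [← hρ.1.2, hρ.eq_cons]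
    rw [hρ.eq_cons, List.nodup_cons] at h1
    simp only [List.tail_cons, List.mem_cons]
    constructor
    · intro hv
      exact ⟨.inr hv, by rintro rfl; exact h1.1 hv⟩
    · rintro ⟨h2 | h2, h3⟩
      exacts [absurd h2 h3, h2]
  have hinter : ∀ v ∈ V(B), v ∈ σ → v = s := fun v hv hvσ =>
    h.chained.eq_of_mem hB hnew hv hsB ((h.mem v).1 hvσ) hs
  have hσ : ∀ a b, [a, b].Sublist σ → [a, b].Sublist (σ ++ ρ.tail) := fun a b hab =>
    hab.trans (List.sublist_append_left _ _)
  have hρ' := sublist_append_tail hρ hsσ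
  refine ⟨?_, fun v => ?_, h.chained.append hB hsB hs, fun v hv => ?_⟩
  · refine List.nodup_append.2 ⟨h.nodup, hρ.1.1.sublist (List.tail_sublist _), ?_⟩
    rintro a ha b hb rfl
    rw [hmem] at hb
    exact hb.2 (hinter a hb.1 ha)
  · rw [List.mem_append, h.mem, hmem]
    simp only [unionVerts, Set.mem_ofPred_eq, List.mem_append, List.mem_singleton]
    constructor
    · rintro (⟨D, hD, hv⟩ | hv)
      exacts [⟨D, .inl hD, hv⟩, ⟨B, .inr rfl, hv.1⟩]
    · rintro ⟨D, hD | rfl, hv⟩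
      · exact .inl ⟨D, hD, hv⟩
      · by_cases hvs : v = s
        · exact .inl (hvs ▸ hs)
        · exact .inr ⟨hv, hvs⟩
  rw [List.mem_append] at hv
  by_cases hvσ : v ∈ σ
  · rcases h.status v hvσ with hgood | ⟨hvc, hleft, huniq⟩ | hE
    · exact .inl (hgood.mono hσ)
    · by_cases hvs : v = s
      · subst hvs
        exact .inl ⟨hleft.mono hσ, (hρ.hasRight_left hB).mono hρ'⟩
      · have hvB : v ∉ V(B) := fun hvB => hvs (hinter v hvB hvσ)
        refine .inr (.inl ⟨hvc, hleft.mono hσ, fun D hD D' hD' hv1 hv2 => ?_⟩)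
        rw [List.mem_append, List.mem_singleton] at hD hD'
        rcases hD with hD | rfl
        · rcases hD' with hD' | rfl
          · exact huniq D hD D' hD' hv1 hv2
          · exact absurd hv2 hvB
        · exact absurd hv1 hvB
    · exact .inr (.inr (hE.mono hσ))
  · have hvρ := (hmem v).1 (hv.resolve_left hvσ)
    by_cases hvt : v = t
    · subst hvt
      have hleft := (hρ.hasLeft_right hB).mono hρ'
      by_cases hB' : IsEndBlock G B
      · obtain ⟨c, hc, hcu⟩ := hB'.2
        have hcut : ∀ y ∈ V(B), IsCutVertex G y → y = s := fun y hy hyc =>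
          (hcu y ⟨hyc, hy⟩).trans (hcu s ⟨hsc, hsB⟩).symm
        refine .inr (.inr ⟨fun h => hst (hcut v hvρ.1 h).symm, B, hB', hvρ.1, fun y hy hyc => ?_⟩)
        have hys : y ≠ s := fun h => hyc (h ▸ hsc)
        exact ⟨(hend hB').2 y ⟨hy, hys⟩, fun hyv => (hρ.good hG hB hy hys hyv).mono hρ'⟩
      · refine .inr (.inl ⟨(hnend hB').1, hleft, fun D hD D' hD' hv1 hv2 => ?_⟩)
        have hnot : ∀ D ∈ before ++ [B], v ∈ V(D) → D = B := by
          intro D hD hvD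
          rw [List.mem_append, List.mem_singleton] at hD
          exact hD.resolve_left fun hD => hvσ ((h.mem v).2 ⟨D, hD, hvD⟩)
        rw [hnot D hD hv1, hnot D' hD' hv2]
    · exact .inl ((hρ.good hG hB hvρ.1 hvρ.2 hvt).mono hρ')

theorem CombineLoop.inv (hG : IsInputGraph G) {before after : List (Graph α β)}
    (h : CombineLoop G before σ after τ) (hinv : CombineInv G before σ)
    (hafter : ∀ B ∈ after, IsBlock G B) (hn : (before ++ after).Nodup) :
    CombineInv G (before ++ after) τ := by
  induction h with
  | done => simpa using hinv
  | @next before after B s t σ ρ τ hc hρ _ ih =>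
    have hB : B ∉ before := fun hB =>
      (List.nodup_append.1 hn).2.2 B hB B (by simp) rfl
    have := ih (hinv.step hG (hafter B (by simp)) hB hc hρ)
      (fun D hD => hafter D (by simp [hD])) (by simpa using hn)
    simpa using this

/-! ### Optimality -/

/-- In every vertex order, every set of at least two vertices has a first and a last vertex. -/
theorem IsVertexOrder.exists_first_last (hτ : IsVertexOrder G τ) (hB : IsBlock G B) :
    ∃ f ∈ V(B), ∃ l ∈ V(B), f ≠ l ∧ (∀ v ∈ V(B), v ≠ f → [f, v].Sublist τ) ∧
      ∀ v ∈ V(B), v ≠ l → [v, l].Sublist τ := by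
  classical
  let ρ := τ.filter (· ∈ V(B))
  have hmem : ∀ v, v ∈ ρ ↔ v ∈ V(B) := fun v => by
    simp only [ρ, List.mem_filter, hτ.2, decide_eq_true_eq]
    exact ⟨fun h => h.2, fun h => ⟨hB.mem_vertexSet h, h⟩⟩
  have hsub : ρ.Sublist τ := List.filter_sublist
  obtain ⟨a, ha, b, hb, hab⟩ := hB.nontrivial
  have hne : ρ ≠ [] := List.ne_nil_of_mem ((hmem a).2 ha)
  have h1 : ∀ v ∈ V(B), v ≠ ρ.head hne → [ρ.head hne, v].Sublist τ := by
    intro v hv hvf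
    refine List.Sublist.trans ?_ hsub
    have hv' := (hmem v).2 hv
    rw [← List.cons_head_tail hne] at hv'
    conv_rhs => rw [← List.cons_head_tail hne]
    exact pair_sublist_cons.2 (.inl ⟨rfl, (List.mem_cons.1 hv').resolve_left hvf⟩)
  have h2 : ∀ v ∈ V(B), v ≠ ρ.getLast hne → [v, ρ.getLast hne].Sublist τ := by
    intro v hv hvf
    refine List.Sublist.trans ?_ hsub
    have hv' := (hmem v).2 hv
    rw [← List.dropLast_append_getLast hne, List.mem_append, List.mem_singleton] at hv'
    conv_rhs => rw [← List.dropLast_append_getLast hne]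
    exact pair_sublist_append.2 (.inr (.inl ⟨hv'.resolve_right hvf, by simp⟩))
  refine ⟨_, (hmem _).1 (ρ.head_mem hne), _, (hmem _).1 (ρ.getLast_mem hne), fun h => ?_, h1, h2⟩
  obtain ⟨v, hv, hvf⟩ := hB.nontrivial.exists_ne (ρ.head hne)
  have h3 := h2 v hv (h ▸ hvf)
  rw [← h] at h3
  exact not_pair_sublist hτ.1 (h1 v hv hvf) h3

/-- All neighbours of a vertex that is not a cut vertex lie in its only component, so an extreme
position there makes it one-sided in the whole order. -/
theorem IsVertexOrder.not_good_of_first (hτ : IsVertexOrder G τ) (hB : IsBlock G B)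
    (hv : v ∈ V(B)) (hvc : ¬ IsCutVertex G v)
    (h : (∀ w ∈ V(B), w ≠ v → [v, w].Sublist τ) ∨ ∀ w ∈ V(B), w ≠ v → [w, v].Sublist τ) :
    ¬ Good G τ v := by
  rintro ⟨⟨a, hva, ha⟩, ⟨b, hvb, hb⟩⟩
  have haB := mem_of_adj_of_not_isCutVertex hvc hB hv hva
  have hbB := mem_of_adj_of_not_isCutVertex hvc hB hv hvb
  rcases h with h | h
  · exact not_pair_sublist hτ.1 ha (h a haB hva.1.symm)
  · exact not_pair_sublist hτ.1 hb (h b hbB hvb.1.symm)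

/-- The first and the last vertex are distinct, so at most one of them is the cut vertex. -/
theorem IsEndBlock.exists_not_good (hτ : IsVertexOrder G τ) (hB : IsEndBlock G B) :
    ∃ x ∈ V(B), ¬ IsCutVertex G x ∧ ¬ Good G τ x := by
  obtain ⟨f, hf, l, hl, hfl, hf', hl'⟩ := hτ.exists_first_last hB.1
  obtain ⟨c, hc, hcu⟩ := hB.2
  by_cases hfc : IsCutVertex G f
  · have hlc : ¬ IsCutVertex G l := fun h =>
      hfl ((hcu f ⟨hfc, hf⟩).trans (hcu l ⟨h, hl⟩).symm)
    exact ⟨l, hl, hlc, hτ.not_good_of_first hB.1 hl hlc (.inr hl')⟩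
  · exact ⟨f, hf, hfc, hτ.not_good_of_first hB.1 hf hfc (.inl hf')⟩

theorem IsInputGraph.nontrivial (hG : IsInputGraph G) : V(G).Nontrivial :=
  (Set.one_lt_ncard_iff_nontrivial_and_finite.1 hG.two_le_card).1

/-- Once all components are processed nothing is pending, as a cut vertex lies in two components.
Every one-sided `v` therefore has the end status. Its image under `f` is a one-sided non-cut vertex
of `τ` in the same end-component; it determines that component and thereby `v`. -/
theorem CombineInv.isOptimalOrder (hG : IsInputGraph G) {bs : List (Graph α β)}
    (h : CombineInv G bs σ) (hall : ∀ B, IsBlock G B → B ∈ bs) : IsOptimalOrder G σ := by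
  classical
  have hpre := hG.connected.preconnected
  have hσ : IsVertexOrder G σ := by
    refine ⟨h.nodup, fun v => ?_⟩
    rw [h.mem]
    constructor
    · rintro ⟨B, hB, hv⟩
      exact (h.chained.1 B hB).mem_vertexSet hv
    · intro hv
      obtain ⟨B, hB, hvB⟩ := exists_isBlock_of_mem hpre hG.nontrivial hv
      exact ⟨B, hall B hB, hvB⟩
  refine ⟨hσ, fun τ hτ => ?_⟩
  have hend : ∀ v, v ∈ V(G) ∧ ¬ Good G σ v → EndStatus G σ v := by
    rintro v ⟨hv, hbad⟩
    rcases h.status v ((hσ.2 v).2 hv) with h1 | ⟨hc, -, hu⟩ | h1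
    · exact absurd h1 hbad
    · obtain ⟨B, hB, hvB⟩ := exists_isBlock_of_mem hpre hG.nontrivial hv
      obtain ⟨B', hB', hvB', hne⟩ := hc.exists_other_block hpre B
      exact absurd (hu B' (hall B' hB') B (hall B hB) hvB' hvB) hne
    · exact h1
  have hex : ∀ v, ∃ x, v ∈ V(G) ∧ ¬ Good G σ v → ∃ B, IsEndBlock G B ∧ v ∈ V(B) ∧ x ∈ V(B) ∧
      ¬ IsCutVertex G x ∧ ¬ Good G τ x ∧ deg G v ≤ deg G x ∧
      ∀ y ∈ V(B), ¬ IsCutVertex G y → y ≠ v → Good G σ y := by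
    intro v
    by_cases hv : v ∈ V(G) ∧ ¬ Good G σ v
    · obtain ⟨-, B, hB, hvB, hy⟩ := hend v hv
      obtain ⟨x, hx, hxc, hxg⟩ := hB.exists_not_good hτ
      exact ⟨x, fun _ => ⟨B, hB, hvB, hx, hxc, hxg, (hy x hx hxc).1,
        fun y hyB hyc => (hy y hyB hyc).2⟩⟩
    · exact ⟨v, fun h => absurd h hv⟩
  choose f hf using hex
  refine objective_le hG hσ hτ f (fun v hv hb => ?_) fun v hv hvb w hw hwb hfv => ?_
  · obtain ⟨B, hB, -, hx, -, hxg, hd, -⟩ := hf v ⟨hv, hb⟩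
    exact ⟨hB.1.mem_vertexSet hx, hxg, hd⟩
  · obtain ⟨B, hB, hvB, hx, hxc, -, -, hy⟩ := hf v ⟨hv, hvb⟩
    obtain ⟨B', hB', hwB', hx', -, -, -, -⟩ := hf w ⟨hw, hwb⟩
    rw [← hfv] at hx'
    have := eq_of_not_isCutVertex hxc hB.1 hB'.1 hx hx'
    subst this
    by_contra hne
    exact hwb (hy w hwB' (hend w ⟨hw, hwb⟩).1 (Ne.symm hne))

theorem IsSTOrder.isOptimalOrder (hG : IsInputGraph G) (hB : IsBlock G G)
    (hc : ∀ c, ¬ IsCutVertex G c) (hs : IsMinDegIn G V(G) s) (ht : IsMinDegIn G (V(G) \ {s}) t)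
    (hρ : IsSTOrder G s t ρ) : IsOptimalOrder G ρ := by
  classical
  refine ⟨hρ.1, fun τ hτ => ?_⟩
  obtain ⟨f, hf, l, hl, hfl, hf', hl'⟩ := hτ.exists_first_last hB
  have hfb := hτ.not_good_of_first hB hf (hc f) (.inl hf')
  have hlb := hτ.not_good_of_first hB hl (hc l) (.inr hl')
  have hbad : ∀ v ∈ V(G), ¬ Good G ρ v → v = s ∨ v = t := by
    intro v hv hb
    by_contra! h
    exact hb (hρ.good hG hB hv h.1 h.2)
  have hst := hρ.ne hB
  -- The ends of `τ` are named so that `b ≠ s`: the degree of `t` is least only among the vertices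
  -- other than `s`, and `t` is to be compared with `b`.
  obtain ⟨a, ha, hab, b, hb, hbb, hab', hbs⟩ : ∃ a ∈ V(G), ¬ Good G τ a ∧ ∃ b ∈ V(G),
      ¬ Good G τ b ∧ a ≠ b ∧ b ≠ s := by
    by_cases hls : l = s
    · exact ⟨l, hl, hlb, f, hf, hfb, hfl.symm, fun h => hfl (h.trans hls.symm)⟩
    · exact ⟨f, hf, hfb, l, hl, hlb, hfl, hls⟩
  refine objective_le hG hρ.1 hτ (fun v => if v = s then a else b) (fun v hv hvb => ?_)
    fun v hv hvb w hw hwb hfv => ?_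
  · rcases hbad v hv hvb with rfl | rfl
    · simp only [if_true]
      exact ⟨ha, hab, hs.2 a ha⟩
    · simp only [if_neg hst.symm]
      exact ⟨hb, hbb, ht.2 b ⟨hb, hbs⟩⟩
  · rcases hbad v hv hvb with rfl | rfl <;> rcases hbad w hw hwb with rfl | rfl
    · rfl
    · simp only [if_true, if_neg hst.symm] at hfv
      exact absurd hfv hab'
    · simp only [if_true, if_neg hst.symm] at hfv
      exact absurd hfv.symm hab'
    · rfl

/-- Every output of `combineST` is optimal. -/
theorem IsCombineSTOutput.isOptimalOrder (hG : IsInputGraph G) (h : IsCombineSTOutput G σ) :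
    IsOptimalOrder G σ := by
  obtain ⟨B, L, rest, s, t, ρ, hL, hbl, hfirst, hρ, hloop⟩ := h
  have hpre := hG.connected.preconnected
  have hall : ∀ D, IsBlock G D → D ∈ B.1 :: rest := fun D hD =>
    hbl ▸ IsDFSOrder.mem_blocksOf hpre hL hD
  have hnd : (B.1 :: rest).Nodup := hbl ▸ nodup_blocksOf (DFSState.nodup hL)
  have hblk : ∀ D ∈ B.1 :: rest, IsBlock G D := fun D hD => by
    rw [← hbl, mem_blocksOf] at hD
    exact hD.1
  rcases hfirst with ⟨hend, htc, -, hs⟩ | ⟨hnc, -, hs, ht⟩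
  · have := hloop.inv hG (.start hG hend htc hs hρ) (fun D hD => hblk D (by simp [hD])) hnd
    exact this.isOptimalOrder hG hall
  · have hBG : ∀ D, IsBlock G D → D = G := fun D hD =>
      hD.eq_of_forall_not_isCutVertex hpre fun c _ => hnc c
    have hrest : rest = [] := by
      rw [List.eq_nil_iff_forall_not_mem]
      intro D hD
      have h1 := hBG D (hblk D (by simp [hD]))
      rw [← hBG B.1 B.2] at h1
      exact (List.nodup_cons.1 hnd).1 (h1 ▸ hD)
    subst hrest
    have hB := hBG B.1 B.2
    have hGG : IsBlock G G := by
      have := B.2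
      rwa [hB] at this
    rw [hB] at hs ht hρ
    cases hloop
    exact hρ.isOptimalOrder hG hGG hnc hs ht

end Objective

end OrderedGraph

/-! ### Total correctness with a step bound -/

namespace RAM

def Store.set (s : Store) (x v : ℕ) : Store := ⟨Function.update s.scalar x v, s.array⟩

def Store.write (s : Store) (a i v : ℕ) : Store :=
  ⟨s.scalar, Function.update s.array a (Function.update (s.array a) i v)⟩

section Store

variable {s : Store} {x y v a b i j : ℕ}

@[simp] theorem Store.set_scalar_self : (s.set x v).scalar x = v := by simp [Store.set]

theorem Store.set_scalar_ne (h : y ≠ x) : (s.set x v).scalar y = s.scalar y := by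
  simp [Store.set, h]

@[simp] theorem Store.set_array : (s.set x v).array = s.array := rfl

@[simp] theorem Store.write_scalar : (s.write a i v).scalar = s.scalar := rfl

theorem Store.write_array_ne (h : b ≠ a) : (s.write a i v).array b = s.array b := by
  simp [Store.write, h]

theorem Store.write_array_self :
    (s.write a i v).array a = Function.update (s.array a) i v := by
  simp [Store.write]

end Store

/-- Started in `s`, the program halts after at most `T` steps, and `Q` holds then. -/
def Computes (P : Program) (s : Store) (T : ℕ) (Q : Store → Prop) : Prop :=
  ∃ k s', Run P s k s' ∧ k ≤ T ∧ Q s'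

section Computes

variable {P P' : Program} {s : Store} {T T' : ℕ} {Q Q' : Store → Prop} {x z b : ℕ} {e f : Expr}

theorem Computes.mono (h : Computes P s T Q) (hT : T ≤ T') (hQ : ∀ s', Q s' → Q' s') :
    Computes P s T' Q' := by
  obtain ⟨k, s', h1, h2, h3⟩ := h
  exact ⟨k, s', h1, h2.trans hT, hQ _ h3⟩

theorem Computes.skip (h : Q s) : Computes .skip s 1 Q := ⟨1, s, .skip s, le_rfl, h⟩

theorem Computes.assign (h : Q (s.set x (e.val s))) : Computes (.assign x e) s 1 Q :=
  ⟨1, _, .assign x e s, le_rfl, h⟩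

theorem Computes.put {a : ℕ} (h : Q (s.write a (e.val s) (f.val s))) :
    Computes (.put a e f) s 1 Q :=
  ⟨1, _, .put a e f s, le_rfl, h⟩

theorem Computes.seq (h : Computes P s T Q) (h' : ∀ s', Q s' → Computes P' s' T' Q') :
    Computes (.seq P P') s (T + T') Q' := by
  obtain ⟨k, s', h1, h2, h3⟩ := h
  obtain ⟨l, s'', h4, h5, h6⟩ := h' s' h3
  exact ⟨k + l, s'', .seq h1 h4, by omega, h6⟩

theorem Computes.branch {c : Test} (h : c.holds s → Computes P s T Q)
    (h' : ¬ c.holds s → Computes P' s T Q) : Computes (.branch c P P') s (T + 1) Q := by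
  by_cases hc : c.holds s
  · obtain ⟨k, s', h1, h2, h3⟩ := h hc
    exact ⟨k + 1, s', .branch_true hc h1, by omega, h3⟩
  · obtain ⟨k, s', h1, h2, h3⟩ := h' hc
    exact ⟨k + 1, s', .branch_false hc h1, by omega, h3⟩

/-- Repeat `P`, incrementing `z` after each round, while `z` is less than `b`. -/
def Program.upTo (z b : ℕ) (P : Program) : Program :=
  .loop (.lt (.var z) (.var b)) (.seq P (.assign z (.add (.var z) (.const 1))))

/-- Run `P` for `z = 0, 1, …` while `z` is less than `b`. -/
def Program.for (z b : ℕ) (P : Program) : Program := .seq (.assign z (.const 0)) (P.upTo z b)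

/-- One round costs the body, the test and the increment, hence `T + 2`; the failing test adds 1. -/
theorem Computes.upTo {i N : ℕ} (I : ℕ → Store → Prop)
    (hI : ∀ j s', I j s' → s'.scalar z = j ∧ s'.scalar b = N)
    (hstep : ∀ j s', j < N → I j s' →
      Computes P s' T fun s'' => I (j + 1) (s''.set z (s''.scalar z + 1)))
    (hi : i ≤ N) (hs : I i s) : Computes (P.upTo z b) s ((N - i) * (T + 2) + 1) (I N) := by
  induction hk : N - i generalizing i s with
  | zero =>
    obtain rfl : i = N := by omega
    refine ⟨1, s, .loop_false ?_, by omega, hs⟩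
    simp [Test.holds, Expr.val, hI i s hs]
  | succ k ih =>
    obtain ⟨l, s', h1, h2, h3⟩ := hstep i s (by omega) hs
    obtain ⟨l', s'', h4, h5, h6⟩ := ih (i := i + 1) (by omega) h3 (by omega)
    refine ⟨l + 1 + l' + 1, s'', .loop_true ?_ (.seq h1 (.assign z _ s')) h4, ?_, h6⟩
    · simp only [Test.holds, Expr.val, hI i s hs]
      omega
    · rw [add_mul]
      omega

theorem Computes.for {N : ℕ} (I : ℕ → Store → Prop)
    (hI : ∀ j s', I j s' → s'.scalar z = j ∧ s'.scalar b = N)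
    (hstep : ∀ j s', j < N → I j s' →
      Computes P s' T fun s'' => I (j + 1) (s''.set z (s''.scalar z + 1)))
    (hs : I 0 (s.set z 0)) : Computes (P.for z b) s (N * (T + 2) + 2) (I N) := by
  refine (Computes.seq (Q := I 0) (T := 1) (.assign hs) fun s' hs' => Computes.upTo I hI hstep
    (Nat.zero_le _) hs').mono ?_ fun _ h => h
  simp only [Nat.sub_zero]
  omega

end Computes

/-! ### A term language with bounded sums and transitive closure -/

/-- Terms over named scalars and arrays. `sum b x t` sums `t` over all values of `x` less than the
scalar `b`; `tc x y φ t t'` decides whether `t'` can be reached from `t` by steps from `x` to `y`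
with `φ ≠ 0` between numbers less than the scalar `0`. -/
inductive Tm where
  | const (k : ℕ)
  | var (x : ℕ)
  | get (a : ℕ) (t : Tm)
  | add (t t' : Tm)
  | sub (t t' : Tm)
  | sum (b x : ℕ) (t : Tm)
  | tc (x y : ℕ) (φ t t' : Tm)

/-- The steps whose transitive closure is taken. -/
def stepRel (n : ℕ) (p : ℕ → ℕ → Prop) (i j : ℕ) : Prop := i < n ∧ j < n ∧ p i j

open Classical in
noncomputable def Tm.eval (arr : ℕ → ℕ → ℕ) : Tm → (ℕ → ℕ) → ℕ
  | .const k, _ => k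
  | .var x, env => env x
  | .get a t, env => arr a (t.eval arr env)
  | .add t t', env => t.eval arr env + t'.eval arr env
  | .sub t t', env => t.eval arr env - t'.eval arr env
  | .sum b x t, env => ∑ i ∈ Finset.range (env b), t.eval arr (Function.update env x i)
  | .tc x y φ t t', env =>
      if Relation.ReflTransGen (stepRel (env 0) fun i j =>
        φ.eval arr (Function.update (Function.update env x i) y j) ≠ 0)
          (t.eval arr env) (t'.eval arr env) then 1 else 0

/-- All names are less than `k`, and the bounds `0` and `1` are never rebound. -/
def Tm.Scoped (k : ℕ) : Tm → Prop
  | .const _ => True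
  | .var x => x < k
  | .get a t => a < k ∧ t.Scoped k
  | .add t t' => t.Scoped k ∧ t'.Scoped k
  | .sub t t' => t.Scoped k ∧ t'.Scoped k
  | .sum b x t => b < 2 ∧ 2 ≤ x ∧ x < k ∧ t.Scoped k
  | .tc x y φ t t' => 2 ≤ x ∧ x < y ∧ y < k ∧ φ.Scoped k ∧ t.Scoped k ∧ t'.Scoped k

theorem Tm.Scoped.mono {k l : ℕ} (hkl : k ≤ l) : ∀ {t : Tm}, t.Scoped k → t.Scoped l
  | .const _, _ => trivial
  | .var _, h => lt_of_lt_of_le h hkl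
  | .get _ _, h => ⟨lt_of_lt_of_le h.1 hkl, h.2.mono hkl⟩
  | .add _ _, h => ⟨h.1.mono hkl, h.2.mono hkl⟩
  | .sub _ _, h => ⟨h.1.mono hkl, h.2.mono hkl⟩
  | .sum _ _ _, h => ⟨h.1, h.2.1, lt_of_lt_of_le h.2.2.1 hkl, h.2.2.2.mono hkl⟩
  | .tc _ _ _ _ _, h => ⟨h.1, h.2.1, lt_of_lt_of_le h.2.2.1 hkl, h.2.2.2.1.mono hkl,
      h.2.2.2.2.1.mono hkl, h.2.2.2.2.2.mono hkl⟩

/-- A term of scope `k` reads no name from `k` on, so it keeps its value when compiled code uses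
those names as temporaries. -/
theorem Tm.eval_congr {k : ℕ} {arr arr' : ℕ → ℕ → ℕ} (harr : ∀ a < k, arr' a = arr a) :
    ∀ {t : Tm} {env env' : ℕ → ℕ}, 2 ≤ k → t.Scoped k → (∀ x < k, env' x = env x) →
      t.eval arr' env' = t.eval arr env := by
  have hupd : ∀ {env env' : ℕ → ℕ} (x i : ℕ), (∀ x < k, env' x = env x) →
      ∀ y < k, Function.update env' x i y = Function.update env x i y := by
    intro env env' x i h y hy
    by_cases hyx : y = x
    · subst hyx; simp
    · simp [hyx, h y hy]
  intro t
  induction t with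
  | const c => intros; rfl
  | var x => intro _ _ _ ht henv; exact henv x ht
  | get a t ih =>
    intro _ _ hk ht henv
    simp only [Tm.eval, ih hk ht.2 henv, harr a ht.1]
  | add t t' ih ih' =>
    intro _ _ hk ht henv
    simp only [Tm.eval, ih hk ht.1 henv, ih' hk ht.2 henv]
  | sub t t' ih ih' =>
    intro _ _ hk ht henv
    simp only [Tm.eval, ih hk ht.1 henv, ih' hk ht.2 henv]
  | sum b x t ih =>
    intro env env' hk ht henv
    simp only [Tm.eval, henv b (by have := ht.1; omega)]
    exact Finset.sum_congr rfl fun i _ => ih hk ht.2.2.2 (hupd x i henv)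
  | tc x y φ t t' ihφ ih ih' =>
    intro env env' hk ht henv
    have hφ : (fun i j => φ.eval arr' (Function.update (Function.update env' x i) y j) ≠ 0) =
        fun i j => φ.eval arr (Function.update (Function.update env x i) y j) ≠ 0 := by
      funext i j
      rw [ihφ hk ht.2.2.2.1 (hupd y j (hupd x i henv))]
    rw [Tm.eval, Tm.eval, ih hk ht.2.2.2.2.1 henv, ih' hk ht.2.2.2.2.2 henv, henv 0 (by omega), hφ]

/-- One sweep of the marking procedure for the transitive closure, with the temporaries from `k`. -/
def markSweep (x y k : ℕ) (P : Program) : Program :=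
  Program.for x 0 (Program.for y 0 (.seq P
    (.branch (.and (.not (.eq (.get k (.var x)) (.const 0))) (.not (.eq (.var (k + 5)) (.const 0))))
      (.put k (.var y) (.const 1)) .skip)))

/-- Code that leaves the value of the term in the scalar `k` and preserves all smaller scalars and
arrays. -/
def Tm.compile : Tm → ℕ → Program
  | .const c, k => .assign k (.const c)
  | .var x, k => .assign k (.var x)
  | .get a t, k => .seq (t.compile k) (.assign k (.get a (.var k)))
  | .add t t', k =>
      .seq (t.compile k) (.seq (t'.compile (k + 1)) (.assign k (.add (.var k) (.var (k + 1)))))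
  | .sub t t', k =>
      .seq (t.compile k) (.seq (t'.compile (k + 1)) (.assign k (.sub (.var k) (.var (k + 1)))))
  | .sum b x t, k =>
      .seq (.assign k (.var x)) <| .seq (.assign (k + 1) (.const 0)) <|
      .seq (Program.for x b (.seq (t.compile (k + 2))
        (.assign (k + 1) (.add (.var (k + 1)) (.var (k + 2)))))) <|
      .seq (.assign x (.var k)) (.assign k (.var (k + 1)))
  | .tc x y φ t t', k =>
      .seq (t.compile k) <| .seq (t'.compile (k + 1)) <|
      .seq (.assign (k + 2) (.var x)) <| .seq (.assign (k + 3) (.var y)) <|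
      .seq (.put k (.var (k + 1)) (.const 0)) <|
      .seq (Program.for x 0 (.put k (.var x) (.const 0))) <|
      .seq (.put k (.var k) (.const 1)) <|
      .seq (Program.for (k + 4) 0 (markSweep x y k (φ.compile (k + 5)))) <|
      .seq (.assign x (.var (k + 2))) <| .seq (.assign y (.var (k + 3)))
        (.assign k (.sub (.const 1) (.sub (.const 1) (.get k (.var (k + 1))))))

/-- A bound for the running time of the code of a term when both loop bounds are at most `N`. -/
def Tm.time (N : ℕ) : Tm → ℕ
  | .const _ => 1
  | .var _ => 1
  | .get _ t => t.time N + 1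
  | .add t t' => t.time N + (t'.time N + 1)
  | .sub t t' => t.time N + (t'.time N + 1)
  | .sum _ _ t => N * (t.time N + 1 + 2) + 6
  | .tc _ _ φ t t' => t.time N + (t'.time N +
      (N * 3 + (N * (N * (N * (φ.time N + 4) + 4) + 4) + 11)))

/-! ### Polynomial time bounds -/

/-- Functions given by a polynomial with natural coefficients. -/
def IsPoly (f : ℕ → ℕ) : Prop := ∃ p : Polynomial ℕ, ∀ N, f N = p.eval N

theorem IsPoly.const (c : ℕ) : IsPoly fun _ => c := ⟨Polynomial.C c, by simp⟩

theorem IsPoly.id : IsPoly fun N => N := ⟨Polynomial.X, by simp⟩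

theorem IsPoly.add {f g : ℕ → ℕ} (hf : IsPoly f) (hg : IsPoly g) : IsPoly fun N => f N + g N := by
  obtain ⟨p, hp⟩ := hf
  obtain ⟨q, hq⟩ := hg
  exact ⟨p + q, by simp [hp, hq]⟩

theorem IsPoly.mul {f g : ℕ → ℕ} (hf : IsPoly f) (hg : IsPoly g) : IsPoly fun N => f N * g N := by
  obtain ⟨p, hp⟩ := hf
  obtain ⟨q, hq⟩ := hg
  exact ⟨p * q, by simp [hp, hq]⟩

theorem Tm.isPoly_time (t : Tm) : IsPoly fun N => t.time N := by
  induction t with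
  | const c => exact .const 1
  | var x => exact .const 1
  | get a t ih => exact ih.add (.const 1)
  | add t t' ih ih' => exact ih.add (ih'.add (.const 1))
  | sub t t' ih ih' => exact ih.add (ih'.add (.const 1))
  | sum b x t ih => exact (IsPoly.id.mul ((ih.add (.const 1)).add (.const 2))).add (.const 6)
  | tc x y φ t t' ihφ ih ih' =>
    exact ih.add (ih'.add ((IsPoly.id.mul (.const 3)).add ((IsPoly.id.mul ((IsPoly.id.mul
      ((IsPoly.id.mul (ihφ.add (.const 4))).add (.const 4))).add (.const 4))).add (.const 11))))

/-! ### Correctness of the compiled code -/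

/-- The stores agree on all scalars and arrays below `k`. -/
def Agree (k : ℕ) (s s' : Store) : Prop :=
  (∀ x < k, s'.scalar x = s.scalar x) ∧ ∀ a < k, s'.array a = s.array a

section Agree

variable {k l x a i v : ℕ} {s s' s'' : Store}

theorem Agree.refl : Agree k s s := ⟨fun _ _ => rfl, fun _ _ => rfl⟩

theorem Agree.trans (h : Agree k s s') (h' : Agree k s' s'') : Agree k s s'' :=
  ⟨fun x hx => (h'.1 x hx).trans (h.1 x hx), fun a ha => (h'.2 a ha).trans (h.2 a ha)⟩

theorem Agree.mono (h : Agree l s s') (hkl : k ≤ l) : Agree k s s' :=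
  ⟨fun x hx => h.1 x (hx.trans_le hkl), fun a ha => h.2 a (ha.trans_le hkl)⟩

theorem Agree.set (h : Agree k s s') (hx : k ≤ x) : Agree k s (s'.set x v) :=
  ⟨fun y hy => by rw [Store.set_scalar_ne (by omega), h.1 y hy], h.2⟩

theorem Agree.eval_eq {t : Tm} (h : Agree k s s') (hk : 2 ≤ k) (ht : t.Scoped k) :
    t.eval s'.array s'.scalar = t.eval s.array s.scalar := Tm.eval_congr h.2 hk ht h.1

end Agree

/-- The specification of the code of a term. -/
def Tm.Correct (t : Tm) : Prop :=
  ∀ (N k : ℕ) (s : Store), 2 ≤ k → t.Scoped k → s.scalar 0 ≤ N → s.scalar 1 ≤ N →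
    Computes (t.compile k) s (t.time N) fun s' =>
      Agree k s s' ∧ s'.scalar k = t.eval s.array s.scalar

theorem Tm.Correct.binop {t t' u : Tm} (h : t.Correct) (h' : t'.Correct)
    (f : Expr → Expr → Expr) (g : ℕ → ℕ → ℕ)
    (hf : ∀ e e' s, (f e e').val s = g (e.val s) (e'.val s))
    (hu : ∀ k, u.compile k =
      .seq (t.compile k) (.seq (t'.compile (k + 1)) (.assign k (f (.var k) (.var (k + 1))))))
    (hs : ∀ k, u.Scoped k → t.Scoped k ∧ t'.Scoped k)
    (he : ∀ arr env, u.eval arr env = g (t.eval arr env) (t'.eval arr env))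
    (ht : ∀ N, u.time N = t.time N + (t'.time N + 1)) : u.Correct := by
  intro N k s hk hsc h0 h1
  rw [hu, ht]
  refine (h N k s hk (hs k hsc).1 h0 h1).seq fun s' ⟨ha, hv⟩ => ?_
  refine (h' N (k + 1) s' (by omega) ((hs k hsc).2.mono (by omega)) ?_ ?_).seq
    fun s'' ⟨ha', hv'⟩ => ?_
  · rwa [ha.1 0 (by omega)]
  · rwa [ha.1 1 (by omega)]
  refine .assign ⟨(ha.trans (ha'.mono (by omega))).set le_rfl, ?_⟩
  rw [Store.set_scalar_self, hf, he, Expr.val, Expr.val, ha'.1 k (by omega), hv, hv',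
    ha.eval_eq hk (hs k hsc).2]

/-- The bound variable `x` is below `k` and may carry a value that is needed outside. It is saved in
scalar `k` and restored, while scalar `k + 1` accumulates the sum. -/
theorem Tm.Correct.sum {t : Tm} (h : t.Correct) (b x : ℕ) : (Tm.sum b x t).Correct := by
  intro N k s hk ⟨hb, hx, hxk, ht⟩ h0 h1
  rw [Tm.compile, Tm.time]
  have hbN : s.scalar b ≤ N := by interval_cases b <;> assumption
  let I : ℕ → Store → Prop := fun j s' =>
    Agree k (s.set x j) s' ∧ s'.scalar k = s.scalar x ∧
      s'.scalar (k + 1) = ∑ i ∈ Finset.range j, t.eval s.array (Function.update s.scalar x i)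
  have hloop : Computes (Program.for x b (.seq (t.compile (k + 2))
      (.assign (k + 1) (.add (.var (k + 1)) (.var (k + 2))))))
      ((s.set k (s.scalar x)).set (k + 1) 0)
      (s.scalar b * (t.time N + 1 + 2) + 2) (I (s.scalar b)) := by
    refine Computes.for I (fun j s' hI => ?_) (fun j s' hj hI => ?_) ?_
    · refine ⟨by rw [hI.1.1 x hxk, Store.set_scalar_self], ?_⟩
      rw [hI.1.1 b (by omega), Store.set_scalar_ne (by omega)]
    · obtain ⟨ha, hk1, hk2⟩ := hI
      have hz : ∀ z, z < 2 → s'.scalar z = s.scalar z := fun z hz => by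
        rw [ha.1 z (by omega), Store.set_scalar_ne (by omega)]
      refine (h N (k + 2) s' (by omega) (ht.mono (by omega)) (by rwa [hz 0 (by omega)])
        (by rwa [hz 1 (by omega)])).seq fun s'' ⟨ha', hv⟩ => .assign ⟨⟨fun y hy => ?_, ?_⟩, ?_, ?_⟩
      · by_cases hyx : y = x
        · subst hyx
          rw [Store.set_scalar_self, Store.set_scalar_self, Store.set_scalar_ne (by omega),
            ha'.1 y (by omega), ha.1 y hxk, Store.set_scalar_self]
        · rw [Store.set_scalar_ne hyx, Store.set_scalar_ne (by omega), ha'.1 y (by omega),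
            ha.1 y hy, Store.set_scalar_ne hyx, Store.set_scalar_ne hyx]
      · intro a hak
        rw [Store.set_array, Store.set_array, ha'.2 a (by omega), ha.2 a hak]
        rfl
      · rw [Store.set_scalar_ne (by omega), Store.set_scalar_ne (by omega), ha'.1 k (by omega), hk1]
      · rw [Store.set_scalar_ne (by omega), Store.set_scalar_self, Expr.val, Expr.val, Expr.val,
          ha'.1 (k + 1) (by omega), hk2, hv, Finset.sum_range_succ, ha.eval_eq hk ht]
        rfl
    · refine ⟨⟨fun y hy => ?_, fun a _ => rfl⟩, ?_, ?_⟩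
      · by_cases hyx : y = x
        · subst hyx; simp
        · rw [Store.set_scalar_ne hyx, Store.set_scalar_ne (by omega),
            Store.set_scalar_ne (by omega), Store.set_scalar_ne hyx]
      · rw [Store.set_scalar_ne (by omega), Store.set_scalar_ne (by omega), Store.set_scalar_self]
      · rw [Store.set_scalar_ne (by omega), Store.set_scalar_self]
        simp
  have hall : Computes (Tm.compile (.sum b x t) k) s
      (1 + (1 + ((s.scalar b * (t.time N + 1 + 2) + 2) + (1 + 1)))) fun s' =>
        Agree k s s' ∧ s'.scalar k = (Tm.sum b x t).eval s.array s.scalar := by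
    rw [Tm.compile]
    refine (Computes.assign (Q := (· = s.set k (s.scalar x))) rfl).seq fun s' hs' => ?_
    refine (Computes.assign (Q := (· = (s.set k (s.scalar x)).set (k + 1) 0))
      (by rw [hs']; rfl)).seq fun s' hs' => ?_
    subst hs'
    refine hloop.seq fun s' ⟨ha, hk1, hk2⟩ => ?_
    refine (Computes.assign (Q := (· = s'.set x (s'.scalar k))) rfl).seq fun s'' hs'' => ?_
    subst hs''
    refine .assign ⟨⟨fun y hy => ?_, ha.2⟩, ?_⟩
    · rw [Store.set_scalar_ne (by omega)]
      by_cases hyx : y = x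
      · subst hyx; rw [Store.set_scalar_self, hk1]
      · rw [Store.set_scalar_ne hyx, ha.1 y hy, Store.set_scalar_ne hyx]
    · rw [Store.set_scalar_self, Expr.val, Store.set_scalar_ne (by omega), hk2]
      rfl
  refine hall.mono ?_ fun _ h => h
  have := Nat.mul_le_mul_right (t.time N + 1 + 2) hbN
  omega

/-- Sets that grow by all successors in each round reach everything after `n` rounds. -/
theorem closure_of_rounds {n a : ℕ} {p : ℕ → ℕ → Prop} (M : ℕ → Set ℕ) (h0 : a ∈ M 0)
    (hmono : ∀ r < n, M r ⊆ M (r + 1))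
    (hstep : ∀ r < n, ∀ i j, i ∈ M r → stepRel n p i j → j ∈ M (r + 1))
    {b : ℕ} (hb : Relation.ReflTransGen (stepRel n p) a b) : b ∈ M n := by
  classical
  have hle : ∀ r s, r ≤ s → s ≤ n → M r ⊆ M s := by
    intro r s hrs
    induction s, hrs using Nat.le_induction with
    | base => exact fun _ => subset_rfl
    | succ s _ ih => exact fun hs => (ih (by omega)).trans (hmono s (by omega))
  -- No step leaves a number that is out of range, so then only `a` itself is reachable.
  by_cases han : n ≤ a
  · have : a = b := by
      rcases hb.cases_head with h | ⟨c, hc, -⟩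
      · exact h
      · exact absurd hc.1 (by omega)
    exact this ▸ hle 0 n (by omega) le_rfl h0
  have hclosed : ∃ r ≤ n, ∀ i j, i ∈ M r → stepRel n p i j → j ∈ M r := by
    -- If no round up to `n` were closed, the number of elements below `n` would grow by at least
    -- one per round, from 1 in round 0 to `n + 1` in round `n`.
    by_contra! hno
    have hcard : ∀ r ≤ n, r + 1 ≤ ((Finset.range n).filter (· ∈ M r)).card := by
      intro r
      induction r with
      | zero =>
        intro _
        rw [Nat.succ_le_iff, Finset.card_pos]
        exact ⟨a, by simp [h0]; omega⟩
      | succ r ih =>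
        intro hr
        refine (Nat.succ_le_succ (ih (by omega))).trans (Finset.card_lt_card ?_)
        obtain ⟨i, j, hi, hij, hj⟩ := hno r (by omega)
        refine ⟨fun z hz => ?_, fun h => ?_⟩
        · simp only [Finset.mem_filter] at hz ⊢
          exact ⟨hz.1, hmono r (by omega) hz.2⟩
        · have := h (Finset.mem_filter.2 ⟨Finset.mem_range.2 hij.2.1,
            hstep r (by omega) i j hi hij⟩)
          exact hj (Finset.mem_filter.1 this).2
    have h1 := hcard n le_rfl
    have h2 := Finset.card_filter_le (Finset.range n) (· ∈ M n)
    rw [Finset.card_range] at h2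
    omega
  obtain ⟨r, hr, hc⟩ := hclosed
  refine hle r n hr le_rfl ?_
  induction hb with
  | refl => exact hle 0 r (by omega) hr h0
  | tail _ hcd ih => exact hc _ _ ih hcd

/-- A sweep marks at least all successors of what was marked before it, and it marks only reachable
numbers. By `closure_of_rounds`, `n` sweeps suffice. The values `a` and `b` of the end terms may be
out of range: cell `b` is cleared separately and cell `a` is marked after all clearing, so the
answer is right in that case too, including `a = b`. -/
theorem Tm.Correct.tc {φ t t' : Tm} (hφ : φ.Correct) (h : t.Correct) (h' : t'.Correct)
    (x y : ℕ) : (Tm.tc x y φ t t').Correct := by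
  classical
  intro N k s hk ⟨hx, hxy, hyk, hsφ, hst, hst'⟩ h0 h1
  let n := s.scalar 0
  let p : ℕ → ℕ → Prop := fun i j =>
    φ.eval s.array (Function.update (Function.update s.scalar x i) y j) ≠ 0
  let a := t.eval s.array s.scalar
  let b := t'.eval s.array s.scalar
  let R := Relation.ReflTransGen (stepRel n p)
  -- the part of the store that is the same in all states of the sweeps
  let F : Store → Prop := fun s' =>
    (∀ z < k, z ≠ x → z ≠ y → s'.scalar z = s.scalar z) ∧ (∀ c < k, s'.array c = s.array c) ∧
      s'.scalar (k + 1) = b ∧ s'.scalar (k + 2) = s.scalar x ∧ s'.scalar (k + 3) = s.scalar y ∧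
        s'.array k a ≠ 0 ∧ (∀ c, (c < n ∨ c = b) → s'.array k c ≠ 0 → R a c)
  have hF0 : ∀ {s'}, F s' → s'.scalar 0 = n := fun hF => hF.1 0 (by omega) (by omega) (by omega)
  have hF1 : ∀ {s'}, F s' → s'.scalar 1 ≤ N := fun {s'} hF => by
    rw [hF.1 1 (by omega) (by omega) (by omega)]; exact h1
  have hFset : ∀ {s'}, F s' → ∀ z v, (z = x ∨ z = y ∨ z = k + 4) → F (s'.set z v) := by
    intro s' hF z v hz
    refine ⟨fun u hu hux huy => ?_, hF.2.1, ?_, ?_, ?_, hF.2.2.2.2.2⟩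
    · rw [Store.set_scalar_ne (by omega), hF.1 u hu hux huy]
    · rw [Store.set_scalar_ne (by omega), hF.2.2.1]
    · rw [Store.set_scalar_ne (by omega), hF.2.2.2.1]
    · rw [Store.set_scalar_ne (by omega), hF.2.2.2.2.1]
  -- one step of a sweep
  let body := Program.seq (φ.compile (k + 5))
    (.branch (.and (.not (.eq (.get k (.var x)) (.const 0))) (.not (.eq (.var (k + 5)) (.const 0))))
      (.put k (.var y) (.const 1)) .skip)
  have hbody : ∀ s', F s' → s'.scalar x < n → s'.scalar y < n →
      Computes body s' (φ.time N + 2) fun s'' => F s'' ∧ s''.scalar x = s'.scalar x ∧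
        s''.scalar y = s'.scalar y ∧ s''.scalar (k + 4) = s'.scalar (k + 4) ∧
        (∀ c, s'.array k c ≠ 0 → s''.array k c ≠ 0) ∧
        (s'.array k (s'.scalar x) ≠ 0 → p (s'.scalar x) (s'.scalar y) →
          s''.array k (s'.scalar y) ≠ 0) := by
    intro s' hF hxn hyn
    refine ((hφ N (k + 5) s' (by omega) (hsφ.mono (by omega)) (by rw [hF0 hF]; exact h0)
      (hF1 hF)).seq (T' := 2) fun s'' ⟨ha, hv⟩ => ?_).mono (by omega) fun _ h => h
    have hpe : s''.scalar (k + 5) ≠ 0 ↔ p (s'.scalar x) (s'.scalar y) := by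
      rw [hv, Tm.eval_congr (arr := s.array) (k := k) hF.2.1 (by omega) hsφ
        (env := Function.update (Function.update s.scalar x (s'.scalar x)) y (s'.scalar y))]
      intro z hz
      by_cases hzy : z = y
      · subst hzy; simp
      by_cases hzx : z = x
      · subst hzx; simp [hzy]
      · simp [hzy, hzx, hF.1 z hz hzx hzy]
    have hxe : s''.scalar x = s'.scalar x := ha.1 x (by omega)
    have hye : s''.scalar y = s'.scalar y := ha.1 y (by omega)
    have hk4 : s''.scalar (k + 4) = s'.scalar (k + 4) := ha.1 (k + 4) (by omega)
    have hak : s''.array k = s'.array k := ha.2 k (by omega)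
    have hF'' : F s'' := by
      refine ⟨fun z hz hzx hzy => ?_, fun c hc => ?_, ?_, ?_, ?_, ?_, ?_⟩
      · rw [ha.1 z (by omega), hF.1 z hz hzx hzy]
      · rw [ha.2 c (by omega), hF.2.1 c hc]
      · rw [ha.1 _ (by omega), hF.2.2.1]
      · rw [ha.1 _ (by omega), hF.2.2.2.1]
      · rw [ha.1 _ (by omega), hF.2.2.2.2.1]
      · rw [hak]; exact hF.2.2.2.2.2.1
      · rw [hak]; exact hF.2.2.2.2.2.2
    refine .branch (T := 1) (fun hc => .put ?_) fun hc => .skip ?_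
    · simp only [Test.holds, Expr.val, hxe] at hc
      simp only [Expr.val]
      have hR : R a (s'.scalar y) :=
        (hF.2.2.2.2.2.2 _ (.inl hxn) (hak ▸ hc.1)).tail ⟨hxn, hyn, hpe.1 hc.2⟩
      refine ⟨⟨hF''.1, fun c hc => ?_, hF''.2.2.1, hF''.2.2.2.1, hF''.2.2.2.2.1, ?_, ?_⟩,
        hxe, hye, hk4, ?_, ?_⟩
      · rw [Store.write_array_ne (by omega), hF''.2.1 c hc]
      · rw [Store.write_array_self, Function.update_apply]
        split_ifs
        exacts [one_ne_zero, hF''.2.2.2.2.2.1]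
      · intro c hc'
        rw [Store.write_array_self, Function.update_apply, hye]
        split_ifs with hcy
        · exact fun _ => hcy ▸ hR
        · exact hF''.2.2.2.2.2.2 c hc'
      · intro c hc'
        rw [Store.write_array_self, Function.update_apply, hak]
        split_ifs
        exacts [one_ne_zero, hc']
      · intro _ _
        rw [Store.write_array_self, hye, Function.update_self]
        exact one_ne_zero
    · refine ⟨hF'', hxe, hye, hk4, fun c hc' => hak ▸ hc', fun hmx hp => absurd ?_ hc⟩
      simp only [Test.holds, Expr.val, hxe]
      exact ⟨hak ▸ hmx, hpe.2 hp⟩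
  -- a sweep
  have hsweep : ∀ s', F s' → Computes (markSweep x y k (φ.compile (k + 5))) s'
      (N * (N * (φ.time N + 4) + 4) + 2) fun s'' => F s'' ∧ s''.scalar (k + 4) = s'.scalar (k + 4) ∧
        (∀ c, s'.array k c ≠ 0 → s''.array k c ≠ 0) ∧
        ∀ i j, stepRel n p i j → s'.array k i ≠ 0 → s''.array k j ≠ 0 := by
    intro s₀ hF₀
    let J : ℕ → Store → Prop := fun i s' => F s' ∧ s'.scalar x = i ∧
      s'.scalar (k + 4) = s₀.scalar (k + 4) ∧ (∀ c, s₀.array k c ≠ 0 → s'.array k c ≠ 0) ∧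
        ∀ i' j, i' < i → stepRel n p i' j → s₀.array k i' ≠ 0 → s'.array k j ≠ 0
    refine (Computes.for (N := n) (T := N * (φ.time N + 4) + 2) J
      (fun j s' hJ => ⟨hJ.2.1, hF0 hJ.1⟩) (fun i s₁ hi hJ => ?_) ?_).mono ?_ ?_
    · let J' : ℕ → Store → Prop := fun j s' => F s' ∧ s'.scalar y = j ∧ s'.scalar x = i ∧
        s'.scalar (k + 4) = s₀.scalar (k + 4) ∧ (∀ c, s₁.array k c ≠ 0 → s'.array k c ≠ 0) ∧
          ∀ j' < j, p i j' → s₁.array k i ≠ 0 → s'.array k j' ≠ 0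
      refine (Computes.for (N := n) (T := φ.time N + 2) J'
        (fun j s' hJ => ⟨hJ.2.1, hF0 hJ.1⟩) (fun j s₂ hj hJ' => ?_) ?_).mono ?_ ?_
      · obtain ⟨hF₂, hy₂, hx₂, hk₂, hm₂, hs₂⟩ := hJ'
        refine (hbody s₂ hF₂ (hx₂ ▸ hi) (hy₂ ▸ hj)).mono le_rfl ?_
        rintro s₃ ⟨hF₃, hx₃, hy₃, hk₃, hm₃, hs₃⟩
        refine ⟨hFset hF₃ _ _ (by omega), by rw [Store.set_scalar_self, hy₃, hy₂], ?_, ?_,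
          fun c hc => hm₃ c (hm₂ c hc), fun j' hj' hp hi' => ?_⟩
        · rw [Store.set_scalar_ne (by omega), hx₃, hx₂]
        · rw [Store.set_scalar_ne (by omega), hk₃, hk₂]
        · rcases Nat.lt_succ_iff_lt_or_eq.1 hj' with hj' | rfl
          · exact hm₃ _ (hs₂ j' hj' hp hi')
          · rw [hx₂, hy₂] at hs₃
            exact hs₃ (hm₂ _ hi') hp
      · refine ⟨hFset hJ.1 _ _ (by omega), by simp, ?_, ?_, fun c hc => hc, by omega⟩
        · rw [Store.set_scalar_ne (by omega), hJ.2.1]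
        · rw [Store.set_scalar_ne (by omega), hJ.2.2.1]
      · exact Nat.add_le_add_right (Nat.mul_le_mul_right (φ.time N + 4) h0) 2
      · rintro s₂ ⟨hF₂, hy₂, hx₂, hk₂, hm₂, hs₂⟩
        refine ⟨hFset hF₂ _ _ (by omega), by rw [Store.set_scalar_self, hx₂], ?_,
          fun c hc => hm₂ c (hJ.2.2.2.1 c hc), fun i' j hi' hij hc => ?_⟩
        · rw [Store.set_scalar_ne (by omega), hk₂]
        · rcases Nat.lt_succ_iff_lt_or_eq.1 hi' with hi' | rfl
          · exact hm₂ _ (hJ.2.2.2.2 i' j hi' hij hc)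
          · exact hs₂ j hij.2.1 hij.2.2 (hJ.2.2.2.1 _ hc)
    · refine ⟨hFset hF₀ _ _ (by omega), by simp, ?_, fun c hc => hc, by omega⟩
      rw [Store.set_scalar_ne (by omega)]
    · exact Nat.add_le_add_right (Nat.mul_le_mul_right (N * (φ.time N + 4) + 4) h0) 2
    · rintro s' ⟨hF', -, hk', hm', hs'⟩
      exact ⟨hF', hk', hm', fun i j hij hc => hs' i j hij.1 hij hc⟩
  -- all sweeps
  have hsweeps : ∀ s', F s' → Computes (Program.for (k + 4) 0
      (markSweep x y k (φ.compile (k + 5)))) s' (N * (N * (N * (φ.time N + 4) + 4) + 4) + 2)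
      fun s'' => F s'' ∧ (R a b → s''.array k b ≠ 0) := by
    intro s₀ hF₀
    let J : ℕ → Store → Prop := fun i s' => F s' ∧ s'.scalar (k + 4) = i ∧
      ∃ M : ℕ → Set ℕ, a ∈ M 0 ∧ (∀ r < i, M r ⊆ M (r + 1)) ∧
        (∀ r < i, ∀ i j, i ∈ M r → stepRel n p i j → j ∈ M (r + 1)) ∧
          ∀ c ∈ M i, s'.array k c ≠ 0
    refine (Computes.for (N := n) (T := N * (N * (φ.time N + 4) + 4) + 2) J
      (fun j s' hJ => ⟨hJ.2.1, hF0 hJ.1⟩) (fun i s₁ hi hJ => ?_) ?_).mono ?_ ?_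
    · obtain ⟨hF₁, hk₁, M, hM0, hMm, hMs, hM⟩ := hJ
      refine (hsweep s₁ hF₁).mono le_rfl ?_
      rintro s₂ ⟨hF₂, hk₂, hm₂, hs₂⟩
      -- The history of marked sets is prolonged by the marks present after this sweep.
      refine ⟨hFset hF₂ _ _ (by omega), by rw [Store.set_scalar_self, hk₂, hk₁],
        fun r => if r ≤ i then M r else {c | s₂.array k c ≠ 0}, by simpa using hM0, ?_, ?_, ?_⟩
      · intro r hr
        beta_reduce
        by_cases hri : r = i
        · subst hri
          rw [if_pos le_rfl, if_neg (by omega)]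
          exact fun c hc => hm₂ c (hM c hc)
        · rw [if_pos (by omega), if_pos (by omega)]
          exact hMm r (by omega)
      · intro r hr u v hu huv
        beta_reduce at hu ⊢
        rw [if_pos (by omega)] at hu
        by_cases hri : r = i
        · subst hri
          rw [if_neg (by omega)]
          exact hs₂ u v huv (hM u hu)
        · rw [if_pos (by omega)]
          exact hMs r (by omega) u v hu huv
      · intro c hc
        beta_reduce at hc
        rw [if_neg (by omega)] at hc
        exact hc
    · refine ⟨hFset hF₀ _ _ (by omega), by simp, fun _ => {a}, rfl, by omega, by omega, ?_⟩
      rintro c rfl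
      exact hF₀.2.2.2.2.2.1
    · exact Nat.add_le_add_right
        (Nat.mul_le_mul_right (N * (N * (φ.time N + 4) + 4) + 4) h0) 2
    · rintro s' ⟨hF', -, M, hM0, hMm, hMs, hM⟩
      exact ⟨hF', fun hR => hM b (closure_of_rounds M hM0 hMm hMs hR)⟩
  -- the whole program
  rw [Tm.compile]
  refine Computes.mono (T := t.time N + (t'.time N + (1 + (1 + (1 + ((N * 3 + 2) + (1 +
    ((N * (N * (N * (φ.time N + 4) + 4) + 4) + 2) + (1 + (1 + 1)))))))))) ?_
    (by rw [Tm.time]; omega) fun _ h => h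
  refine (h N k s hk hst h0 h1).seq fun s₁ ⟨ha₁, hv₁⟩ => ?_
  have e0 := ha₁.1 0 (by omega)
  have e1 := ha₁.1 1 (by omega)
  refine (h' N (k + 1) s₁ (by omega) (hst'.mono (by omega)) (by omega) (by omega)).seq
    fun s₂ ⟨ha₂, hv₂⟩ => ?_
  rw [ha₁.eval_eq hk hst'] at hv₂
  have hka : s₂.scalar k = a := (ha₂.1 k (by omega)).trans hv₁
  have ha₂' : Agree k s s₂ := ha₁.trans (ha₂.mono (by omega))
  refine (Computes.assign (Q := (· = s₂.set (k + 2) (s.scalar x))) ?_).seq ?_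
  · rw [Expr.val, ha₂'.1 x (by omega)]
  rintro _ rfl
  refine (Computes.assign (Q := (· = (s₂.set (k + 2) (s.scalar x)).set (k + 3)
    (s.scalar y))) ?_).seq
    ?_
  · rw [Expr.val, Store.set_scalar_ne (by omega), ha₂'.1 y (by omega)]
  rintro _ rfl
  set s₃ := (s₂.set (k + 2) (s.scalar x)).set (k + 3) (s.scalar y) with hs₃
  have hk0 : s₃.scalar k = a := by
    rw [hs₃, Store.set_scalar_ne (by omega), Store.set_scalar_ne (by omega), hka]
  have hk1 : s₃.scalar (k + 1) = b := by
    rw [hs₃, Store.set_scalar_ne (by omega), Store.set_scalar_ne (by omega), hv₂]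
  have ha₃ : Agree k s s₃ := (ha₂'.set (by omega)).set (by omega)
  have hk2 : s₃.scalar (k + 2) = s.scalar x := by
    rw [hs₃, Store.set_scalar_ne (by omega), Store.set_scalar_self]
  have hk3 : s₃.scalar (k + 3) = s.scalar y := by rw [hs₃, Store.set_scalar_self]
  refine (Computes.put (Q := (· = s₃.write k b 0)) (by simp only [Expr.val, hk1])).seq ?_
  rintro _ rfl
  -- clearing the marks
  let C : ℕ → Store → Prop := fun i s' => s'.scalar x = i ∧
    (∀ z, z ≠ x → s'.scalar z = s₃.scalar z) ∧ (∀ c < k, s'.array c = s.array c) ∧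
      ∀ c, (c < i ∨ c = b) → s'.array k c = 0
  have hclear : Computes (Program.for x 0 (.put k (.var x) (.const 0))) (s₃.write k b 0)
      (N * 3 + 2) (C n) := by
    refine (Computes.for (N := n) (T := 1) C (fun j s' hC => ⟨hC.1, ?_⟩) (fun j s' hj hC => ?_)
      ?_).mono ?_ fun _ h => h
    · rw [hC.2.1 0 (by omega), ha₃.1 0 (by omega)]
    · refine .put ⟨?_, fun z hz => ?_, fun c hc => ?_, fun c hc => ?_⟩
      · simp [hC.1]
      · rw [Store.set_scalar_ne hz]
        exact hC.2.1 z hz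
      · rw [Store.set_array, Store.write_array_ne (by omega), hC.2.2.1 c hc]
      · rw [Store.set_array, Store.write_array_self, Function.update_apply]
        simp only [Expr.val, hC.1]
        split_ifs with hcj
        · rfl
        · exact hC.2.2.2 c (by omega)
    · refine ⟨by simp, fun z hz => by rw [Store.set_scalar_ne hz]; rfl, fun c hc => ?_,
        fun c hc => ?_⟩
      · rw [Store.set_array, Store.write_array_ne (by omega), ha₃.2 c hc]
      · obtain rfl : c = b := by omega
        rw [Store.set_array, Store.write_array_self, Function.update_self]
    · have := Nat.mul_le_mul_right 3 h0
      omega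
  refine hclear.seq fun s₄ ⟨_, hC1, hC2, hC3⟩ => ?_
  have hF₅ : F (s₄.write k a 1) := by
    refine ⟨fun z hz hzx _ => ?_, fun c hc => ?_, ?_, ?_, ?_, ?_, fun c hc => ?_⟩
    · rw [Store.write_scalar, hC1 z hzx, ha₃.1 z hz]
    · rw [Store.write_array_ne (by omega), hC2 c hc]
    · rw [Store.write_scalar, hC1 _ (by omega), hk1]
    · rw [Store.write_scalar, hC1 _ (by omega), hk2]
    · rw [Store.write_scalar, hC1 _ (by omega), hk3]
    · simp [Store.write_array_self]
    · rw [Store.write_array_self, Function.update_apply]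
      split_ifs with hca
      · exact fun _ => hca ▸ .refl
      · exact fun h => absurd (hC3 c hc) h
  refine (Computes.put (Q := (· = s₄.write k a 1)) ?_).seq ?_
  · simp only [Expr.val]
    rw [hC1 k (by omega), hk0]
  rintro _ rfl
  refine (hsweeps _ hF₅).seq fun s₆ ⟨hF₆, hR₆⟩ => ?_
  refine (Computes.assign (Q := (· = s₆.set x (s.scalar x))) (by
    rw [Expr.val, hF₆.2.2.2.1])).seq ?_
  rintro _ rfl
  refine (Computes.assign (Q := (· = (s₆.set x (s.scalar x)).set y (s.scalar y))) (by
    rw [Expr.val, Store.set_scalar_ne (by omega), hF₆.2.2.2.2.1])).seq ?_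
  rintro _ rfl
  have hval : 1 - (1 - s₆.array k b) = (Tm.tc x y φ t t').eval s.array s.scalar := by
    by_cases hab : R a b
    · have := hR₆ hab
      rw [Tm.eval, if_pos hab]
      omega
    · have : s₆.array k b = 0 := by_contra fun h => hab (hF₆.2.2.2.2.2.2 b (.inr rfl) h)
      rw [Tm.eval, if_neg hab, this]
  refine .assign ⟨⟨fun z hz => ?_, hF₆.2.1⟩, ?_⟩
  · rw [Store.set_scalar_ne (by omega)]
    by_cases hzy : z = y
    · subst hzy; rw [Store.set_scalar_self]
    rw [Store.set_scalar_ne hzy]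
    by_cases hzx : z = x
    · subst hzx; rw [Store.set_scalar_self]
    · rw [Store.set_scalar_ne hzx, hF₆.1 z hz hzx hzy]
  · simp only [Expr.val]
    rw [Store.set_scalar_self, Store.set_scalar_ne (by omega), Store.set_scalar_ne (by omega),
      hF₆.2.2.1]
    exact hval

theorem Tm.correct (t : Tm) : t.Correct := by
  induction t with
  | const c =>
    intro N k s _ _ _ _
    exact .assign ⟨Agree.refl.set le_rfl, by simp [Expr.val, Tm.eval]⟩
  | var x =>
    intro N k s _ _ _ _
    exact .assign ⟨Agree.refl.set le_rfl, by simp [Expr.val, Tm.eval]⟩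
  | get a t ih =>
    intro N k s hk hs h0 h1
    refine (ih N k s hk hs.2 h0 h1).seq fun s' ⟨ha, hv⟩ => .assign ⟨ha.set le_rfl, ?_⟩
    rw [Store.set_scalar_self, Expr.val, Expr.val, hv, ha.2 a hs.1, Tm.eval]
  | add t t' ih ih' =>
    exact ih.binop ih' .add (· + ·) (fun _ _ _ => rfl) (fun _ => rfl) (fun _ h => h)
      (fun _ _ => rfl) fun _ => rfl
  | sub t t' ih ih' =>
    exact ih.binop ih' .sub (· - ·) (fun _ _ _ => rfl) (fun _ => rfl) (fun _ h => h)
      (fun _ _ => rfl) fun _ => rfl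
  | sum b x t ih => exact ih.sum b x
  | tc x y φ t t' ihφ ih ih' => exact ihφ.tc ih ih' x y

end RAM

/-! ### Formulas -/

namespace RAM

namespace Tm

/-- A term read as a formula: it holds if the value is not zero. -/
def Holds (arr : ℕ → ℕ → ℕ) (t : Tm) (env : ℕ → ℕ) : Prop := t.eval arr env ≠ 0

def not (t : Tm) : Tm := .sub (.const 1) t

def and (t t' : Tm) : Tm := .not (.add (.not t) (.not t'))

def or (t t' : Tm) : Tm := .add t t'

def lt (t t' : Tm) : Tm := .sub t' t

def le (t t' : Tm) : Tm := .not (.lt t' t)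

def eq (t t' : Tm) : Tm := .not (.or (.lt t t') (.lt t' t))

def ex (b x : ℕ) (t : Tm) : Tm := .sum b x t

def all (b x : ℕ) (t : Tm) : Tm := .not (.ex b x (.not t))

/-- The least value of `x` for which the formula `φ` holds. -/
def first (x x' : ℕ) (φ : Tm) : Tm :=
  .sum 0 x' (.not (.ex 0 x (.and (.le (.var x) (.var x')) φ)))

section Semantics

variable {arr : ℕ → ℕ → ℕ} {env : ℕ → ℕ} {t t' φ : Tm} {b x x' y a : ℕ}

@[simp] theorem eval_var : (Tm.var x).eval arr env = env x := rfl

@[simp] theorem eval_get : (Tm.get a t).eval arr env = arr a (t.eval arr env) := rfl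

@[simp] theorem holds_not : Holds arr (.not t) env ↔ ¬ Holds arr t env := by
  simp only [Holds, not, eval]
  omega

@[simp] theorem holds_or : Holds arr (.or t t') env ↔ Holds arr t env ∨ Holds arr t' env := by
  simp only [Holds, or, eval]
  omega

@[simp] theorem holds_and : Holds arr (.and t t') env ↔ Holds arr t env ∧ Holds arr t' env := by
  simp only [Holds, and, not, eval]
  omega

@[simp] theorem holds_lt : Holds arr (.lt t t') env ↔ t.eval arr env < t'.eval arr env := by
  simp only [Holds, lt, eval]
  omega

@[simp] theorem holds_le : Holds arr (.le t t') env ↔ t.eval arr env ≤ t'.eval arr env := by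
  simp [le]

@[simp] theorem holds_eq : Holds arr (.eq t t') env ↔ t.eval arr env = t'.eval arr env := by
  simp only [eq, holds_not, holds_or, holds_lt]
  omega

@[simp] theorem holds_ex : Holds arr (.ex b x t) env ↔
    ∃ i < env b, Holds arr t (Function.update env x i) := by
  simp [Holds, ex, eval, Finset.sum_eq_zero_iff]

@[simp] theorem holds_all : Holds arr (.all b x t) env ↔
    ∀ i < env b, Holds arr t (Function.update env x i) := by
  simp [all]

theorem holds_tc : Holds arr (.tc x y φ t t') env ↔
    Relation.ReflTransGen (stepRel (env 0) fun i j =>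
      Holds arr φ (Function.update (Function.update env x i) y j))
        (t.eval arr env) (t'.eval arr env) := by
  classical
  rw [Holds, eval]
  split_ifs with h
  · exact ⟨fun _ => h, fun _ => one_ne_zero⟩
  · exact ⟨fun h' => absurd rfl h', fun h' => absurd h' h⟩

open Classical in
theorem eval_not : (Tm.not t).eval arr env = if Holds arr t env then 0 else 1 := by
  rw [Holds, not, eval, eval]
  split_ifs <;> omega

/-- The sum counts the numbers `i` with no witness up to `i`, and their count is the least witness.
Hypothesis `h` says in particular that the meaning of `φ` does not depend on the auxiliary counter
`x'`. -/
theorem eval_first (P : ℕ → Prop) (hx' : 2 ≤ x') (hne : x ≠ x')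
    (h : ∀ i j, j < env 0 →
      (Holds arr φ (Function.update (Function.update env x' i) x j) ↔ P j))
    (hex : ∃ j < env 0, P j) :
    P ((first x x' φ).eval arr env) ∧ (first x x' φ).eval arr env < env 0 := by
  classical
  have hr := Nat.find_spec hex
  have : (first x x' φ).eval arr env = Nat.find hex := by
    rw [first, eval]
    have : ∀ i ∈ Finset.range (env 0),
        ((Tm.ex 0 x ((Tm.le (.var x) (.var x')).and φ)).not).eval arr (Function.update env x' i) =
          if i < Nat.find hex then 1 else 0 := by
      intro i hi
      rw [eval_not, holds_ex, Function.update_of_ne (by omega)]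
      have hiff : (∃ j < env 0, Holds arr ((Tm.le (.var x) (.var x')).and φ)
          (Function.update (Function.update env x' i) x j)) ↔ ¬ i < Nat.find hex := by
        rw [not_lt, Nat.find_le_iff]
        constructor
        · rintro ⟨j, hj, hh⟩
          rw [holds_and, holds_le, h i j hj] at hh
          simp [hne.symm] at hh
          exact ⟨j, hh.1, hj, hh.2⟩
        · rintro ⟨j, hji, hj, hP⟩
          refine ⟨j, hj, ?_⟩
          rw [holds_and, holds_le, h i j hj]
          simpa [hne.symm] using ⟨hji, hP⟩
      by_cases hlt : i < Nat.find hex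
      · rw [if_neg (by rw [hiff]; simpa using hlt), if_pos hlt]
      · rw [if_pos (hiff.2 hlt), if_neg hlt]
    rw [Finset.sum_congr rfl this, Finset.sum_boole]
    have : (Finset.range (env 0)).filter (· < Nat.find hex) = Finset.range (Nat.find hex) := by
      ext z
      simp only [Finset.mem_filter, Finset.mem_range]
      omega
    rw [this, Finset.card_range, Nat.cast_id]
  rw [this]
  exact ⟨hr.2, hr.1⟩

end Semantics

/-! ### The formulas used by the program -/

/-- Scalars 0 and 1 hold `n` and `m`, and scalar 2 the length of the partial order in array 2.
Scalars 3 and 4 hold the edge `sw` that fixes the current component, 5 its last vertex `t`, and 6 an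
intermediate result. Names from 7 on are bound; nested formulas bind different ones, so nothing is
captured. -/
def adj (x y : ℕ) : Tm :=
  .ex 1 7 (.or (.and (.eq (.get 0 (.var 7)) (.var x)) (.eq (.get 1 (.var 7)) (.var y)))
    (.and (.eq (.get 0 (.var 7)) (.var y)) (.eq (.get 1 (.var 7)) (.var x))))

/-- The disjunction is a sum of truth values. The double negation reduces it to 0 or 1, so that the
outer sum counts edges. -/
def deg (x : ℕ) : Tm :=
  .sum 1 7 (.not (.not (.or (.eq (.get 0 (.var 7)) (.var x)) (.eq (.get 1 (.var 7)) (.var x)))))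

/-- The closure contains the walk of length zero, so the start has to be kept away from `x`
explicitly. -/
def joins (x u v : ℕ) : Tm :=
  .and (.not (.eq (.var u) (.var x)))
    (.tc 8 9 (.and (adj 8 9) (.and (.not (.eq (.var 8) (.var x))) (.not (.eq (.var 9) (.var x)))))
      (.var u) (.var v))

def blk (s w v : ℕ) : Tm :=
  .all 0 10 (.or (.eq (.var 10) (.var v)) (.or (joins 10 v s) (joins 10 v w)))

def cut (c : ℕ) : Tm :=
  .ex 0 11 (.ex 0 12 (.and (.not (.eq (.var 11) (.var c)))
    (.and (.not (.eq (.var 12) (.var c))) (.not (joins c 11 12)))))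

def placed (v : ℕ) : Tm :=
  .ex 0 13 (.and (.lt (.var 13) (.var 2)) (.eq (.get 2 (.var 13)) (.var v)))

def keyLe (u y : ℕ) : Tm := .or (cut u) (.and (.not (cut y)) (.le (deg u) (deg y)))

def terminal : Tm :=
  .first 14 39 (.and (blk 3 4 14) (.and (.not (.eq (.var 14) (.var 3)))
    (.all 0 15 (.or (.not (blk 3 4 15)) (.or (.eq (.var 15) (.var 3)) (keyLe 14 15))))))

def done : Tm := .all 0 16 (.or (.not (blk 3 4 16)) (placed 16))

def hasOut (u : ℕ) : Tm := .ex 0 21 (.and (adj u 21) (.not (placed 21)))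

/-- `hasOut` takes the name of a scalar. Hence 20 ranges over all values and is compared with the
entry at position 19. -/
def source : Tm :=
  .first 17 39 (.ex 0 18 (.and (.lt (.var 18) (.var 2)) (.and (.eq (.get 2 (.var 18)) (.var 17))
    (.and (hasOut 17) (.all 0 19 (.all 0 20 (.or (.le (.var 19) (.var 18))
      (.or (.le (.var 2) (.var 19)) (.or (.not (.eq (.get 2 (.var 19)) (.var 20)))
        (.not (hasOut 20)))))))))))

def newNbr : Tm := .first 22 39 (.and (adj 3 22) (.not (placed 22)))

def outside (z : ℕ) : Tm := .and (.not (placed z)) (blk 3 4 z)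

def next : Tm :=
  .first 23 39 (.and (outside 23) (.and
    (.ex 0 24 (.and (placed 24) (.and (blk 3 4 24) (adj 24 23))))
    (.all 0 25 (.or (.not (outside 25)) (.or (.eq (.var 25) (.var 23))
      (.tc 26 27 (.and (adj 26 27) (.and (.and (outside 26) (.not (.eq (.var 26) (.var 23))))
        (.and (outside 27) (.not (.eq (.var 27) (.var 23))))))
        (.var 25) (.var 5)))))))

/-- Asking for at most one cut vertex in the component covers both forms of the first choice, an
end-component and a graph without cut vertices. -/
def start : Tm :=
  .first 28 39 (.and (.not (cut 28)) (.ex 0 29 (.and (adj 28 29) (.and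
    (.all 0 30 (.all 0 31 (.or (.not (.and (blk 28 29 30) (cut 30)))
      (.or (.not (.and (blk 28 29 31) (cut 31))) (.eq (.var 30) (.var 31))))))
    (.all 0 30 (.or (.not (blk 28 29 30)) (.or (cut 30) (.le (deg 28) (deg 30)))))))))

end Tm

/-! ### Their meaning -/

open OrderedGraph

/-- The memory holds the input graph `G`. -/
structure Encodes (G : Graph ℕ ℕ) (arr : ℕ → ℕ → ℕ) (env : ℕ → ℕ) : Prop where
  vert : V(G) = {i | i < env 0}
  edge : E(G) = {k | k < env 1}
  link : ∀ k < env 1, G.IsLink k (arr 0 k) (arr 1 k)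
  input : IsInputGraph G

/-- The memory holds the partial order `σ`. -/
structure Tracks (σ : List ℕ) (arr : ℕ → ℕ → ℕ) (env : ℕ → ℕ) : Prop where
  len : env 2 = σ.length
  le : σ.length ≤ env 0
  out : ∀ i (h : i < σ.length), arr 2 i = σ[i]

section Meaning

variable {G : Graph ℕ ℕ} {arr : ℕ → ℕ → ℕ} {env : ℕ → ℕ} {σ : List ℕ} {x y u v s w c i : ℕ}

theorem Encodes.update (h : Encodes G arr env) (hx : 2 ≤ x := by decide) :
    Encodes G arr (Function.update env x i) := by
  have h0 : Function.update env x i 0 = env 0 := Function.update_of_ne (by omega) _ _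
  have h1 : Function.update env x i 1 = env 1 := Function.update_of_ne (by omega) _ _
  exact ⟨by rw [h0]; exact h.vert, by rw [h1]; exact h.edge, by rw [h1]; exact h.link, h.input⟩

theorem Tracks.update (h : Tracks σ arr env) (hx : 3 ≤ x := by decide) :
    Tracks σ arr (Function.update env x i) := by
  have h0 : Function.update env x i 0 = env 0 := Function.update_of_ne (by omega) _ _
  have h2 : Function.update env x i 2 = env 2 := Function.update_of_ne (by omega) _ _
  exact ⟨by rw [h2]; exact h.len, by rw [h0]; exact h.le, h.out⟩

theorem Encodes.mem_iff (h : Encodes G arr env) : v ∈ V(G) ↔ v < env 0 := by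
  rw [h.vert]; rfl

theorem Encodes.holds_adj (h : Encodes G arr env) (hx : x ≠ 7 := by decide)
    (hy : y ≠ 7 := by decide) :
    (Tm.adj x y).Holds arr env ↔ (skel G).Adj (env x) (env y) := by
  have := h.input.loopless
  simp only [Tm.adj, Tm.holds_ex, Tm.holds_or, Tm.holds_and, Tm.holds_eq, Tm.eval_var, Tm.eval_get,
    Function.update_self, Function.update_of_ne hx, Function.update_of_ne hy]
  constructor
  · rintro ⟨k, hk, ⟨h1, h2⟩ | ⟨h1, h2⟩⟩
    · have := h.link k hk
      rw [h1, h2] at this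
      exact ⟨this.ne, k, this⟩
    · have := (h.link k hk).symm
      rw [h1, h2] at this
      exact ⟨this.ne, k, this⟩
  · rintro ⟨-, k, hk⟩
    have hkm : k < env 1 := by
      have := hk.edge_mem
      rwa [h.edge] at this
    refine ⟨k, hkm, ?_⟩
    rcases (h.link k hkm).eq_and_eq_or_eq_and_eq hk with h' | h'
    exacts [.inl h', .inr h']

theorem Encodes.eval_deg (h : Encodes G arr env) (hx : x ≠ 7 := by decide) :
    (Tm.deg x).eval arr env = OrderedGraph.deg G (env x) := by
  classical
  have hset : {e | G.Inc e (env x)} = ↑((Finset.range (env 1)).filter fun k =>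
      arr 0 k = env x ∨ arr 1 k = env x) := by
    ext k
    simp only [Finset.coe_filter, Finset.mem_range, Set.mem_ofPred_eq]
    constructor
    · intro hk
      have hkm : k < env 1 := by
        have := hk.edge_mem
        rwa [h.edge] at this
      refine ⟨hkm, ?_⟩
      rcases hk.eq_or_eq_of_isLink (h.link k hkm) with h' | h'
      exacts [.inl h'.symm, .inr h'.symm]
    · rintro ⟨hk, h1 | h1⟩
      · exact h1 ▸ (h.link k hk).inc_left
      · exact h1 ▸ (h.link k hk).inc_right
  rw [OrderedGraph.deg, hset, Set.ncard_coe_finset, Finset.card_filter, Tm.deg, Tm.eval]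
  refine Finset.sum_congr rfl fun k _ => ?_
  rw [Tm.eval_not]
  simp only [Tm.holds_not, Tm.holds_or, Tm.holds_eq, Tm.eval_var, Tm.eval_get,
    Function.update_self, Function.update_of_ne hx]
  split_ifs <;> simp_all

theorem Encodes.holds_joins (h : Encodes G arr env) (hx : x ≠ 7 ∧ x ≠ 8 ∧ x ≠ 9 := by decide) :
    (Tm.joins x u v).Holds arr env ↔ Joins (skel G) {env x}ᶜ (env u) (env v) := by
  rw [Tm.joins, Tm.holds_and, Tm.holds_not, Tm.holds_eq, Tm.holds_tc, joins_iff_reflTransGen]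
  have : (stepRel (env 0) fun i j => Tm.Holds arr (.and (Tm.adj 8 9)
      (.and (.not (.eq (.var 8) (.var x))) (.not (.eq (.var 9) (.var x)))))
        (Function.update (Function.update env 8 i) 9 j)) =
      fun a b => (skel G).Adj a b ∧ a ∈ ({env x}ᶜ : Set ℕ) ∧ b ∈ ({env x}ᶜ : Set ℕ) := by
    funext a b
    have h' : Encodes G arr (Function.update (Function.update env 8 a) 9 b) := h.update.update
    simp only [stepRel, Tm.holds_and, Tm.holds_not, Tm.holds_eq, h'.holds_adj (x := 8) (y := 9),
      Tm.eval_var]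
    simp only [Function.update_self, Function.update_of_ne hx.2.1, Function.update_of_ne hx.2.2,
      Function.update_of_ne (show (8 : ℕ) ≠ 9 by decide), Set.mem_compl_iff,
      Set.mem_singleton_iff, eq_iff_iff]
    constructor
    · exact fun h => h.2.2
    · exact fun h'' => ⟨h.mem_iff.1 (skel_adj_left h''.1), h.mem_iff.1 (skel_adj_right h''.1), h''⟩
  rw [this]
  simp

theorem Encodes.holds_blk (h : Encodes G arr env) (hs : s ≠ 10 := by decide)
    (hw : w ≠ 10 := by decide) (hv : v ≠ 10 := by decide) (hsV : env s ∈ V(G))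
    (hvV : env v ∈ V(G)) :
    (Tm.blk s w v).Holds arr env ↔ env v ∈ OrderedGraph.blk (skel G) (env s) (env w) := by
  have hj : ∀ z u, (Tm.joins 10 v u).Holds arr (Function.update env 10 z) ↔
      Joins (skel G) {z}ᶜ (env v) (Function.update env 10 z u) := fun z u => by
    rw [(h.update (x := 10) (i := z)).holds_joins (x := 10), Function.update_self,
      Function.update_of_ne hv]
  simp only [Tm.blk, Tm.holds_all, Tm.holds_or, Tm.holds_eq, Tm.eval_var, hj,
    Function.update_self, Function.update_of_ne hs, Function.update_of_ne hw,
    Function.update_of_ne hv, OrderedGraph.blk, Set.mem_ofPred_eq]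
  constructor
  · intro hall z hz
    by_cases hzn : z < env 0
    · exact (hall z hzn).resolve_left hz
    -- The term quantifies over vertices only. A number `z` that is not a vertex lies on no walk, so
    -- connectedness of `G` settles this case.
    · refine .inl ((preconnected_iff.1 h.input.connected.preconnected _ hvV _ hsV).restrict
        fun y hy => ?_)
      rintro rfl
      exact hzn (h.mem_iff.1 (hy.mem_vertexSet hsV))
  · intro hall z _
    by_cases hz : z = env v
    · exact .inl hz
    · exact .inr (hall z hz)

theorem Encodes.holds_cut (h : Encodes G arr env)
    (hc : c ≠ 7 ∧ c ≠ 8 ∧ c ≠ 9 ∧ c ≠ 11 ∧ c ≠ 12 := by decide) (hcV : env c ∈ V(G)) :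
    (Tm.cut c).Holds arr env ↔ IsCutVertex G (env c) := by
  rw [isCutVertex_iff, and_iff_right hcV]
  simp only [Tm.cut, Tm.holds_ex, Tm.holds_and, Tm.holds_not, Tm.holds_eq, Tm.eval_var,
    ((h.update (x := 11)).update (x := 12)).holds_joins (x := c) ⟨hc.1, hc.2.1, hc.2.2.1⟩,
    Function.update_self, Function.update_of_ne hc.2.2.2.1, Function.update_of_ne hc.2.2.2.2,
    Function.update_of_ne (show (11 : ℕ) ≠ 12 by decide),
    Function.update_of_ne (show (0 : ℕ) ≠ 11 by decide), Separates, h.mem_iff]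

theorem Tracks.holds_placed (h : Tracks σ arr env) (hv : v ≠ 13 := by decide) :
    (Tm.placed v).Holds arr env ↔ env v ∈ σ := by
  simp only [Tm.placed, Tm.holds_ex, Tm.holds_and, Tm.holds_lt, Tm.holds_eq, Tm.eval_var,
    Tm.eval_get, Function.update_self, Function.update_of_ne hv,
    Function.update_of_ne (show (2 : ℕ) ≠ 13 by decide), h.len]
  rw [List.mem_iff_getElem]
  constructor
  · rintro ⟨i, -, hi, he⟩
    exact ⟨i, hi, (h.out i hi).symm.trans he⟩
  · rintro ⟨i, hi, he⟩
    exact ⟨i, hi.trans_le h.le, hi, (h.out i hi).trans he⟩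

end Meaning

end RAM

/-! ### The choices of the program -/

namespace OrderedGraph

section Choices

variable (G : Graph ℕ ℕ) (σ : List ℕ)

/-- Cut vertices come first, then vertices of small degree. -/
def KeyLe (u y : ℕ) : Prop := IsCutVertex G u ∨ ¬ IsCutVertex G y ∧ deg G u ≤ deg G y

/-- An admissible last vertex for the component of the edge `sw` when `s` is its first vertex. -/
def IsTerminal (s w u : ℕ) : Prop :=
  u ∈ blk (skel G) s w ∧ u ≠ s ∧ ∀ y ∈ blk (skel G) s w, y ≠ s → KeyLe G u y

def HasOut (u : ℕ) : Prop := ∃ w, (skel G).Adj u w ∧ w ∉ σ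

/-- The last vertex of `σ` with a neighbour outside `σ`. -/
def IsSource (u : ℕ) : Prop :=
  ∃ l₁ l₂, σ = l₁ ++ u :: l₂ ∧ HasOut G σ u ∧ ∀ z ∈ l₂, ¬ HasOut G σ z

/-- An admissible next vertex in the component of the edge `sw` with last vertex `t`. -/
def IsNext (s w t v : ℕ) : Prop :=
  (v ∈ blk (skel G) s w ∧ v ∉ σ) ∧ (∃ a ∈ σ, a ∈ blk (skel G) s w ∧ (skel G).Adj a v) ∧
    ∀ y ∈ blk (skel G) s w, y ∉ σ → y ≠ v →
      Joins (skel G) ((blk (skel G) s w \ {z | z ∈ σ}) \ {v}) y t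

/-- An admissible first vertex of the whole order. -/
def IsStart (s : ℕ) : Prop :=
  s ∈ V(G) ∧ ¬ IsCutVertex G s ∧ ∃ w, (skel G).Adj s w ∧
    (∀ y ∈ blk (skel G) s w, ∀ z ∈ blk (skel G) s w,
      IsCutVertex G y → IsCutVertex G z → y = z) ∧
    ∀ y ∈ blk (skel G) s w, ¬ IsCutVertex G y → deg G s ≤ deg G y

theorem isSource_iff {u : ℕ} : IsSource G σ u ↔ ∃ i, ∃ hi : i < σ.length, σ[i] = u ∧ HasOut G σ u ∧
    ∀ j, ∀ hj : j < σ.length, i < j → ¬ HasOut G σ σ[j] := by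
  constructor
  · rintro ⟨l₁, l₂, rfl, h1, h2⟩
    refine ⟨l₁.length, by simp, by simp, h1, fun j hj hlt => h2 _ ?_⟩
    rw [List.getElem_append_right hlt.le, List.getElem_cons, dif_neg (by omega)]
    exact List.getElem_mem _
  · rintro ⟨i, hi, rfl, h1, h2⟩
    refine ⟨σ.take i, σ.drop (i + 1), ?_, h1, fun z hz => ?_⟩
    · rw [← List.drop_eq_getElem_cons hi, List.take_append_drop]
    · rw [List.mem_iff_getElem] at hz
      obtain ⟨j, hj, rfl⟩ := hz
      rw [List.getElem_drop]
      rw [List.length_drop] at hj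
      exact h2 _ (by omega) (by omega)

end Choices

end OrderedGraph

namespace RAM

open OrderedGraph

/-! ### Correctness of the terms that make the choices -/

section Meaning

variable {G : Graph ℕ ℕ} {arr : ℕ → ℕ → ℕ} {env : ℕ → ℕ} {σ : List ℕ} {x y u v s w c i : ℕ}

theorem Encodes.holds_keyLe (h : Encodes G arr env)
    (hu : u ≠ 7 ∧ u ≠ 8 ∧ u ≠ 9 ∧ u ≠ 11 ∧ u ≠ 12 := by decide)
    (hy : y ≠ 7 ∧ y ≠ 8 ∧ y ≠ 9 ∧ y ≠ 11 ∧ y ≠ 12 := by decide)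
    (huV : env u ∈ V(G)) (hyV : env y ∈ V(G)) :
    (Tm.keyLe u y).Holds arr env ↔ KeyLe G (env u) (env y) := by
  simp only [Tm.keyLe, Tm.holds_or, Tm.holds_and, Tm.holds_not, Tm.holds_le, KeyLe,
    h.holds_cut hu huV, h.holds_cut hy hyV, h.eval_deg hu.1, h.eval_deg hy.1]

theorem Encodes.holds_hasOut (h : Encodes G arr env) (hσ : Tracks σ arr env)
    (hu : u ≠ 7 ∧ u ≠ 21 := by decide) :
    (Tm.hasOut u).Holds arr env ↔ HasOut G σ (env u) := by
  simp only [Tm.hasOut, Tm.holds_ex, Tm.holds_and, Tm.holds_not,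
    (h.update (x := 21)).holds_adj (x := u) (y := 21) hu.1,
    (hσ.update (x := 21)).holds_placed (v := 21), Function.update_self,
    Function.update_of_ne hu.2, HasOut]
  constructor
  · rintro ⟨i, -, hi⟩
    exact ⟨i, hi⟩
  · rintro ⟨i, hi⟩
    exact ⟨i, h.mem_iff.1 (skel_adj_right hi.1), hi⟩

theorem Encodes.holds_done (h : Encodes G arr env) (hσ : Tracks σ arr env)
    (hsw : (skel G).Adj (env 3) (env 4)) :
    Tm.done.Holds arr env ↔ ∀ v ∈ OrderedGraph.blk (skel G) (env 3) (env 4), v ∈ σ := by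
  have key : ∀ i < env 0, (Tm.or (.not (Tm.blk 3 4 16)) (Tm.placed 16)).Holds arr
      (Function.update env 16 i) ↔ (i ∈ OrderedGraph.blk (skel G) (env 3) (env 4) → i ∈ σ) := by
    intro i hi
    have u3 : Function.update env 16 i 3 = env 3 := by simp
    have u4 : Function.update env 16 i 4 = env 4 := by simp
    have u16 : Function.update env 16 i 16 = i := Function.update_self ..
    rw [Tm.holds_or, Tm.holds_not, (hσ.update (x := 16)).holds_placed,
      (h.update (x := 16)).holds_blk (s := 3) (w := 4) (v := 16)
        (hsV := by rw [u3]; exact skel_adj_left hsw) (hvV := by rw [u16]; exact h.mem_iff.2 hi),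
      u3, u4, u16, imp_iff_not_or]
  rw [Tm.done, Tm.holds_all]
  exact ⟨fun hall v hv => (key v (h.mem_iff.1 (blk_subset hsw hv))).1
    (hall v (h.mem_iff.1 (blk_subset hsw hv))) hv, fun hall i hi => (key i hi).2 (hall i)⟩

theorem Encodes.eval_terminal (h : Encodes G arr env) (hsw : (skel G).Adj (env 3) (env 4))
    (hex : ∃ u, IsTerminal G (env 3) (env 4) u) :
    IsTerminal G (env 3) (env 4) (Tm.terminal.eval arr env) := by
  refine (Tm.eval_first (IsTerminal G (env 3) (env 4)) (by decide) (by decide)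
    (fun i j hj => ?_) ?_).1
  · set env' := Function.update (Function.update env 39 i) 14 j with henv'
    have h' : Encodes G arr env' := h.update.update
    have e14 : env' 14 = j := Function.update_self ..
    have e3 : env' 3 = env 3 := by simp [henv']
    have e4 : env' 4 = env 4 := by simp [henv']
    have e0 : env' 0 = env 0 := by simp [henv']
    have hjV : j ∈ V(G) := h.mem_iff.2 hj
    have key : ∀ y < env' 0, (Tm.or (.not (Tm.blk 3 4 15)) (.or (.eq (.var 15) (.var 3))
        (Tm.keyLe 14 15))).Holds arr (Function.update env' 15 y) ↔
        (y ∈ OrderedGraph.blk (skel G) (env 3) (env 4) → y ≠ env 3 → KeyLe G j y) := by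
      intro y hy
      have hyV : y ∈ V(G) := h'.mem_iff.2 hy
      have u3 : Function.update env' 15 y 3 = env 3 := by simp [e3]
      have u4 : Function.update env' 15 y 4 = env 4 := by simp [e4]
      have u14 : Function.update env' 15 y 14 = j := by simp [e14]
      have u15 : Function.update env' 15 y 15 = y := Function.update_self ..
      have h'' : Encodes G arr (Function.update env' 15 y) := h'.update
      rw [Tm.holds_or, Tm.holds_or, Tm.holds_not, Tm.holds_eq, Tm.eval_var, Tm.eval_var,
        h''.holds_blk (hsV := by rw [u3]; exact skel_adj_left hsw) (hvV := by rwa [u15]),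
        h''.holds_keyLe (huV := by rwa [u14]) (hyV := by rwa [u15]), u3, u4, u14, u15]
      rw [← or_iff_not_imp_left, imp_iff_not_or]
    rw [Tm.holds_and, Tm.holds_and, Tm.holds_not, Tm.holds_eq, Tm.eval_var, Tm.eval_var,
      h'.holds_blk (hsV := by rw [e3]; exact skel_adj_left hsw) (hvV := by rwa [e14]),
      Tm.holds_all, e3, e4, e14, IsTerminal]
    refine and_congr_right fun _ => and_congr_right fun _ => ⟨fun hall y hy => ?_,
      fun hall y hy => (key y hy).2 (hall y)⟩
    have := e0 ▸ h.mem_iff.1 (blk_subset hsw hy)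
    exact (key y this).1 (hall y this) hy
  · obtain ⟨u, hu⟩ := hex
    exact ⟨u, h.mem_iff.1 (blk_subset hsw hu.1), hu⟩

theorem Encodes.eval_newNbr (h : Encodes G arr env) (hσ : Tracks σ arr env)
    (hex : HasOut G σ (env 3)) :
    (skel G).Adj (env 3) (Tm.newNbr.eval arr env) ∧ Tm.newNbr.eval arr env ∉ σ := by
  refine (Tm.eval_first (fun u => (skel G).Adj (env 3) u ∧ u ∉ σ) (by decide) (by decide)
    (fun i j hj => ?_) ?_).1
  · rw [Tm.holds_and, Tm.holds_not, ((h.update (x := 39)).update (x := 22)).holds_adj,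
      ((hσ.update (x := 39)).update (x := 22)).holds_placed]
    simp
  · obtain ⟨u, hu⟩ := hex
    exact ⟨u, h.mem_iff.1 (skel_adj_right hu.1), hu⟩

theorem Encodes.eval_source (h : Encodes G arr env) (hσ : Tracks σ arr env)
    (hσV : ∀ v ∈ σ, v ∈ V(G)) (hex : ∃ u, IsSource G σ u) :
    IsSource G σ (Tm.source.eval arr env) := by
  refine (Tm.eval_first (IsSource G σ) (by decide) (by decide) (fun i j hj => ?_) ?_).1
  · set env' := Function.update (Function.update env 39 i) 17 j with henv'
    have h' : Encodes G arr env' := h.update.update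
    have hσ' : Tracks σ arr env' := hσ.update.update
    have e17 : env' 17 = j := Function.update_self ..
    rw [isSource_iff, Tm.holds_ex]
    have key : ∀ a b c, (Tm.or (.le (.var 19) (.var 18))
      (.or (.le (.var 2) (.var 19)) (.or (.not (.eq (.get 2 (.var 19)) (.var 20)))
        (.not (Tm.hasOut 20))))).Holds arr (Function.update (Function.update (Function.update env'
          18 a) 19 b) 20 c) ↔ (a < b → b < σ.length → arr 2 b = c → ¬ HasOut G σ c) := by
      intro a b c
      have hσ'' : Tracks σ arr (Function.update (Function.update (Function.update env'
        18 a) 19 b) 20 c) := ((hσ'.update (x := 18)).update (x := 19)).update (x := 20)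
      have h'' : Encodes G arr (Function.update (Function.update (Function.update env'
        18 a) 19 b) 20 c) := ((h'.update (x := 18)).update (x := 19)).update (x := 20)
      simp only [Tm.holds_or, Tm.holds_le, Tm.holds_not, Tm.holds_eq, Tm.eval_var, Tm.eval_get,
        hσ''.len, h''.holds_hasOut hσ'' (u := 20)]
      simp only [Function.update_self, ne_eq, Nat.reduceEqDiff, not_false_eq_true,
        Function.update_of_ne]
      rw [← not_lt, ← not_lt]
      tauto
    have key' : ∀ a, (Tm.and (.lt (.var 18) (.var 2)) (.and (.eq (.get 2 (.var 18)) (.var 17))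
        (.and (Tm.hasOut 17) (.all 0 19 (.all 0 20 (.or (.le (.var 19) (.var 18))
          (.or (.le (.var 2) (.var 19)) (.or (.not (.eq (.get 2 (.var 19)) (.var 20)))
            (.not (Tm.hasOut 20)))))))))).Holds arr (Function.update env' 18 a) ↔
        (a < σ.length ∧ arr 2 a = j ∧ HasOut G σ j ∧ ∀ b < env 0, ∀ c < env 0, a < b →
          b < σ.length → arr 2 b = c → ¬ HasOut G σ c) := by
      intro a
      rw [Tm.holds_and, Tm.holds_and, Tm.holds_and, Tm.holds_lt, Tm.holds_eq, Tm.holds_all,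
        (h'.update (x := 18)).holds_hasOut (hσ'.update (x := 18)), Tm.eval_var, Tm.eval_var,
        Tm.eval_get, Tm.eval_var, Tm.eval_var, (hσ'.update (x := 18)).len]
      simp only [Tm.holds_all, key]
      simp [henv']
    simp only [key']
    constructor
    · rintro ⟨a, -, ha, haj, ho, hall⟩
      refine ⟨a, ha, (hσ.out a ha).symm.trans haj, ho, fun b hb hab => ?_⟩
      exact hall b (hb.trans_le hσ.le) _ (h.mem_iff.1 (hσV _ (List.getElem_mem hb))) hab hb
        (hσ.out b hb)
    · rintro ⟨a, ha, haj, ho, hall⟩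
      refine ⟨a, ?_, ha, (hσ.out a ha).trans haj, ho, fun b _ c _ hab hb hc => ?_⟩
      · have : env' 0 = env 0 := by simp [henv']
        exact this ▸ ha.trans_le hσ.le
      · rw [← hc, hσ.out b hb]
        exact hall b hb hab
  · obtain ⟨u, hu⟩ := hex
    obtain ⟨l₁, l₂, rfl, -⟩ := id hu
    exact ⟨u, h.mem_iff.1 (hσV u (by simp)), hu⟩

theorem Encodes.holds_outside (h : Encodes G arr env) (hσ : Tracks σ arr env) (hv : v ≠ 10 ∧ v ≠ 13)
    (hs : env 3 ∈ V(G)) (hvV : env v ∈ V(G)) : (Tm.outside v).Holds arr env ↔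
      env v ∈ OrderedGraph.blk (skel G) (env 3) (env 4) ∧ env v ∉ σ := by
  rw [Tm.outside, Tm.holds_and, Tm.holds_not, hσ.holds_placed hv.2,
    h.holds_blk (hv := hv.1) (hsV := hs) (hvV := hvV), and_comm]

theorem Encodes.eval_next (h : Encodes G arr env) (hσ : Tracks σ arr env)
    (hsw : (skel G).Adj (env 3) (env 4)) (hex : ∃ u, IsNext G σ (env 3) (env 4) (env 5) u) :
    IsNext G σ (env 3) (env 4) (env 5) (Tm.next.eval arr env) := by
  have hsV := skel_adj_left hsw
  refine (Tm.eval_first (IsNext G σ (env 3) (env 4) (env 5)) (by decide) (by decide)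
    (fun i j hj => ?_) ?_).1
  · set env' := Function.update (Function.update env 39 i) 23 j with henv'
    have h' : Encodes G arr env' := h.update.update
    have hσ' : Tracks σ arr env' := hσ.update.update
    have e23 : env' 23 = j := Function.update_self ..
    have e3 : env' 3 = env 3 := by simp [henv']
    have e4 : env' 4 = env 4 := by simp [henv']
    have e5 : env' 5 = env 5 := by simp [henv']
    have e0 : env' 0 = env 0 := by simp [henv']
    have hjV : j ∈ V(G) := h.mem_iff.2 hj
    have key1 : ∀ a < env' 0, (Tm.and (.placed 24) (.and (.blk 3 4 24) (.adj 24 23))).Holds arr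
        (Function.update env' 24 a) ↔ a ∈ σ ∧ a ∈ OrderedGraph.blk (skel G) (env 3) (env 4) ∧
          (skel G).Adj a j := by
      intro a ha
      have u3 : Function.update env' 24 a 3 = env 3 := by simp [e3]
      have u4 : Function.update env' 24 a 4 = env 4 := by simp [e4]
      have u23 : Function.update env' 24 a 23 = j := by simp [e23]
      have u24 : Function.update env' 24 a 24 = a := Function.update_self ..
      have h'' : Encodes G arr (Function.update env' 24 a) := h'.update
      rw [Tm.holds_and, Tm.holds_and, (hσ'.update (x := 24)).holds_placed,
        h''.holds_blk (hsV := by rwa [u3]) (hvV := by rw [u24]; exact h'.mem_iff.2 ha),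
        h''.holds_adj, u3, u4, u23, u24]
    have key2 : ∀ y < env' 0, (Tm.or (.not (.outside 25)) (.or (.eq (.var 25) (.var 23))
        (.tc 26 27 (.and (.adj 26 27) (.and (.and (.outside 26) (.not (.eq (.var 26) (.var 23))))
        (.and (.outside 27) (.not (.eq (.var 27) (.var 23))))))
        (.var 25) (.var 5)))).Holds arr (Function.update env' 25 y) ↔
        (y ∈ OrderedGraph.blk (skel G) (env 3) (env 4) → y ∉ σ → y ≠ j → Joins (skel G)
          ((OrderedGraph.blk (skel G) (env 3) (env 4) \ {z | z ∈ σ}) \ {j}) y (env 5)) := by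
      intro y hy
      have hyV : y ∈ V(G) := h'.mem_iff.2 hy
      have u3 : Function.update env' 25 y 3 = env 3 := by simp [e3]
      have u4 : Function.update env' 25 y 4 = env 4 := by simp [e4]
      have u5 : Function.update env' 25 y 5 = env 5 := by simp [e5]
      have u23 : Function.update env' 25 y 23 = j := by simp [e23]
      have u25 : Function.update env' 25 y 25 = y := Function.update_self ..
      have h'' : Encodes G arr (Function.update env' 25 y) := h'.update
      have hrel : (stepRel (Function.update env' 25 y 0) fun a b => Tm.Holds arr
          (.and (.adj 26 27) (.and (.and (.outside 26) (.not (.eq (.var 26) (.var 23))))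
            (.and (.outside 27) (.not (.eq (.var 27) (.var 23))))))
          (Function.update (Function.update (Function.update env' 25 y) 26 a) 27 b)) =
          fun a b => (skel G).Adj a b ∧
            a ∈ (OrderedGraph.blk (skel G) (env 3) (env 4) \ {z | z ∈ σ}) \ {j} ∧
            b ∈ (OrderedGraph.blk (skel G) (env 3) (env 4) \ {z | z ∈ σ}) \ {j} := by
        funext a b
        set env₃ := Function.update (Function.update (Function.update env' 25 y) 26 a) 27 b
          with henv₃
        have h₃ : Encodes G arr env₃ := (h''.update (x := 26)).update (x := 27)
        have hσ₃ : Tracks σ arr env₃ :=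
          ((hσ'.update (x := 25)).update (x := 26)).update (x := 27)
        have w3 : env₃ 3 = env 3 := by simp [henv₃, e3]
        have w4 : env₃ 4 = env 4 := by simp [henv₃, e4]
        have w23 : env₃ 23 = j := by simp [henv₃, e23]
        have w26 : env₃ 26 = a := by simp [henv₃]
        have w27 : env₃ 27 = b := by simp [henv₃]
        rw [eq_iff_iff, stepRel, ← henv₃, Tm.holds_and, Tm.holds_and, Tm.holds_and, Tm.holds_and,
          Tm.holds_not, Tm.holds_not, Tm.holds_eq, Tm.holds_eq, h₃.holds_adj, Tm.eval_var,
          Tm.eval_var, Tm.eval_var, w26, w27, w23]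
        have hout : ∀ z, env₃ z ∈ V(G) → z ≠ 10 ∧ z ≠ 13 → ((Tm.outside z).Holds arr env₃ ↔
            env₃ z ∈ OrderedGraph.blk (skel G) (env 3) (env 4) ∧ env₃ z ∉ σ) := fun z hz hz' => by
          rw [h₃.holds_outside hσ₃ hz' (by rwa [w3]) hz, w3, w4]
        constructor
        · rintro ⟨-, -, hab, ⟨ha, haj⟩, hb, hbj⟩
          rw [hout 26 (by rw [w26]; exact skel_adj_left hab) (by decide), w26] at ha
          rw [hout 27 (by rw [w27]; exact skel_adj_right hab) (by decide), w27] at hb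
          exact ⟨hab, ⟨ha, haj⟩, hb, hbj⟩
        · rintro ⟨hab, ⟨ha, haj⟩, hb, hbj⟩
          have haV := skel_adj_left hab
          have hbV := skel_adj_right hab
          refine ⟨h''.mem_iff.1 haV, h''.mem_iff.1 hbV, hab, ⟨?_, haj⟩, ?_, hbj⟩
          · rw [hout 26 (by rwa [w26]) (by decide), w26]
            exact ha
          · rw [hout 27 (by rwa [w27]) (by decide), w27]
            exact hb
      rw [Tm.holds_or, Tm.holds_or, Tm.holds_not, Tm.holds_eq, Tm.eval_var, Tm.eval_var,
        Tm.holds_tc, hrel, Tm.eval_var, Tm.eval_var, h''.holds_outside (hσ'.update (x := 25))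
          (by decide) (by rwa [u3]) (by rwa [u25]), u3, u4, u5, u23, u25, joins_iff_reflTransGen]
      simp only [Set.mem_sdiff, Set.mem_ofPred_eq, Set.mem_singleton_iff]
      tauto
    rw [Tm.holds_and, Tm.holds_and, h'.holds_outside hσ' (by decide) (by rwa [e3]) (by rwa [e23]),
      Tm.holds_ex, Tm.holds_all, e3, e4, e23, IsNext]
    refine and_congr_right fun _ => and_congr ⟨?_, ?_⟩ ⟨fun hall y hy => ?_,
      fun hall y hy => (key2 y hy).2 (hall y)⟩
    · rintro ⟨a, ha, hh⟩
      rw [key1 a ha] at hh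
      exact ⟨a, hh⟩
    · rintro ⟨a, hh⟩
      have ha : a < env' 0 := h'.mem_iff.1 (skel_adj_left hh.2.2)
      exact ⟨a, ha, (key1 a ha).2 hh⟩
    · have := h'.mem_iff.1 (blk_subset hsw hy)
      exact (key2 y this).1 (hall y this) hy
  · obtain ⟨u, hu⟩ := hex
    exact ⟨u, h.mem_iff.1 (blk_subset hsw hu.1.1), hu⟩

theorem Encodes.eval_start (h : Encodes G arr env) (hex : ∃ u, IsStart G u) :
    IsStart G (Tm.start.eval arr env) := by
  refine (Tm.eval_first (IsStart G) (by decide) (by decide) (fun i j hj => ?_) ?_).1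
  · set env' := Function.update (Function.update env 39 i) 28 j with henv'
    have h' : Encodes G arr env' := h.update.update
    have e28 : env' 28 = j := Function.update_self ..
    have hjV : j ∈ V(G) := h.mem_iff.2 hj
    have key1 : ∀ w, (skel G).Adj j w → ∀ a < env' 0, ∀ b < env' 0,
        (Tm.or (.not (.and (.blk 28 29 30) (.cut 30)))
          (.or (.not (.and (.blk 28 29 31) (.cut 31))) (.eq (.var 30) (.var 31)))).Holds arr
        (Function.update (Function.update (Function.update env' 29 w) 30 a) 31 b) ↔
        (a ∈ OrderedGraph.blk (skel G) j w → b ∈ OrderedGraph.blk (skel G) j w →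
          IsCutVertex G a → IsCutVertex G b → a = b) := by
      intro w hw a ha b hb
      set env₃ := Function.update (Function.update (Function.update env' 29 w) 30 a) 31 b
        with henv₃
      have h₃ : Encodes G arr env₃ := ((h'.update (x := 29)).update (x := 30)).update (x := 31)
      have w28 : env₃ 28 = j := by simp [henv₃, e28]
      have w29 : env₃ 29 = w := by simp [henv₃]
      have w30 : env₃ 30 = a := by simp [henv₃]
      have w31 : env₃ 31 = b := by simp [henv₃]
      have haV : a ∈ V(G) := h'.mem_iff.2 ha
      have hbV : b ∈ V(G) := h'.mem_iff.2 hb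
      rw [Tm.holds_or, Tm.holds_or, Tm.holds_not, Tm.holds_not, Tm.holds_and, Tm.holds_and,
        Tm.holds_eq, Tm.eval_var, Tm.eval_var,
        h₃.holds_blk (hsV := by rwa [w28]) (hvV := by rwa [w30]),
        h₃.holds_blk (hsV := by rwa [w28]) (hvV := by rwa [w31]),
        h₃.holds_cut (hcV := by rwa [w30]), h₃.holds_cut (hcV := by rwa [w31]), w28, w29, w30, w31]
      tauto
    have key2 : ∀ w, (skel G).Adj j w → ∀ a < env' 0,
        (Tm.or (.not (.blk 28 29 30)) (.or (.cut 30) (.le (.deg 28) (.deg 30)))).Holds arr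
        (Function.update (Function.update env' 29 w) 30 a) ↔
        (a ∈ OrderedGraph.blk (skel G) j w → ¬ IsCutVertex G a →
          OrderedGraph.deg G j ≤ OrderedGraph.deg G a) := by
      intro w hw a ha
      set env₃ := Function.update (Function.update env' 29 w) 30 a with henv₃
      have h₃ : Encodes G arr env₃ := (h'.update (x := 29)).update (x := 30)
      have w28 : env₃ 28 = j := by simp [henv₃, e28]
      have w29 : env₃ 29 = w := by simp [henv₃]
      have w30 : env₃ 30 = a := by simp [henv₃]
      have haV : a ∈ V(G) := h'.mem_iff.2 ha
      rw [Tm.holds_or, Tm.holds_or, Tm.holds_not, Tm.holds_le, h₃.eval_deg, h₃.eval_deg,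
        h₃.holds_blk (hsV := by rwa [w28]) (hvV := by rwa [w30]),
        h₃.holds_cut (hcV := by rwa [w30]), w28, w29, w30]
      tauto
    have h29 : ∀ w, (Tm.adj 28 29).Holds arr (Function.update env' 29 w) ↔ (skel G).Adj j w := by
      intro w
      rw [(h'.update (x := 29)).holds_adj, Function.update_self, Function.update_of_ne (by decide),
        e28]
    rw [Tm.holds_and, Tm.holds_not, h'.holds_cut (hcV := by rwa [e28]), Tm.holds_ex, e28, IsStart,
      and_iff_right hjV]
    refine and_congr_right fun _ => ⟨?_, ?_⟩
    · rintro ⟨w, -, hh⟩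
      rw [Tm.holds_and, Tm.holds_and, h29, Tm.holds_all, Tm.holds_all] at hh
      obtain ⟨hw, h1, h2⟩ := hh
      have hlt : ∀ y ∈ OrderedGraph.blk (skel G) j w, y < env' 0 := fun y hy =>
        h'.mem_iff.1 (blk_subset hw hy)
      refine ⟨w, hw, fun y hy z hz => ?_, fun y hy => ?_⟩
      · have := h1 y (hlt y hy)
        rw [Tm.holds_all] at this
        exact (key1 w hw y (hlt y hy) z (hlt z hz)).1 (this z (hlt z hz)) hy hz
      · exact (key2 w hw y (hlt y hy)).1 (h2 y (hlt y hy)) hy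
    · rintro ⟨w, hw, h1, h2⟩
      refine ⟨w, h'.mem_iff.1 (skel_adj_right hw), ?_⟩
      rw [Tm.holds_and, Tm.holds_and, h29, Tm.holds_all, Tm.holds_all]
      refine ⟨hw, fun a ha => ?_, fun a ha => (key2 w hw a ha).2 (h2 a)⟩
      rw [Tm.holds_all]
      intro b hb
      exact (key1 w hw a ha b hb).2 fun ha' hb' => h1 a ha' b hb'
  · obtain ⟨u, hu⟩ := hex
    exact ⟨u, h.mem_iff.1 hu.1, hu⟩

end Meaning

end RAM

/-! ### The order built by the program is an output of `combineST` -/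

namespace OrderedGraph

section Complete

variable {G B B₁ : Graph ℕ ℕ} {bs : List (Graph ℕ ℕ)} {σ τ ρ : List ℕ} {s t u v w x y : ℕ}
  {L : List (BlockNode G)}

theorem pair_sublist_trans {α : Type u} {a b c : α} {l : List α} (hl : l.Nodup)
    (h : [a, b].Sublist l) (h' : [b, c].Sublist l) : [a, c].Sublist l := by
  induction l with
  | nil => simp at h
  | cons d l ih =>
    rw [List.nodup_cons] at hl
    rw [pair_sublist_cons] at h h' ⊢
    have hc : c ∈ l := by
      rcases h' with ⟨-, h'⟩ | h'
      · exact h'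
      · exact h'.subset (by simp)
    rcases h with ⟨rfl, -⟩ | h
    · exact .inl ⟨rfl, hc⟩
    · rcases h' with ⟨rfl, -⟩ | h'
      · exact absurd (h.subset (by simp)) hl.1
      · exact .inr (ih hl.2 h h')

theorem HasOut.of_append (h : HasOut G (σ ++ τ) u) : HasOut G σ u :=
  h.imp fun _ hw => ⟨hw.1, fun h' => hw.2 (List.mem_append_left _ h')⟩

theorem IsSource.mem (h : IsSource G σ s) : s ∈ σ := by
  obtain ⟨l₁, l₂, rfl, -⟩ := h
  simp

theorem IsSource.hasOut (h : IsSource G σ s) : HasOut G σ s := by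
  obtain ⟨l₁, l₂, -, h, -⟩ := h
  exact h

theorem IsSource.not_hasOut (h : IsSource G σ s) (hσ : σ.Nodup) (hx : [s, x].Sublist σ) :
    ¬ HasOut G σ x := by
  obtain ⟨l₁, l₂, rfl, -, h⟩ := h
  refine h x ?_
  have hs : s ∉ l₁ := fun hs => (List.nodup_append.1 hσ).2.2 s hs s (by simp) rfl
  rw [pair_sublist_append, pair_sublist_cons] at hx
  rcases hx with hx | ⟨hx, -⟩ | ⟨-, hx⟩ | hx
  · exact absurd (hx.subset (by simp)) hs
  · exact absurd hx hs
  · exact hx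
  · exact hx.subset (by simp)

theorem exists_isSource (h : ∃ u ∈ σ, HasOut G σ u) : ∃ u, IsSource G σ u := by
  suffices ∀ τ : List ℕ, (∃ u ∈ τ, HasOut G σ u) →
      ∃ u l₁ l₂, τ = l₁ ++ u :: l₂ ∧ HasOut G σ u ∧ ∀ z ∈ l₂, ¬ HasOut G σ z from this σ h
  intro τ
  induction τ with
  | nil => simp
  | cons a τ ih =>
    rintro ⟨u, hu, ho⟩
    by_cases hτ : ∃ u ∈ τ, HasOut G σ u
    · obtain ⟨u, l₁, l₂, rfl, h⟩ := ih hτ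
      exact ⟨u, a :: l₁, l₂, rfl, h⟩
    · push Not at hτ
      rcases List.mem_cons.1 hu with rfl | hu
      · exact ⟨u, [], τ, rfl, ho, hτ⟩
      · exact absurd ho (hτ u hu)

/-- Processing the components in `bs`, the first of which is `B₁`, may lead to the order `σ`. -/
def IsPrefix (G B₁ : Graph ℕ ℕ) (bs : List (Graph ℕ ℕ)) (σ : List ℕ) : Prop :=
  ∃ (rest : List (Graph ℕ ℕ)) (s t : ℕ) (ρ : List ℕ), bs = B₁ :: rest ∧ FirstChoice G B₁ s t ∧
    IsSTOrder B₁ s t ρ ∧ ∀ after τ, (∀ D, IsBlock G D → D ∈ bs ++ after) →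
      CombineLoop G bs σ after τ → CombineLoop G [B₁] ρ (rest ++ after) τ

theorem IsPrefix.start (h : FirstChoice G B s t) (hρ : IsSTOrder B s t ρ) :
    IsPrefix G B [B] ρ := ⟨[], s, t, ρ, rfl, h, hρ, fun _ _ _ h => h⟩

/-- An admissible terminal may have to lie in a component that is still to come. The choice is
therefore required to be admissible for every list `after` that completes the components. -/
theorem IsPrefix.append (h : IsPrefix G B₁ bs σ) (hρ : IsSTOrder B s t ρ)
    (hB : ∀ after, (∀ D, IsBlock G D → D ∈ bs ++ B :: after) → LaterChoice G bs B after s t) :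
    IsPrefix G B₁ (bs ++ [B]) (σ ++ ρ.tail) := by
  obtain ⟨rest, s₁, t₁, ρ₁, rfl, h1, h2, h3⟩ := h
  refine ⟨rest ++ [B], s₁, t₁, ρ₁, rfl, h1, h2, fun after τ hall hloop => ?_⟩
  rw [List.append_assoc, List.singleton_append] at hall ⊢
  exact h3 _ τ hall (.next (hB after hall) hρ hloop)

/-- The components in the list `L` of nodes discovered so far have been processed, with the order
`σ` as the result. -/
structure Complete (G : Graph ℕ ℕ) (B₁ : {B : Graph ℕ ℕ // IsBlock G B}) (L : List (BlockNode G))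
    (σ : List ℕ) : Prop where
  dfs : ∃ st, DFSState (blockTree G) (.inl B₁) L st
  isPrefix : IsPrefix G B₁ (blocksOf L) σ
  nodup : σ.Nodup
  mem : ∀ v, v ∈ σ ↔ v ∈ unionVerts (blocksOf L)
  chained : Chained G (blocksOf L)
  shared : ∀ D D' x, [Sum.inl D, Sum.inl D'].Sublist L → x ∈ V(D.1) → x ∈ V(D'.1) →
    ∃ h, Sum.inr ⟨x, h⟩ ∈ L
  order : ∀ D D' x y, [Sum.inl D, Sum.inl D'].Sublist L → x ∈ V(D.1) → y ∈ V(D'.1) →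
    (∃ h, Sum.inr ⟨y, h⟩ ∈ L) ∨ [x, y].Sublist σ
  parent : ∀ c, Sum.inr c ∈ L → ∃ D, c.1 ∈ V(D.1) ∧ [Sum.inl D, Sum.inr c].Sublist L
  exhausted : ∀ D c x, [Sum.inl D, Sum.inr c].Sublist L → x ∈ V(D.1) → [c.1, x].Sublist σ →
    ¬ HasOut G σ x

variable {B₁ : {B : Graph ℕ ℕ // IsBlock G B}}

theorem Complete.mem_iff (h : Complete G B₁ L σ) :
    v ∈ σ ↔ ∃ D, Sum.inl D ∈ L ∧ v ∈ V(D.1) := by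
  rw [h.mem, unionVerts, Set.mem_ofPred_eq]
  constructor
  · rintro ⟨B, hB, hv⟩
    obtain ⟨hB', hL⟩ := mem_blocksOf.1 hB
    exact ⟨⟨B, hB'⟩, hL, hv⟩
  · rintro ⟨D, hD, hv⟩
    exact ⟨D.1, mem_blocksOf.2 ⟨D.2, hD⟩, hv⟩

/-- A neighbour of `v` inside `D` is placed as well. An undiscovered `D` would then meet the union
of the discovered components in two vertices. -/
theorem Complete.inl_mem (h : Complete G B₁ L σ) (D : {B : Graph ℕ ℕ // IsBlock G B})
    (hv : v ∈ σ) (hout : ¬ HasOut G σ v) (hvD : v ∈ V(D.1)) : Sum.inl D ∈ L := by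
  by_contra hD
  obtain ⟨w, hw⟩ := D.2.exists_skel_adj hvD
  have hwσ : w ∈ σ := by
    by_contra hwσ
    exact hout ⟨w, skel_mono D.2.le hw, hwσ⟩
  refine hw.1 (h.chained.eq_of_mem D.2 (fun hD' => hD ?_) hvD (skel_adj_right hw)
    ((h.mem v).1 hv) ((h.mem w).1 hwσ))
  exact (mem_blocksOf.1 hD').2

theorem Complete.mem_of_adj (hG : G.toSimpleGraph.Preconnected) (h : Complete G B₁ L σ)
    (hs : IsSource G σ s) {D : {B : Graph ℕ ℕ // IsBlock G B}} (hsD : s ∈ V(D.1))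
    {z z' : BlockNode G} (hz : [Sum.inl D, z].Sublist L) (hzs : ∀ h, z ≠ Sum.inr ⟨s, h⟩)
    (hzz' : (blockTree G).Adj z z') : z' ∈ L := by
  have hL : L.Nodup := h.dfs.choose_spec.nodup
  have hzL : z ∈ L := hz.subset (by simp)
  rcases z with D' | c
  · rcases z' with D'' | c
    · simp [blockTree, SimpleGraph.fromRel_adj] at hzz'
    · rw [blockTree_adj_inl_inr] at hzz'
      rcases h.order D D' s c.1 hz hsD hzz' with ⟨h1, h2⟩ | hsc
      · exact h2
      · obtain ⟨D'', hD'', hc, hne⟩ := c.2.exists_other_block hG D'.1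
        have hDL := h.inl_mem ⟨D'', hD''⟩ (hsc.subset (by simp)) (hs.not_hasOut h.nodup hsc) hc
        rcases pair_sublist_or hzL hDL (by
          rintro h'; exact hne (congrArg Subtype.val (Sum.inl_injective h')).symm) with h' | h'
        · exact (h.shared _ _ c.1 h' hzz' hc).choose_spec
        · exact (h.shared _ _ c.1 h' hc hzz').choose_spec
  · rcases z' with D' | c'
    · rw [SimpleGraph.adj_comm, blockTree_adj_inl_inr] at hzz'
      obtain ⟨E, hcE, hE⟩ := h.parent c hzL
      have hcσ : c.1 ∈ σ := h.mem_iff.2 ⟨E, hE.subset (by simp), hcE⟩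
      have hcs : c.1 ≠ s := by
        rintro rfl
        exact hzs c.2 rfl
      rcases pair_sublist_or hs.mem hcσ hcs.symm with h' | h'
      · exact h.inl_mem D' hcσ (hs.not_hasOut h.nodup h') hzz'
      · exact absurd hs.hasOut (h.exhausted D c s hz hsD h')
    · simp [blockTree, SimpleGraph.fromRel_adj] at hzz'

theorem pair_sublist_concat {α : Type u} {a b c : α} {l : List α} :
    [a, b].Sublist (l ++ [c]) ↔ [a, b].Sublist l ∨ a ∈ l ∧ b = c := by
  rw [pair_sublist_append]
  simp

/-- A cut vertex enters the traversal only when a component is about to be attached to it. By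
`Complete.mem_of_adj` the traversal can first backtrack to a component that contains it. -/
theorem Complete.discover (hG : G.toSimpleGraph.Preconnected) (h : Complete G B₁ L σ)
    (hs : IsSource G σ s) (hc : IsCutVertex G s) :
    ∃ L', Complete G B₁ L' σ ∧ Sum.inr ⟨s, hc⟩ ∈ L' ∧ blocksOf L' = blocksOf L := by
  by_cases hsL : Sum.inr ⟨s, hc⟩ ∈ L
  · exact ⟨L, h, hsL, rfl⟩
  obtain ⟨D, hD, hsD⟩ := h.mem_iff.1 hs.mem
  obtain ⟨l₁, l₂, hL⟩ := List.append_of_mem hD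
  obtain ⟨st, hst⟩ := h.dfs
  have hbl : blocksOf (L ++ [Sum.inr ⟨s, hc⟩]) = blocksOf L := by simp [blocksOf]
  refine ⟨L ++ [Sum.inr ⟨s, hc⟩], ⟨?_, ?_, h.nodup, ?_, ?_, ?_, ?_, ?_, ?_⟩, by simp, hbl⟩
  · refine hst.extend hL (blockTree_adj_inl_inr.2 hsD) hsL fun z hz z' hzz' => ?_
    have hz' : [Sum.inl D, z].Sublist L := by
      rw [hL, pair_sublist_append, pair_sublist_cons]
      exact .inr (.inr (.inl ⟨rfl, hz⟩))
    refine h.mem_of_adj hG hs hsD hz' ?_ hzz'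
    intro _ hzs
    rw [hzs] at hz'
    exact hsL (hz'.subset (by simp))
  · rw [hbl]; exact h.isPrefix
  · rw [hbl]; exact h.mem
  · rw [hbl]; exact h.chained
  · intro D D' x hD hx hx'
    rw [pair_sublist_concat] at hD
    obtain ⟨h1, h2⟩ := h.shared D D' x (hD.resolve_right (by simp)) hx hx'
    exact ⟨h1, List.mem_append_left _ h2⟩
  · intro D D' x y hD hx hy
    rw [pair_sublist_concat] at hD
    refine (h.order D D' x y (hD.resolve_right (by simp)) hx hy).imp_left ?_
    exact Exists.imp fun _ => List.mem_append_left _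
  · intro c hcL
    rw [List.mem_append, List.mem_singleton] at hcL
    rcases hcL with hcL | hcL
    · obtain ⟨D, h1, h2⟩ := h.parent c hcL
      exact ⟨D, h1, pair_sublist_concat.2 (.inl h2)⟩
    · obtain rfl := Sum.inr_injective hcL
      exact ⟨D, hsD, pair_sublist_concat.2 (.inr ⟨hD, rfl⟩)⟩
  · intro D c x hD hx hcx
    rw [pair_sublist_concat] at hD
    rcases hD with hD | ⟨-, hD⟩
    · exact h.exhausted D c x hD hx hcx
    · obtain rfl := Sum.inr_injective hD
      exact hs.not_hasOut h.nodup hcx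

/-- The preference for cut vertices in `KeyLe` matches the two cases: in an end-component no
candidate is a cut vertex and the degree decides, while in any other component a cut vertex is
selected. -/
theorem laterChoice_of_isTerminal (hG : G.toSimpleGraph.Preconnected) (hbs : Chained G bs)
    (hsw : (skel G).Adj s w) (hs : s ∈ unionVerts bs) (hw : w ∉ unionVerts bs)
    (ht : IsTerminal G s w t) {after : List (Graph ℕ ℕ)}
    (hall : ∀ D, IsBlock G D → D ∈ bs ++ G.induce (blk (skel G) s w) :: after) :
    IsCutVertex G s ∧ LaterChoice G bs (G.induce (blk (skel G) s w)) after s t := by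
  have hB := isBlock_induce_blk hsw
  have hBbs : G.induce (blk (skel G) s w) ∉ bs := fun h => hw ⟨_, h, right_mem_blk⟩
  obtain ⟨B', hB', hsB'⟩ := id hs
  have hsc : IsCutVertex G s := hB.isCutVertex (hbs.1 B' hB') (by rintro rfl; exact hBbs hB')
    left_mem_blk hsB'
  refine ⟨hsc, ⟨hsc, left_mem_blk, B', hB', hsB'⟩, fun he => ⟨⟨ht.1, ht.2.1⟩, fun y hy => ?_⟩,
    fun he => ?_⟩
  · have hne : ∀ z ∈ blk (skel G) s w, z ≠ s → ¬ IsCutVertex G z := fun z hz hzs hzc =>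
      hzs (he.2.unique ⟨hzc, hz⟩ ⟨hsc, left_mem_blk⟩)
    exact ((ht.2.2 y hy.1 hy.2).resolve_left (hne t ht.1 ht.2.1)).2
  · have : ∃ y ∈ blk (skel G) s w, y ≠ s ∧ IsCutVertex G y := by
      by_contra! hcon
      refine he ⟨hB, s, ⟨hsc, left_mem_blk⟩, fun y hy => ?_⟩
      by_contra hys
      exact hcon y hy.2 hys hy.1
    obtain ⟨y, hy, hys, hyc⟩ := this
    have htc : IsCutVertex G t := (ht.2.2 y hy hys).resolve_right fun h => h.1 hyc
    obtain ⟨D, hD, htD, hne⟩ := htc.exists_other_block hG (G.induce (blk (skel G) s w))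
    refine ⟨htc, ⟨ht.1, ht.2.1⟩, D, ?_, htD⟩
    -- An earlier component cannot contain `t`, because the new component meets their union only in
    -- `s`. Hence `D` is still to come.
    have := hall D hD
    rw [List.mem_append, List.mem_cons] at this
    rcases this with h | h | h
    · exact absurd (hbs.eq_of_mem hB hBbs (u := t) (v := s) ht.1 left_mem_blk ⟨D, h, htD⟩ hs) ht.2.1
    · exact absurd h hne
    · exact h

theorem unionVerts_append_singleton : unionVerts (bs ++ [B]) = unionVerts bs ∪ V(B) := by
  ext v
  simp [unionVerts, or_and_right, exists_or]

/-- Processing one more component. -/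
theorem Complete.step (hG : G.toSimpleGraph.Preconnected) (h : Complete G B₁ L σ)
    (hs : IsSource G σ s) (hsw : (skel G).Adj s w) (hw : w ∉ σ) (ht : IsTerminal G s w t)
    (hρ : IsSTOrder (G.induce (blk (skel G) s w)) s t ρ) :
    ∃ L', Complete G B₁ L' (σ ++ ρ.tail) := by
  set B := G.induce (blk (skel G) s w) with hBdef
  have hB : IsBlock G B := isBlock_induce_blk hsw
  have hsB : s ∈ V(B) := left_mem_blk
  have hwB : w ∈ V(B) := right_mem_blk
  have hsc : IsCutVertex G s := by
    obtain ⟨D, hD, hsD⟩ := h.mem_iff.1 hs.mem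
    refine hB.isCutVertex D.2 ?_ hsB hsD
    intro hBD
    exact hw (h.mem_iff.2 ⟨D, hD, hBD ▸ hwB⟩)
  obtain ⟨L, h, hsL, -⟩ := h.discover hG hs hsc
  have hBL : B ∉ blocksOf L := fun hBL => hw ((h.mem w).2 ⟨B, hBL, hwB⟩)
  have hinter : ∀ z ∈ V(B), z ∈ σ → z = s := fun z hz hzσ =>
    h.chained.eq_of_mem hB hBL hz hsB ((h.mem z).1 hzσ) ((h.mem s).1 hs.mem)
  have htail : ∀ z, z ∈ V(B) ↔ z = s ∨ z ∈ ρ.tail := fun z => by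
    rw [← hρ.1.2, hρ.eq_cons, List.mem_cons, List.tail_cons]
  have hstail : s ∉ ρ.tail := by
    have := hρ.1.1
    rw [hρ.eq_cons, List.nodup_cons] at this
    exact this.1
  have hdisj : ∀ z ∈ σ, z ∉ ρ.tail := fun z hz hz' =>
    hstail (hinter z ((htail z).2 (.inr hz')) hz ▸ hz')
  have hbl : blocksOf (L ++ [Sum.inl ⟨B, hB⟩]) = blocksOf L ++ [B] := by simp [blocksOf]
  refine ⟨L ++ [Sum.inl ⟨B, hB⟩], ⟨?_, ?_, ?_, ?_, ?_, ?_, ?_, ?_, ?_⟩⟩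
  · obtain ⟨st, hst⟩ := h.dfs
    obtain ⟨l₁, l₂, hL⟩ := List.append_of_mem hsL
    refine hst.extend hL (SimpleGraph.Adj.symm (blockTree_adj_inl_inr.2 hsB))
      (fun hBL' => hBL (mem_blocksOf.2 ⟨hB, hBL'⟩)) fun z hz z' hzz' => ?_
    have hz' : [Sum.inr ⟨s, hsc⟩, z].Sublist L := by
      rw [hL, pair_sublist_append, pair_sublist_cons]
      exact .inr (.inr (.inl ⟨rfl, hz⟩))
    obtain ⟨D, hsD, hD⟩ := h.parent _ hsL
    -- What follows the cut vertex `s` in the traversal also follows its parent component, so it is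
    -- exhausted.
    refine h.mem_of_adj hG hs hsD (pair_sublist_trans hst.nodup hD hz') ?_ hzz'
    intro _ hzs
    rw [hzs] at hz'
    exact ne_of_pair_sublist hst.nodup hz' rfl
  · rw [hbl]
    refine h.isPrefix.append hρ fun after hall => ?_
    exact (laterChoice_of_isTerminal hG h.chained hsw ((h.mem s).1 hs.mem)
      (fun hw' => hw ((h.mem w).2 hw')) ht hall).2
  · exact List.nodup_append.2 ⟨h.nodup, hρ.1.1.sublist (List.tail_sublist _),
      fun a ha b hb hab => hdisj a ha (hab ▸ hb)⟩
  · intro v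
    rw [hbl, unionVerts_append_singleton, List.mem_append, Set.mem_union, ← h.mem, htail]
    constructor
    · exact Or.imp_right .inr
    · rintro (hv | rfl | hv)
      · exact .inl hv
      · exact .inl hs.mem
      · exact .inr hv
  · rw [hbl]
    exact h.chained.append hB hsB ((h.mem s).1 hs.mem)
  · intro D D' x hD hx hx'
    rw [pair_sublist_concat] at hD
    rcases hD with hD | ⟨hD, hD'⟩
    · obtain ⟨h1, h2⟩ := h.shared D D' x hD hx hx'
      exact ⟨h1, List.mem_append_left _ h2⟩
    · obtain rfl := Sum.inl_injective hD'
      obtain rfl := hinter x hx' (h.mem_iff.2 ⟨D, hD, hx⟩)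
      exact ⟨hsc, List.mem_append_left _ hsL⟩
  · intro D D' x y hD hx hy
    rw [pair_sublist_concat] at hD
    rcases hD with hD | ⟨hD, hD'⟩
    · exact (h.order D D' x y hD hx hy).imp (Exists.imp fun _ => List.mem_append_left _)
        fun h' => pair_sublist_append.2 (.inl h')
    · obtain rfl := Sum.inl_injective hD'
      rcases (htail y).1 hy with rfl | hy
      · exact .inl ⟨hsc, List.mem_append_left _ hsL⟩
      · exact .inr (pair_sublist_append.2 (.inr (.inl ⟨h.mem_iff.2 ⟨D, hD, hx⟩, hy⟩)))
  · intro c hcL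
    rw [List.mem_append, List.mem_singleton] at hcL
    obtain ⟨D, h1, h2⟩ := h.parent c (hcL.resolve_right (by simp))
    exact ⟨D, h1, pair_sublist_concat.2 (.inl h2)⟩
  · intro D c x hD hx hcx ho
    rw [pair_sublist_concat] at hD
    have hD := hD.resolve_right (by simp)
    have hxσ : x ∈ σ := h.mem_iff.2 ⟨D, hD.subset (by simp), hx⟩
    refine h.exhausted D c x hD hx ?_ ho.of_append
    rw [pair_sublist_append] at hcx
    rcases hcx with hcx | ⟨-, hcx⟩ | hcx
    · exact hcx
    · exact absurd hcx (hdisj x hxσ)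
    · exact absurd (hcx.subset (by simp)) (hdisj x hxσ)

theorem firstChoice_of_isStart (hG : G.toSimpleGraph.Preconnected) (hs : IsStart G s)
    (hsw : (skel G).Adj s w) (ht : IsTerminal G s w t) :
    FirstChoice G (G.induce (blk (skel G) s w)) s t := by
  have hB := isBlock_induce_blk hsw
  obtain ⟨-, hsc, w', hsw', hcut, hdeg⟩ := hs
  -- The edge that witnesses `IsStart` need not be the edge chosen afterwards, but both lie in the
  -- only component of `s`, which is no cut vertex.
  have hbb : blk (skel G) s w' = blk (skel G) s w := by
    have := eq_of_not_isCutVertex hsc (isBlock_induce_blk hsw') hB left_mem_blk left_mem_blk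
    simpa using congrArg Graph.vertexSet this
  rw [hbb] at hcut hdeg
  by_cases hc : ∃ c ∈ blk (skel G) s w, IsCutVertex G c
  · obtain ⟨c, hcB, hc⟩ := hc
    have hcs : c ≠ s := by rintro rfl; exact hsc hc
    have htc : IsCutVertex G t := (ht.2.2 c hcB hcs).resolve_right fun h => h.1 hc
    refine .inl ⟨⟨hB, c, ⟨hc, hcB⟩, fun y hy => hcut y hy.2 c hcB hy.1 hc⟩, htc, ht.1,
      ⟨left_mem_blk, ht.2.1.symm⟩, fun y hy => hdeg y hy.1 fun hyc => ?_⟩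
    exact hy.2 (hcut y hy.1 t ht.1 hyc htc)
  · push Not at hc
    have hBG := hB.eq_of_forall_not_isCutVertex hG hc
    refine .inr ⟨fun c hcc => hc c ?_ hcc, hB, ⟨left_mem_blk, fun y hy => hdeg y hy (hc y hy)⟩,
      ⟨ht.1, ht.2.1⟩, fun y hy => ?_⟩
    · have := hcc.1
      rw [← hBG] at this
      exact this
    · exact ((ht.2.2 y hy.1 hy.2).resolve_left (hc t ht.1)).2

theorem Complete.start (hG : G.toSimpleGraph.Preconnected) (hs : IsStart G s)
    (hsw : (skel G).Adj s w) (ht : IsTerminal G s w t)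
    (hρ : IsSTOrder (G.induce (blk (skel G) s w)) s t ρ) :
    ∃ B₁ L, Complete G B₁ L ρ := by
  have hB := isBlock_induce_blk hsw
  have hbl : blocksOf [Sum.inl ⟨_, hB⟩] = [G.induce (blk (skel G) s w)] := by simp [blocksOf]
  refine ⟨⟨_, hB⟩, [Sum.inl ⟨_, hB⟩], ⟨⟨_, .start⟩, ?_, hρ.1.1, fun v => ?_, ?_, ?_, ?_, ?_, ?_⟩⟩
  · rw [hbl]; exact .start (firstChoice_of_isStart hG hs hsw ht) hρ
  · rw [hbl, hρ.1.2]; simp [unionVerts]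
  · rw [hbl]; exact .singleton hB
  · intro D D' x hD; simp at hD
  · intro D D' x y hD; simp at hD
  · intro c hc; simp at hc
  · intro D c x hD; simp at hD

/-- Without unplaced vertices every component has been discovered. A cut vertex lies in two of them,
so `shared` puts it into the list too. The list is closed under adjacency, and the stack can be
emptied. -/
theorem Complete.output (hG : G.toSimpleGraph.Preconnected) (h : Complete G B₁ L σ)
    (hσ : ∀ v ∈ V(G), v ∈ σ) : IsCombineSTOutput G σ := by
  obtain ⟨st, hst⟩ := h.dfs
  have hL : ∀ D, Sum.inl D ∈ L := by
    intro D
    obtain ⟨v, hv⟩ := D.2.nontrivial.nonempty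
    refine h.inl_mem D (hσ v (D.2.mem_vertexSet hv)) ?_ hv
    rintro ⟨w, hw, hwσ⟩
    exact hwσ (hσ w (skel_adj_right hw))
  have hdfs : IsDFSOrder (blockTree G) (.inl B₁) L := by
    refine hst.isDFSOrder fun x hx y hxy => ?_
    rcases x with D | c
    · rcases y with D' | c
      · exact hL D'
      · rw [blockTree_adj_inl_inr] at hxy
        obtain ⟨D', hD', hc, hne⟩ := c.2.exists_other_block hG D.1
        rcases pair_sublist_or hx (hL ⟨D', hD'⟩) (by
          rintro h'; exact hne (congrArg Subtype.val (Sum.inl_injective h')).symm) with h' | h'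
        · exact (h.shared _ _ c.1 h' hxy hc).choose_spec
        · exact (h.shared _ _ c.1 h' hc hxy).choose_spec
    · rcases y with D' | c'
      · exact hL D'
      · simp [blockTree, SimpleGraph.fromRel_adj] at hxy
  obtain ⟨rest, s, t, ρ, hbs, h1, h2, h3⟩ := h.isPrefix
  refine ⟨B₁, L, rest, s, t, ρ, hdfs, hbs, h1, h2, ?_⟩
  have := h3 [] σ (fun D hD => by
    rw [List.append_nil]; exact mem_blocksOf.2 ⟨hD, hL ⟨D, hD⟩⟩) .done
  rwa [List.append_nil] at this

end Complete

end OrderedGraph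

/-! ### Extending an order of a component vertex by vertex -/

namespace OrderedGraph

section Running

variable {G : Graph ℕ ℕ} {σ σ₀ ρ : List ℕ} {s t u v w : ℕ}

/-- `ρ` can be extended to an `s`-`t` order of the component of the edge `sw`. -/
structure IsPartialST (G : Graph ℕ ℕ) (s w t : ℕ) (ρ : List ℕ) : Prop where
  nodup : ρ.Nodup
  head : ρ.head? = some s
  subset : ∀ v ∈ ρ, v ∈ blk (skel G) s w
  left : ∀ v ∈ ρ, v ≠ s → HasLeft G ρ v
  right : ∀ v ∈ ρ, v ≠ t → HasRight G ρ v ∨ ∃ a ∈ blk (skel G) s w, a ∉ ρ ∧ (skel G).Adj v a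
  last : t ∈ ρ → ρ.getLast? = some t
  joins : ∀ y ∈ blk (skel G) s w, y ∉ ρ → Joins (skel G) (blk (skel G) s w \ {z | z ∈ ρ}) y t

theorem IsPartialST.start (hsw : (skel G).Adj s w) (ht : IsTerminal G s w t) :
    IsPartialST G s w t [s] where
  nodup := by simp
  head := rfl
  subset v hv := by
    rw [List.mem_singleton.1 hv]
    exact left_mem_blk
  left v hv hvs := absurd (List.mem_singleton.1 hv) hvs
  right v hv _ := .inr ⟨w, right_mem_blk, by simpa using hsw.1.symm, by
    rwa [List.mem_singleton.1 hv]⟩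
  last hts := absurd (List.mem_singleton.1 hts) ht.2.1
  joins y hy hys := by
    have : {z | z ∈ [s]} = {s} := by ext; simp
    rw [this]
    exact (isBlock_induce_blk hsw).joins_diff hy ht.1 (by simpa [eq_comm] using hys) ht.2.1.symm

theorem IsPartialST.mem_left (h : IsPartialST G s w t ρ) : s ∈ ρ :=
  List.mem_of_mem_head? h.head

/-- An earlier vertex whose reserved unplaced neighbour was `v` now has it on the right. If `v ≠ t`,
the first edge of a walk from `v` to `t` through unplaced vertices reserves a neighbour for `v`. -/
theorem IsPartialST.append (h : IsPartialST G s w t ρ) (hv : v ∈ blk (skel G) s w) (hvρ : v ∉ ρ)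
    (ha : ∃ a ∈ ρ, (skel G).Adj a v)
    (hj : ∀ y ∈ blk (skel G) s w, y ∉ ρ → y ≠ v →
      Joins (skel G) ((blk (skel G) s w \ {z | z ∈ ρ}) \ {v}) y t) :
    IsPartialST G s w t (ρ ++ [v]) := by
  have hsub : ∀ a b, [a, b].Sublist ρ → [a, b].Sublist (ρ ++ [v]) := fun a b hab =>
    hab.trans (List.sublist_append_left _ _)
  -- Unplaced vertices are joined to `t` among themselves, so `t` is unplaced as long as any vertex
  -- of the component is. This forces `t` to come last.
  have htρ : t ∉ ρ := (h.joins v hv hvρ).right_mem.2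
  refine ⟨?_, ?_, ?_, ?_, ?_, ?_, ?_⟩
  · exact List.nodup_append.2 ⟨h.nodup, by simp, fun a ha b hb hab =>
      hvρ (List.mem_singleton.1 hb ▸ hab ▸ ha)⟩
  · rw [List.head?_append, h.head]
    rfl
  · intro u hu
    rcases List.mem_append.1 hu with hu | hu
    · exact h.subset u hu
    · exact List.mem_singleton.1 hu ▸ hv
  · intro u hu hus
    rcases List.mem_append.1 hu with hu | hu
    · exact (h.left u hu hus).mono hsub
    · obtain ⟨a, ha, hav⟩ := ha
      rw [List.mem_singleton.1 hu]
      exact ⟨a, hav.symm, pair_sublist_concat.2 (.inr ⟨ha, rfl⟩)⟩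
  · intro u hu hut
    rcases List.mem_append.1 hu with hu | hu
    · rcases h.right u hu hut with hr | ⟨a, haB, haρ, hua⟩
      · exact .inl (hr.mono hsub)
      · by_cases hav : a = v
        · exact .inl ⟨v, hav ▸ hua, pair_sublist_concat.2 (.inr ⟨hu, rfl⟩)⟩
        · exact .inr ⟨a, haB, by simp [haρ, hav], hua⟩
    · rw [List.mem_singleton] at hu
      subst hu
      obtain ⟨a, hua, hat⟩ := (h.joins u hv hvρ).exists_adj hut
      refine .inr ⟨a, hat.left_mem.1.1, ?_, hua⟩
      rw [List.mem_append, List.mem_singleton, not_or]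
      exact ⟨hat.left_mem.1.2, hat.left_mem.2⟩
  · intro ht
    rw [List.mem_append, List.mem_singleton] at ht
    rw [List.getLast?_concat, ht.resolve_left htρ]
  · intro y hy hyρ
    rw [List.mem_append, List.mem_singleton, not_or] at hyρ
    refine (hj y hy hyρ.1 hyρ.2).mono fun z hz => ⟨hz.1.1, fun hz' => ?_⟩
    rcases List.mem_append.1 hz' with hz' | hz'
    · exact hz.1.2 hz'
    · exact hz.2 (List.mem_singleton.1 hz')

theorem one_le_degTo_of_isBlock (hG : IsInputGraph G) {B : Graph ℕ ℕ} (hB : IsBlock G B)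
    {S : Set ℕ} (hv : v ∈ V(B)) (h : ∃ a ∈ V(B), (skel G).Adj v a ∧ a ∈ S) : 1 ≤ degTo B v S := by
  obtain ⟨a, ha, ⟨-, e, he⟩, haS⟩ := h
  have hfin : {e | ∃ w ∈ S, B.IsLink e v w}.Finite :=
    hG.finite_edges.subset fun e ⟨w, _, he⟩ => (he.mono hB.le).edge_mem
  exact (Set.ncard_pos hfin).2 ⟨e, a, haS, hB.isLink he hv ha⟩

theorem IsPartialST.isSTOrder (hG : IsInputGraph G) (hsw : (skel G).Adj s w)
    (h : IsPartialST G s w t ρ) (ht : t ∈ blk (skel G) s w)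
    (hall : ∀ v ∈ blk (skel G) s w, v ∈ ρ) :
    IsSTOrder (G.induce (blk (skel G) s w)) s t ρ := by
  have hB := isBlock_induce_blk hsw
  refine ⟨⟨h.nodup, fun v => ⟨h.subset v, hall v⟩⟩, h.head, h.last (hall t ht),
    fun v hv hvs hvt _ => ⟨?_, ?_⟩⟩
  · obtain ⟨a, hva, ha⟩ := h.left v (hall v hv) hvs
    exact one_le_degTo_of_isBlock hG hB hv ⟨a, h.subset a (ha.subset (by simp)), hva, ha⟩
  · obtain ⟨a, hva, ha⟩ := (h.right v (hall v hv) hvt).resolve_right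
      fun ⟨a, ha, haρ, _⟩ => haρ (hall a ha)
    exact one_le_degTo_of_isBlock hG hB hv ⟨a, h.subset a (ha.subset (by simp)), hva, ha⟩

/-- `σ` extends a result of the first components by a part of the component of the edge `sw`,
whose terminals are `s` and `t`. -/
def IsRunning (G : Graph ℕ ℕ) (σ : List ℕ) (s w t : ℕ) : Prop :=
  (skel G).Adj s w ∧ IsTerminal G s w t ∧ σ.Nodup ∧ ∃ σ₀ ρ, σ = σ₀ ++ ρ.tail ∧ s ∈ σ₀ ∧
    (∀ v ∈ σ₀, v ∈ V(G) ∧ (v ∈ blk (skel G) s w → v = s)) ∧ IsPartialST G s w t ρ ∧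
    ∀ ρ', IsSTOrder (G.induce (blk (skel G) s w)) s t ρ' →
      ∃ B₁ L, Complete G B₁ L (σ₀ ++ ρ'.tail)

theorem IsRunning.start (hG : IsInputGraph G) (hs : IsStart G s) (hsw : (skel G).Adj s w)
    (ht : IsTerminal G s w t) : IsRunning G [s] s w t := by
  refine ⟨hsw, ht, by simp, [s], [s], rfl, by simp, ?_, .start hsw ht, fun ρ' hρ' => ?_⟩
  · intro v hv
    rw [List.mem_singleton.1 hv]
    exact ⟨hs.1, fun _ => rfl⟩
  · rw [List.singleton_append, ← hρ'.eq_cons]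
    exact Complete.start hG.connected.preconnected hs hsw ht hρ'

theorem Complete.isRunning (hG : IsInputGraph G) {B₁ : {B : Graph ℕ ℕ // IsBlock G B}}
    {L : List (BlockNode G)} (h : Complete G B₁ L σ) (hs : IsSource G σ s)
    (hsw : (skel G).Adj s w) (hw : w ∉ σ) (ht : IsTerminal G s w t) : IsRunning G σ s w t := by
  have hB := isBlock_induce_blk hsw
  refine ⟨hsw, ht, h.nodup, σ, [s], by simp, hs.mem, ?_, .start hsw ht, fun ρ' hρ' =>
    ⟨B₁, h.step hG.connected.preconnected hs hsw hw ht hρ'⟩⟩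
  intro v hv
  obtain ⟨D, -, hvD⟩ := h.mem_iff.1 hv
  refine ⟨D.2.mem_vertexSet hvD, fun hvB => ?_⟩
  exact h.chained.eq_of_mem hB (fun hBL => hw ((h.mem w).2 ⟨_, hBL, right_mem_blk⟩)) hvB
    left_mem_blk ((h.mem v).1 hv) ((h.mem s).1 hs.mem)

theorem IsRunning.mem_iff (h : IsRunning G σ s w t) {ρ : List ℕ} (hσ : σ = σ₀ ++ ρ.tail)
    (h0 : ∀ v ∈ σ₀, v ∈ V(G) ∧ (v ∈ blk (skel G) s w → v = s)) (hs : s ∈ σ₀)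
    (hρ : IsPartialST G s w t ρ) (hv : v ∈ blk (skel G) s w) : v ∈ σ ↔ v ∈ ρ := by
  have hcons : ρ = s :: ρ.tail := (List.cons_head?_tail hρ.head).symm
  rw [hσ, hcons, List.mem_append, List.mem_cons, List.tail_cons]
  refine or_congr_left ⟨fun hv' => (h0 v hv').2 hv, ?_⟩
  rintro rfl
  exact hs

theorem IsRunning.mem_vertexSet (h : IsRunning G σ s w t) (hv : v ∈ σ) : v ∈ V(G) := by
  obtain ⟨hsw, -, -, σ₀, ρ, rfl, -, h0, hρ, -⟩ := h
  rcases List.mem_append.1 hv with hv | hv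
  · exact (h0 v hv).1
  · exact blk_subset hsw (hρ.subset v (List.mem_of_mem_tail hv))

theorem IsRunning.complete (hG : IsInputGraph G) (h : IsRunning G σ s w t)
    (hall : ∀ v ∈ blk (skel G) s w, v ∈ σ) : ∃ B₁ L, Complete G B₁ L σ := by
  obtain ⟨hsw, ht, -, σ₀, ρ, rfl, hs, h0, hρ, hfin⟩ := id h
  exact hfin ρ (hρ.isSTOrder hG hsw ht.1 fun v hv => (h.mem_iff rfl h0 hs hρ hv).1 (hall v hv))

/-- `exists_extension` is applied to the unplaced part of the component. Inside the component, the
vertices placed in `σ` are exactly those of `ρ`. -/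
theorem IsRunning.exists_isNext (hG : IsInputGraph G) (h : IsRunning G σ s w t)
    (hall : ¬ ∀ v ∈ blk (skel G) s w, v ∈ σ) : ∃ v, IsNext G σ s w t v := by
  obtain ⟨hsw, ht, -, σ₀, ρ, hσ, hs, h0, hρ, hfin⟩ := id h
  have hB := isBlock_induce_blk hsw
  have hmem := fun v => h.mem_iff (v := v) hσ h0 hs hρ
  have hset : blk (skel G) s w \ {z | z ∈ σ} = blk (skel G) s w \ {z | z ∈ ρ} := by
    ext z
    simp +contextual [hmem z]
  push Not at hall
  obtain ⟨y, hy, hyσ⟩ := hall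
  have htR := (hρ.joins y hy ((hmem y hy).not.1 hyσ)).right_mem
  obtain ⟨v, hv, ⟨a, ha, hav⟩, hj⟩ := exists_extension
    (hG.finite_vertices.subset (blk_subset hsw))
    (fun x u hu v hv hxu hxv => hB.joins_diff hu hv hxu hxv) (fun u hu v hv => hB.joins hu hv)
    (R := blk (skel G) s w \ {z | z ∈ ρ}) Set.sdiff_subset left_mem_blk
    (fun hs => hs.2 hρ.mem_left) htR (fun y hy => hρ.joins y hy.1 hy.2)
  refine ⟨v, ⟨hv.1, (hmem v hv.1).not.2 hv.2⟩, ⟨a, ?_, ha.1, hav⟩, fun y hy hyσ hyv => ?_⟩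
  · by_contra haσ
    exact ha.2 ⟨ha.1, (hmem a ha.1).not.1 haσ⟩
  · rw [hset]
    exact hj y ⟨hy, (hmem y hy).not.1 hyσ⟩ hyv

theorem IsRunning.append (h : IsRunning G σ s w t) (hv : IsNext G σ s w t v) :
    IsRunning G (σ ++ [v]) s w t := by
  obtain ⟨hsw, ht, hnd, σ₀, ρ, hσ, hs, h0, hρ, hfin⟩ := id h
  have hmem := fun v => h.mem_iff (v := v) hσ h0 hs hρ
  have hset : blk (skel G) s w \ {z | z ∈ σ} = blk (skel G) s w \ {z | z ∈ ρ} := by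
    ext z
    simp +contextual [hmem z]
  obtain ⟨⟨hvB, hvσ⟩, ⟨a, haσ, haB, hav⟩, hj⟩ := hv
  refine ⟨hsw, ht, ?_, σ₀, ρ ++ [v], ?_, hs, h0, ?_, hfin⟩
  · exact List.nodup_append.2 ⟨hnd, by simp, fun a ha b hb hab =>
      hvσ (List.mem_singleton.1 hb ▸ hab ▸ ha)⟩
  · rw [hσ, List.append_assoc, List.tail_append_of_ne_nil (List.ne_nil_of_mem hρ.mem_left)]
  · refine hρ.append hvB ((hmem v hvB).not.1 hvσ) ⟨a, (hmem a haB).1 haσ, hav⟩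
      fun y hy hyρ hyv => ?_
    rw [← hset]
    exact hj y hy ((hmem y hy).not.2 hyρ) hyv

/-! ### Existence of the choices -/

theorem exists_min_keyLe {S : Set ℕ} (hfin : S.Finite) (hne : S.Nonempty) :
    ∃ t ∈ S, ∀ y ∈ S, KeyLe G t y := by
  by_cases hc : ∃ t ∈ S, IsCutVertex G t
  · obtain ⟨t, ht, htc⟩ := hc
    exact ⟨t, ht, fun y _ => .inl htc⟩
  · push Not at hc
    obtain ⟨t, ht, hmin⟩ := hfin.exists_minimalFor (deg G) S hne
    refine ⟨t, ht, fun y hy => .inr ⟨hc y hy, ?_⟩⟩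
    rcases le_total (deg G t) (deg G y) with h | h
    · exact h
    · exact hmin hy h

theorem exists_isTerminal (hG : IsInputGraph G) (hsw : (skel G).Adj s w) :
    ∃ t, IsTerminal G s w t := by
  obtain ⟨t, ht, hmin⟩ := exists_min_keyLe (G := G) (S := blk (skel G) s w \ {s})
    ((hG.finite_vertices.subset (blk_subset hsw)).subset Set.sdiff_subset)
    ⟨w, right_mem_blk, hsw.1.symm⟩
  exact ⟨t, ht.1, ht.2, fun y hy hys => hmin y ⟨hy, hys⟩⟩

theorem exists_isStart (hG : IsInputGraph G) : ∃ s, IsStart G s := by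
  have hpre := hG.connected.preconnected
  by_cases hc : ∃ c, IsCutVertex G c
  · obtain ⟨B, hB, c, ⟨hc, hcB⟩, hu⟩ := exists_isEndBlock hG.finite_vertices hpre hc
    obtain ⟨y, hy, hyc⟩ := hB.nontrivial.exists_ne c
    obtain ⟨s, ⟨hs, hsc⟩, hmin⟩ := (hG.finite_vertices.subset
      fun z (hz : z ∈ V(B) \ {c}) => hB.mem_vertexSet hz.1).exists_minimalFor (deg G) (V(B) \ {c})
      ⟨y, hy, hyc⟩
    have hnc : ∀ z ∈ V(B), z ≠ c → ¬ IsCutVertex G z := fun z hz hzc hz' => hzc (hu z ⟨hz', hz⟩)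
    obtain ⟨w, hsw, -, rfl⟩ := hB.exists_eq_induce_blk hs
    refine ⟨s, hB.mem_vertexSet hs, hnc s hs hsc, w, hsw, fun y hy z hz hyc hzc =>
      (hu y ⟨hyc, hy⟩).trans (hu z ⟨hzc, hz⟩).symm, fun y hy hyc => ?_⟩
    have hyS : y ∈ V(G.induce (blk (skel G) s w)) \ {c} := ⟨hy, fun hy => hyc (hy ▸ hc)⟩
    rcases le_total (deg G s) (deg G y) with h | h
    · exact h
    · exact hmin hyS h
  · push Not at hc
    obtain ⟨s, hs, hmin⟩ := hG.finite_vertices.exists_minimalFor (deg G) V(G)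
      hG.nontrivial.nonempty
    obtain ⟨w, hsw⟩ := exists_skel_adj hpre hG.nontrivial hs
    refine ⟨s, hs, hc s, w, hsw, fun y _ _ _ hyc => absurd hyc (hc y), fun y hy _ => ?_⟩
    rcases le_total (deg G s) (deg G y) with h | h
    · exact h
    · exact hmin (blk_subset hsw hy) h

theorem exists_hasOut (hG : IsInputGraph G) (hu : u ∈ σ) (hσ : ∀ v ∈ σ, v ∈ V(G)) (hv : v ∈ V(G))
    (hvσ : v ∉ σ) : ∃ u ∈ σ, HasOut G σ u := by
  obtain ⟨a, b, hab, ha, hb, -⟩ := (preconnected_iff.1 hG.connected.preconnected u (hσ u hu) v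
    hv).exists_crossing {z | z ∈ σ} hu hvσ
  exact ⟨a, ha, b, hab, hb⟩

theorem IsRunning.exists_isSource (hG : IsInputGraph G) (h : IsRunning G σ s w t)
    (hn : σ.length < V(G).ncard) : ∃ u, IsSource G σ u := by
  obtain ⟨-, -, -, σ₀, ρ, hσ, hs, -⟩ := id h
  have hsub : {z | z ∈ σ} ⊆ V(G) := fun _ => h.mem_vertexSet
  obtain ⟨v, hv, hvσ⟩ : ∃ v ∈ V(G), v ∉ σ := by
    by_contra! hcon
    have : V(G).ncard ≤ σ.toFinset.card := by
      rw [← Set.ncard_coe_finset]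
      exact Set.ncard_le_ncard (fun z hz => by simpa using hcon z hz) (Finset.finite_toSet _)
    exact absurd (this.trans (List.toFinset_card_le σ)) (by omega)
  exact OrderedGraph.exists_isSource
    (exists_hasOut hG (u := s) (hσ ▸ List.mem_append_left _ hs) hsub hv hvσ)

theorem IsRunning.output (hG : IsInputGraph G) (h : IsRunning G σ s w t)
    (hn : V(G).ncard ≤ σ.length) : IsCombineSTOutput G σ := by
  have hall : ∀ v ∈ V(G), v ∈ σ := by
    have hsub : (σ.toFinset : Set ℕ) ⊆ V(G) := fun z hz => h.mem_vertexSet (by simpa using hz)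
    have heq := Set.eq_of_subset_of_ncard_le hsub (by
      rw [Set.ncard_coe_finset, List.toFinset_card_of_nodup h.2.2.1]; exact hn)
      hG.finite_vertices
    intro v hv
    rw [← heq] at hv
    simpa using hv
  obtain ⟨B₁, L, hc⟩ := h.complete hG fun v hv => hall v (blk_subset h.1 hv)
  exact hc.output hG.connected.preconnected hall

end Running

end OrderedGraph

/-! ### The program -/

namespace RAM

open OrderedGraph

/-- Store the value of the term in the scalar `x`. -/
def choose (t : Tm) (x : ℕ) : Program := .seq (t.compile 40) (.assign x (.var 40))

/-- Choose the terminals of a new component whose first vertex is the value of `t`. -/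
def openBlock (t : Tm) : Program :=
  .seq (choose t 3) (.seq (choose .newNbr 4) (choose .terminal 5))

/-- Scalar 2 is both the length of the order and the counter of the enclosing loop. That loop
increments it, so the new vertex is written at the current value. -/
def extend : Program :=
  .seq (choose .done 6) (.seq
    (.branch (.eq (.var 6) (.const 0)) .skip (openBlock .source))
    (.seq (choose .next 6) (.put 2 (.var 2) (.var 6))))

def combineST : Program :=
  .seq (openBlock .start) (.seq (.put 2 (.const 0) (.var 3)) (.seq (.assign 2 (.const 1))
    (.upTo 2 0 extend)))

def openTime (t : Tm) (N : ℕ) : ℕ :=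
  t.time N + 1 + (Tm.newNbr.time N + 1 + (Tm.terminal.time N + 1))

def extendTime (N : ℕ) : ℕ :=
  Tm.done.time N + 1 + (openTime .source N + 1 + (Tm.next.time N + 1 + 1))

def combineTime (N : ℕ) : ℕ := openTime .start N + (1 + (1 + (N * (extendTime N + 2) + 1)))

theorem isPoly_combineTime : IsPoly combineTime := by
  have hopen : ∀ t, IsPoly (openTime t) := fun t =>
    (t.isPoly_time.add (.const 1)).add ((Tm.newNbr.isPoly_time.add (.const 1)).add
      (Tm.terminal.isPoly_time.add (.const 1)))
  have hext : IsPoly extendTime :=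
    (Tm.done.isPoly_time.add (.const 1)).add (((hopen _).add (.const 1)).add
      ((Tm.next.isPoly_time.add (.const 1)).add (.const 1)))
  exact (hopen _).add ((IsPoly.const 1).add ((IsPoly.const 1).add
    ((IsPoly.id.mul (hext.add (.const 2))).add (.const 1))))

/-! ### Scopes of the terms: temporaries start at 40 -/

theorem Tm.scoped_terminal : Tm.terminal.Scoped 40 := by
  simp [Tm.terminal, Tm.Scoped, Tm.first, Tm.and, Tm.or, Tm.not, Tm.le, Tm.lt, Tm.eq, Tm.ex,
    Tm.all, Tm.blk, Tm.joins, Tm.adj, Tm.keyLe, Tm.cut, Tm.deg]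

theorem Tm.scoped_newNbr : Tm.newNbr.Scoped 40 := by
  simp [Tm.newNbr, Tm.Scoped, Tm.first, Tm.and, Tm.or, Tm.not, Tm.le, Tm.lt, Tm.eq, Tm.ex,
    Tm.adj, Tm.placed]

theorem Tm.scoped_done : Tm.done.Scoped 40 := by
  simp [Tm.done, Tm.Scoped, Tm.and, Tm.or, Tm.not, Tm.lt, Tm.eq, Tm.ex,
    Tm.all, Tm.blk, Tm.joins, Tm.adj, Tm.placed]

theorem Tm.scoped_source : Tm.source.Scoped 40 := by
  simp [Tm.source, Tm.Scoped, Tm.first, Tm.and, Tm.or, Tm.not, Tm.le, Tm.lt, Tm.eq, Tm.ex,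
    Tm.all, Tm.hasOut, Tm.adj, Tm.placed]

theorem Tm.scoped_next : Tm.next.Scoped 40 := by
  simp [Tm.next, Tm.Scoped, Tm.first, Tm.and, Tm.or, Tm.not, Tm.le, Tm.lt, Tm.eq, Tm.ex,
    Tm.all, Tm.outside, Tm.blk, Tm.joins, Tm.adj, Tm.placed]

theorem Tm.scoped_start : Tm.start.Scoped 40 := by
  simp [Tm.start, Tm.Scoped, Tm.first, Tm.and, Tm.or, Tm.not, Tm.le, Tm.lt, Tm.eq, Tm.ex,
    Tm.all, Tm.blk, Tm.joins, Tm.adj, Tm.cut, Tm.deg]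

/-! ### Correctness of the program -/

section Correct

variable {G : Graph ℕ ℕ} {σ : List ℕ} {s s' : Store} {t : Tm} {N x v : ℕ}

theorem Agree.trans_set {x v : ℕ} {s s' : Store} (h : Agree 40 s s') :
    Agree 40 (s.set x v) (s'.set x v) := by
  refine ⟨fun y hy => ?_, h.2⟩
  by_cases hyx : y = x
  · rw [hyx, Store.set_scalar_self, Store.set_scalar_self]
  · rw [Store.set_scalar_ne hyx, Store.set_scalar_ne hyx, h.1 y hy]

theorem choose_correct (ht : t.Scoped 40) (h0 : s.scalar 0 ≤ N) (h1 : s.scalar 1 ≤ N) :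
    Computes (choose t x) s (t.time N + 1)
      (Agree 40 (s.set x (t.eval s.array s.scalar))) := by
  refine (t.correct N 40 s (by decide) ht h0 h1).seq fun s' hs' => .assign ?_
  rw [Expr.val, hs'.2]
  exact hs'.1.trans_set

theorem Encodes.of_agree (h : Encodes G s.array s.scalar) (ha : Agree 40 s s') :
    Encodes G s'.array s'.scalar where
  vert := by rw [ha.1 0 (by decide)]; exact h.vert
  edge := by rw [ha.1 1 (by decide)]; exact h.edge
  link := by
    rw [ha.1 1 (by decide), ha.2 0 (by decide), ha.2 1 (by decide)]
    exact h.link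
  input := h.input

theorem Tracks.of_agree (h : Tracks σ s.array s.scalar) (ha : Agree 40 s s') :
    Tracks σ s'.array s'.scalar where
  len := by rw [ha.1 2 (by decide)]; exact h.len
  le := by rw [ha.1 0 (by decide)]; exact h.le
  out := by rw [ha.2 2 (by decide)]; exact h.out

/-- The memory holds the input, the partial order `σ`, and the numbers `n`, `m`. -/
structure Holds (G : Graph ℕ ℕ) (n m : ℕ) (σ : List ℕ) (s : Store) : Prop where
  encodes : Encodes G s.array s.scalar
  tracks : Tracks σ s.array s.scalar
  scalar_zero : s.scalar 0 = n
  scalar_one : s.scalar 1 = m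

variable {n m : ℕ}

theorem Holds.of_agree (h : Holds G n m σ s) (ha : Agree 40 s s') : Holds G n m σ s' where
  encodes := h.encodes.of_agree ha
  tracks := h.tracks.of_agree ha
  scalar_zero := (ha.1 0 (by decide)).trans h.scalar_zero
  scalar_one := (ha.1 1 (by decide)).trans h.scalar_one

theorem Holds.set (h : Holds G n m σ s) (hx : 3 ≤ x) : Holds G n m σ (s.set x v) where
  encodes := h.encodes.update (hx := by omega)
  tracks := h.tracks.update (hx := by omega)
  scalar_zero := by rw [Store.set_scalar_ne (by omega), h.scalar_zero]
  scalar_one := by rw [Store.set_scalar_ne (by omega), h.scalar_one]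

theorem Holds.choose (h : Holds G n m σ s) (ht : t.Scoped 40) (hx : 3 ≤ x) (hx' : x < 40)
    (hn : n ≤ N) (hm : m ≤ N) : Computes (choose t x) s (t.time N + 1) fun s' =>
      Holds G n m σ s' ∧ s'.scalar x = t.eval s.array s.scalar ∧
        ∀ y < 40, y ≠ x → s'.scalar y = s.scalar y := by
  refine (choose_correct ht (h.scalar_zero.trans_le hn) (h.scalar_one.trans_le hm)).mono le_rfl
    fun s' hs' => ⟨(h.set hx).of_agree hs', ?_, fun y hy hyx => ?_⟩
  · rw [hs'.1 x hx', Store.set_scalar_self]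
  · rw [hs'.1 y hy, Store.set_scalar_ne hyx]

theorem Holds.openBlock (h : Holds G n m σ s) (ht : t.Scoped 40) (hn : n ≤ N) (hm : m ≤ N)
    (ho : HasOut G σ (t.eval s.array s.scalar)) :
    Computes (openBlock t) s (openTime t N) fun s' => Holds G n m σ s' ∧
      s'.scalar 3 = t.eval s.array s.scalar ∧ (skel G).Adj (s'.scalar 3) (s'.scalar 4) ∧
      s'.scalar 4 ∉ σ ∧ IsTerminal G (s'.scalar 3) (s'.scalar 4) (s'.scalar 5) := by
  refine (h.choose ht le_rfl (by decide) hn hm).seq fun s₁ ⟨h₁, e₁, _⟩ => ?_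
  rw [← e₁] at ho ⊢
  refine (h₁.choose Tm.scoped_newNbr (by decide) (by decide) hn hm).seq fun s₂ ⟨h₂, e₂, e₂'⟩ => ?_
  have hw := h₁.encodes.eval_newNbr h₁.tracks ho
  rw [← e₂, ← e₂' 3 (by decide) (by decide)] at hw
  refine (h₂.choose Tm.scoped_terminal (by decide) (by decide) hn hm).mono le_rfl
    fun s₃ ⟨h₃, e₃, e₃'⟩ => ?_
  have ht := h₂.encodes.eval_terminal hw.1 (exists_isTerminal h.encodes.input hw.1)
  rw [← e₃, ← e₃' 3 (by decide) (by decide), ← e₃' 4 (by decide) (by decide)] at ht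
  rw [← e₂' 3 (by decide) (by decide), ← e₃' 3 (by decide) (by decide)]
  rw [← e₃' 3 (by decide) (by decide), ← e₃' 4 (by decide) (by decide)] at hw
  exact ⟨h₃, rfl, hw.1, hw.2, ht⟩

/-- The invariant of the main loop. -/
def LoopInv (G : Graph ℕ ℕ) (n m k : ℕ) (s : Store) : Prop :=
  ∃ σ, Holds G n m σ s ∧ σ.length = k ∧ IsRunning G σ (s.scalar 3) (s.scalar 4) (s.scalar 5)

theorem Encodes.ncard_eq (h : Encodes G s.array s.scalar) : V(G).ncard = s.scalar 0 := by
  have : {i | i < s.scalar 0} = ↑(Finset.range (s.scalar 0)) := by ext; simp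
  rw [h.vert, this, Set.ncard_coe_finset, Finset.card_range]

/-- Both branches end with an open component that has an unplaced vertex. If the old one is
finished, `k < n` and connectedness provide a vertex from which a new one is opened, and its vertex
`w` is unplaced. Then an admissible next vertex exists. -/
theorem LoopInv.extend {k : ℕ} (h : LoopInv G n m k s) (hk : k < n) (hn : n ≤ N) (hm : m ≤ N) :
    Computes extend s (extendTime N)
      fun s' => LoopInv G n m (k + 1) (s'.set 2 (s'.scalar 2 + 1)) := by
  obtain ⟨σ, h, hσk, hr⟩ := h
  have hG := h.encodes.input
  refine (h.choose Tm.scoped_done (by decide) (by decide) hn hm).seq fun s₁ ⟨h₁, e₁, e₁'⟩ => ?_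
  rw [← e₁' 3 (by decide) (by decide), ← e₁' 4 (by decide) (by decide),
    ← e₁' 5 (by decide) (by decide)] at hr
  have hdone := h.encodes.holds_done h.tracks (by
    rw [← e₁' 3 (by decide) (by decide), ← e₁' 4 (by decide) (by decide)]; exact hr.1)
  rw [Tm.Holds, ← e₁, ← e₁' 3 (by decide) (by decide), ← e₁' 4 (by decide) (by decide)] at hdone
  refine (Computes.branch (Q := fun s₂ => Holds G n m σ s₂ ∧
    IsRunning G σ (s₂.scalar 3) (s₂.scalar 4) (s₂.scalar 5) ∧
    ¬ ∀ v ∈ blk (skel G) (s₂.scalar 3) (s₂.scalar 4), v ∈ σ) (fun hc => ?_) fun hc => ?_).seq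
    fun s₂ ⟨h₂, hr₂, hnd⟩ => ?_
  · refine (Computes.skip ⟨h₁, hr, ?_⟩).mono ?_ fun _ h => h
    · unfold openTime
      omega
    · rw [← hdone]
      exact not_not.2 hc
  · obtain ⟨B₁, L, hcomp⟩ := hr.complete hG (hdone.1 hc)
    have hlt : σ.length < V(G).ncard := by
      rw [h.encodes.ncard_eq, h.scalar_zero, hσk]
      exact hk
    have hs := h₁.encodes.eval_source h₁.tracks (fun v => hr.mem_vertexSet)
      (hr.exists_isSource hG hlt)
    refine (h₁.openBlock Tm.scoped_source hn hm hs.hasOut).mono le_rfl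
      fun s₂ ⟨h₂, e₂, hsw, hw, ht⟩ => ⟨h₂, ?_, fun hall => hw (hall _ right_mem_blk)⟩
    rw [← e₂] at hs
    exact hcomp.isRunning hG hs hsw hw ht
  · refine (h₂.choose Tm.scoped_next (by decide) (by decide) hn hm).seq
      fun s₃ ⟨h₃, e₃, e₃'⟩ => .put ?_
    have hnext := h₂.encodes.eval_next h₂.tracks hr₂.1 (hr₂.exists_isNext hG hnd)
    rw [← e₃] at hnext
    have hr₃ := hr₂.append hnext
    have hlen : s₃.scalar 2 = k := h₃.tracks.len.trans hσk
    refine ⟨σ ++ [s₃.scalar 6], ⟨?_, ⟨?_, ?_, ?_⟩, ?_, ?_⟩, by simp [hσk], ?_⟩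
    · exact ⟨h₃.encodes.vert, h₃.encodes.edge, h₃.encodes.link, hG⟩
    · simp [hlen, hσk]
    · have : s₃.scalar 0 = n := h₃.scalar_zero
      simp [Store.set_scalar_ne, this, hσk]
      exact hk
    · intro i hi
      rw [List.length_append, List.length_singleton] at hi
      simp only [Store.set_array, Store.write_array_self, Expr.val, hlen, Function.update_apply]
      split_ifs with hik
      · subst hik
        simp [← hσk]
      · rw [List.getElem_append_left (by omega)]
        exact h₃.tracks.out i (by omega)
    · simpa [Store.set_scalar_ne] using h₃.scalar_zero
    · simpa [Store.set_scalar_ne] using h₃.scalar_one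
    · simpa [Store.set_scalar_ne, e₃' 3, e₃' 4, e₃' 5] using hr₃

theorem combineST_correct (h : Holds G n m [] s) :
    Computes combineST s (combineTime (n + m)) fun s' => IsCombineSTOutput G (listOutput n s') := by
  have hn : n ≤ n + m := Nat.le_add_right n m
  have hm : m ≤ n + m := Nat.le_add_left m n
  have hG := h.encodes.input
  have hcard : V(G).ncard = n := by rw [h.encodes.ncard_eq, h.scalar_zero]
  have hs := h.encodes.eval_start (exists_isStart hG)
  have ho : HasOut G [] (Tm.start.eval s.array s.scalar) := by
    obtain ⟨w, hw⟩ := exists_skel_adj hG.connected.preconnected hG.nontrivial hs.1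
    exact ⟨w, hw, by simp⟩
  refine (h.openBlock Tm.scoped_start hn hm ho).seq fun s₁ ⟨h₁, e₁, hsw, _, ht⟩ => ?_
  rw [← e₁] at hs
  refine (Computes.put (Q := (· = s₁.write 2 0 (s₁.scalar 3))) rfl).seq ?_
  rintro _ rfl
  refine (Computes.assign (Q := (· = (s₁.write 2 0 (s₁.scalar 3)).set 2 1)) rfl).seq ?_
  rintro _ rfl
  have h2 : 2 ≤ n := hcard ▸ hG.two_le_card
  refine (Computes.upTo (N := n) (i := 1) (T := extendTime (n + m)) (LoopInv G n m) ?_ ?_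
    (by omega) ?_).mono ?_ ?_
  · rintro j s' ⟨σ, h', rfl, -⟩
    exact ⟨h'.tracks.len, h'.scalar_zero⟩
  · exact fun j s' hj h' => h'.extend hj hn hm
  · refine ⟨[s₁.scalar 3], ⟨?_, ⟨?_, ?_, ?_⟩, ?_, ?_⟩, rfl, ?_⟩
    · exact ⟨h₁.encodes.vert, h₁.encodes.edge, h₁.encodes.link, hG⟩
    · simp
    · have : s₁.scalar 0 = n := h₁.scalar_zero
      simp [Store.set_scalar_ne, this]
      omega
    · intro i hi
      obtain rfl : i = 0 := by simpa using hi
      simp [Store.write_array_self]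
    · simpa [Store.set_scalar_ne] using h₁.scalar_zero
    · simpa [Store.set_scalar_ne] using h₁.scalar_one
    · simpa [Store.set_scalar_ne] using IsRunning.start hG hs hsw ht
  · have := Nat.mul_le_mul_right (extendTime (n + m) + 2) (show n - 1 ≤ n + m by omega)
    omega
  · rintro s' ⟨σ, h', hσ, hr⟩
    have : listOutput n s' = σ := by
      refine List.ext_getElem (by simp [listOutput, hσ]) fun i hi hi' => ?_
      simp [listOutput, h'.tracks.out i hi']
    rw [this]
    exact hr.output hG (by omega)

theorem holds_graphInput {src tgt : ℕ → ℕ} (hV : V(G) = {i | i < n}) (hE : E(G) = {k | k < m})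
    (hlink : ∀ k < m, G.IsLink k (src k) (tgt k)) (hG : IsInputGraph G) :
    Holds G n m [] (graphInput n m src tgt) where
  encodes := ⟨hV, hE, fun k (hk : k < m) => by simpa [graphInput, hk] using hlink k hk, hG⟩
  tracks := ⟨rfl, Nat.zero_le _, fun i hi => absurd hi (by simp)⟩
  scalar_zero := rfl
  scalar_one := rfl

end Correct

end RAM
-- The main theorem
theorem mainTheorem10 :
    (∀ (α : Type u) (β : Type v) (G : Graph α β), OrderedGraph.IsInputGraph G →
      ∀ σ : List α, OrderedGraph.IsCombineSTOutput G σ → OrderedGraph.IsOptimalOrder G σ) ∧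
    (∃ (P : RAM.Program) (p : Polynomial ℕ),
      ∀ (n m : ℕ) (src tgt : ℕ → ℕ) (G : Graph ℕ ℕ),
        V(G) = {i | i < n} → E(G) = {k | k < m} → (∀ k < m, G.IsLink k (src k) (tgt k)) →
        OrderedGraph.IsInputGraph G →
        ∃ (steps : ℕ) (final : RAM.Store),
          RAM.Run P (RAM.graphInput n m src tgt) steps final ∧
          steps ≤ p.eval (n + m) ∧
          OrderedGraph.IsCombineSTOutput G (RAM.listOutput n final) ∧
          OrderedGraph.IsOptimalOrder G (RAM.listOutput n final)) := by
  obtain ⟨p, hp⟩ := RAM.isPoly_combineTime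
  refine ⟨fun α β G hG σ h => h.isOptimalOrder hG, RAM.combineST, p, ?_⟩
  intro n m src tgt G hV hE hlink hG
  obtain ⟨steps, final, hrun, hsteps, hout⟩ :=
    RAM.combineST_correct (RAM.holds_graphInput hV hE hlink hG)
  exact ⟨steps, final, hrun, hp _ ▸ hsteps, hout, hout.isOptimalOrder hG⟩
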